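/- **High-accuracy $\ell_2$ regression in the coordinator model.** *Model.* There are $s$ machines and a coordinator without input. Each machine is joined to the coordinator by a private two-way channel, all parties share a random seed, and local computation is unrestricted. The communication cost of an execution is the total number of bits that cross the channels, in either direction. Which end of a channel sends the next bit is determined by the seed and by the bits that have crossed that channel so far; what a machine sends depends on the seed, its own input and the bits on its own channel; what the coordinator does depends on the seed and on the bits on all channels. *Setting.* Machine $i\in\{1,\dots,s\}$ holds $A^{(i)}\in\mathbb R^{n_i\times d}$ and $b^{(i)}\in\mathbb R^{n_i}$. Let $A=[A^{(i)}]\in\mathbb R^{n\times d}$ and $b=[b^{(i)}]\in\mathbb R^{n}$ be obtained by stacking, $n=\sum_i n_i$. Every entry of $A$ and $b$ has at most $L$ bits before and at most $L$ bits after the binary point, i.e. it is of the form $z/2^L$ with $z\in\mathbb Z$, $|z|<2^{2L}$. With $M^\dagger$ the Moore–Penrose inverse and $\|M\|_2$ the spectral norm of a matrix $M$, the condition number $\|A\|_2\|A^\dagger\|_2$ of $A$ is at most $\kappa$, where $\kappa\ge 1$. The numbers $s,n,d,L,\kappa,\varepsilon$ are known to all parties. *Theorem.* For every constant $C\in\mathbb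 N$ there are constants $K>0$ and $p\in\mathbb N$, depending only on $C$, such that for all $s,n,d,L\in\mathbb N$, $\kappa\ge1$ and $\varepsilon>0$ there is a randomized protocol with the following properties for every input as above. 1. On every seed the protocol ends after at most $$K\Bigl(sd\,(L+\log\kappa)\,\max\{1,\log\varepsilon^{-1}\}+d^2L\Bigr)\Bigl(\log(3+sndL)\cdot\log\bigl(3+\log(\kappa\max\{1,\varepsilon^{-1}\})\bigr)\Bigr)^{p}$$ bits of communication; that is, it uses $\widetilde O\bigl(sd(L+\log\kappa)\log(\varepsilon^{-1})+d^2L\bigr)$ bits, where $\widetilde O$ hides factors polylogarithmic in $sndL$ and in $\log(\kappa\varepsilon^{-1})$. 2. With probability at least $1-n^{-C}$, at the end the coordinator and all the machines know one and the same vector $\widehat x\in\mathbb R^d$, and $$\|A\widehat x-b\|_2\le\varepsilon\,\bigl\|A(A^\top A)^{\dagger}A^\top b\bigr\|_2+\min_{x\in\mathbb R^d}\|Ax-b\|_2 .$$ -/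

import Mathlib

open scoped Matrix

/-! ### Communication protocols in the coordinator model -/

/-- A randomized protocol with shared randomness in the coordinator model, with `s` machines, each
holding an input in `X`, and a coordinator that holds no input; every party produces an output
in `Y`.  Local computation is unrestricted.

Machine `i` and the coordinator are joined by a private two-way channel, and the
transcript of a channel is the chronological list of the bits that have crossed it, in either
direction. All parties see the shared random seed, which has the law `law`.
* `speaks ω i τ` says whether, when the transcript of its channel is `τ`, machine `i` is the one
  to send the next bit on that channel.  It depends only on what both ends of the channel know, so
  that no information is conveyed by silence or by message boundaries.
* `machine ω i x τ` is the bit that machine `i`, holding `x`, then sends.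
* `coordinator ω T` is what the coordinator does when all the channel transcripts are `T` and no
  machine is to speak: it sends the bit `c` to machine `i` (`some (i, c)`) or ends the protocol
  (`none`).
* `machineOut`, `coordinatorOut` are the outputs, computed from what the party knows at the end. -/
structure CoordinatorProtocol (s : ℕ) (X Y : Type) where
  Seed : Type
  law : PMF Seed
  speaks : Seed → Fin s → List Bool → Bool
  machine : Seed → Fin s → X → List Bool → Bool
  coordinator : Seed → (Fin s → List Bool) → Option (Fin s × Bool)
  machineOut : Seed → Fin s → X → List Bool → Y
  coordinatorOut : Seed → (Fin s → List Bool) → Y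

namespace CoordinatorProtocol

variable {s : ℕ} {X Y : Type} (P : CoordinatorProtocol s X Y)

/-- The next bit to be communicated and its channel; `none` if the protocol has ended. If several
machines are to speak, they do so in the order of their indices; what any of
them sends does not depend on this order. -/
def next (ω : P.Seed) (x : Fin s → X) (T : Fin s → List Bool) : Option (Fin s × Bool) :=
  match (List.finRange s).find? (fun i => P.speaks ω i (T i)) with
  | some i => some (i, P.machine ω i (x i) (T i))
  | none => P.coordinator ω T

/-- One step of the execution: the next bit is appended to the transcript of its channel. -/
def step (ω : P.Seed) (x : Fin s → X) (T : Fin s → List Bool) : Fin s → List Bool :=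
  match P.next ω x T with
  | some (i, c) => Function.update T i (T i ++ [c])
  | none => T

/-- `P.EndsWith ω x T`: on seed `ω` and inputs `x` the protocol ends, with channel
transcripts `T`. -/
def EndsWith (ω : P.Seed) (x : Fin s → X) (T : Fin s → List Bool) : Prop :=
  (∃ t : ℕ, (P.step ω x)^[t] (fun _ => []) = T) ∧ P.next ω x T = none

end CoordinatorProtocol

/-- The total number of bits sent or received by the coordinator. -/
def bitCount {s : ℕ} (T : Fin s → List Bool) : ℕ := ∑ i, (T i).length

/-! ### Moore–Penrose inverse and condition number of a real matrix -/

/-- The four Penrose conditions. -/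
structure IsMoorePenrose {m n : Type*} [Fintype m] [Fintype n]
    (A : Matrix m n ℝ) (B : Matrix n m ℝ) : Prop where
  mul_mul_self : A * B * A = A
  mul_mul_inv : B * A * B = B
  transpose_left : (A * B)ᵀ = A * B
  transpose_right : (B * A)ᵀ = B * A

theorem IsMoorePenrose.unique {m n : Type*} [Fintype m] [Fintype n]
    {A : Matrix m n ℝ} {B C : Matrix n m ℝ}
    (hB : IsMoorePenrose A B) (hC : IsMoorePenrose A C) : B = C := by
  have h1 : A * B = A * C := by
    calc A * B = (A * B)ᵀ := hB.transpose_left.symm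
      _ = ((A * C) * (A * B))ᵀ := by
          rw [← Matrix.mul_assoc (A * C), hC.mul_mul_self]
      _ = (A * B) * (A * C) := by
          rw [Matrix.transpose_mul, hB.transpose_left, hC.transpose_left]
      _ = A * C := by rw [← Matrix.mul_assoc (A * B), hB.mul_mul_self]
  have h2 : B * A = C * A := by
    calc B * A = (B * A)ᵀ := hB.transpose_right.symm
      _ = ((B * A) * (C * A))ᵀ := by
          rw [Matrix.mul_assoc B A, ← Matrix.mul_assoc A C A, hC.mul_mul_self]
      _ = (C * A) * (B * A) := by
          rw [Matrix.transpose_mul, hB.transpose_right, hC.transpose_right]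
      _ = C * A := by rw [Matrix.mul_assoc C A, ← Matrix.mul_assoc A B A, hB.mul_mul_self]
  calc B = B * A * B := hB.mul_mul_inv.symm
    _ = C * A * C := by rw [h2, Matrix.mul_assoc, h1, ← Matrix.mul_assoc]
    _ = C := hC.mul_mul_inv

theorem exists_isMoorePenrose {m n : Type*} [Fintype m] [Fintype n]
    (A : Matrix m n ℝ) : ∃ B, IsMoorePenrose A B := by
  classical
  have hH : (Aᵀ * A).IsHermitian := by
    have := Matrix.isHermitian_conjTranspose_mul_self A
    rwa [Matrix.conjTranspose_eq_transpose_of_trivial] at this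
  obtain ⟨S, hST, hHSH, hSHS, hcomm⟩ : ∃ S : Matrix n n ℝ, Sᵀ = S ∧
      (Aᵀ * A) * S * (Aᵀ * A) = Aᵀ * A ∧ S * (Aᵀ * A) * S = S ∧
      (Aᵀ * A) * S = S * (Aᵀ * A) := by
    set U : Matrix n n ℝ := (hH.eigenvectorUnitary : Matrix n n ℝ) with hU
    set l := hH.eigenvalues with hl
    have hUU : star U * U = 1 := Unitary.coe_star_mul_self hH.eigenvectorUnitary
    have hspec : Aᵀ * A = U * Matrix.diagonal l * star U := by
      have := hH.spectral_theorem
      rw [Unitary.conjStarAlgAut_apply] at this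
      simpa [hU, hl, Function.comp_def] using this
    have key : ∀ a b : n → ℝ, (U * Matrix.diagonal a * star U) * (U * Matrix.diagonal b * star U)
        = U * Matrix.diagonal (fun i => a i * b i) * star U := by
      intro a b
      calc _ = U * Matrix.diagonal a * (star U * U) * Matrix.diagonal b * star U := by
            simp only [Matrix.mul_assoc]
        _ = _ := by rw [hUU, Matrix.mul_one, Matrix.mul_assoc U, Matrix.diagonal_mul_diagonal]
    refine ⟨U * Matrix.diagonal (fun i => (l i)⁻¹) * star U, ?_, ?_, ?_, ?_⟩
    · simp [Matrix.star_eq_conjTranspose, Matrix.transpose_mul, Matrix.mul_assoc]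
    · rw [hspec, key, key]
      congr 3; ext i; exact mul_inv_mul_cancel (l i)
    · rw [hspec, key, key]
      congr 3; ext i
      simpa using mul_inv_mul_cancel (l i)⁻¹
    · rw [hspec, key, key]
      congr 3; ext i; exact mul_comm _ _
  refine ⟨S * Aᵀ, ?_, ?_, ?_, ?_⟩
  · have h0 : Aᵀ * A * (S * (Aᵀ * A) - 1) = 0 := by
      rw [Matrix.mul_sub, ← Matrix.mul_assoc, hHSH, Matrix.mul_one, sub_self]
    have h1 : A * (S * (Aᵀ * A) - 1) = 0 := by
      have := (Matrix.conjTranspose_mul_self_mul_eq_zero A (S * (Aᵀ * A) - 1)).1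
      rw [Matrix.conjTranspose_eq_transpose_of_trivial] at this
      exact this h0
    rw [Matrix.mul_sub, Matrix.mul_one, sub_eq_zero] at h1
    simpa only [Matrix.mul_assoc] using h1
  · calc S * Aᵀ * A * (S * Aᵀ) = S * (Aᵀ * A) * S * Aᵀ := by simp only [Matrix.mul_assoc]
      _ = S * Aᵀ := by rw [hSHS]
  · simp only [Matrix.transpose_mul, Matrix.transpose_transpose, hST, Matrix.mul_assoc]
  · rw [Matrix.mul_assoc, Matrix.transpose_mul, hST, Matrix.transpose_mul,
      Matrix.transpose_transpose, hcomm]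

/-- The Moore–Penrose inverse `A†`. -/
noncomputable def pinv {m n : Type*} [Fintype m] [Fintype n] (A : Matrix m n ℝ) : Matrix n m ℝ :=
  (exists_isMoorePenrose A).choose

theorem isMoorePenrose_pinv {m n : Type*} [Fintype m] [Fintype n] (A : Matrix m n ℝ) :
    IsMoorePenrose A (pinv A) :=
  (exists_isMoorePenrose A).choose_spec

open scoped Matrix.Norms.L2Operator in
/-- The condition number `‖A‖₂ ‖A†‖₂`, with the spectral norm (largest singular value). -/
noncomputable def condNumber {m n : Type*} [Fintype m] [DecidableEq m] [Fintype n] [DecidableEq n]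
    (A : Matrix m n ℝ) : ℝ :=
  ‖A‖ * ‖pinv A‖

/-! ### Distributed least squares -/

/-- The Euclidean norm of a real vector. -/
noncomputable def l2norm {m : Type*} [Fintype m] (v : m → ℝ) : ℝ := ‖WithLp.toLp 2 v‖

/-- `x` has at most `L` bits before and at most `L` bits after the binary point. -/
def IsFixedPoint (L : ℕ) (x : ℝ) : Prop := ∃ z : ℤ, |z| < 2 ^ (2 * L) ∧ x = z / 2 ^ L

/-- What a single machine holds: a number of rows, and that many rows of the matrix and entries
of the right-hand side. -/
abbrev LocalData (d : ℕ) : Type := Σ k : ℕ, Matrix (Fin k) (Fin d) ℝ × (Fin k → ℝ)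

/-- The rows `A⁽¹⁾, …, A⁽ˢ⁾` stacked; row `j` of machine `i` has the index `⟨i, j⟩`. -/
def stackMatrix {s d : ℕ} (D : Fin s → LocalData d) :
    Matrix (Σ i : Fin s, Fin (D i).1) (Fin d) ℝ :=
  Matrix.of fun p j => (D p.1).2.1 p.2 j

/-- The right-hand sides `b⁽¹⁾, …, b⁽ˢ⁾` stacked. -/
def stackVector {s d : ℕ} (D : Fin s → LocalData d) : (Σ i : Fin s, Fin (D i).1) → ℝ :=
  fun p => (D p.1).2.2 p.2

/-- `‖A x - b‖ ≤ ε ‖A (Aᵀ A)† Aᵀ b‖ + min_y ‖A y - b‖`. -/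
def IsHighAccuracySolution {m : Type*} [Fintype m] {d : ℕ} (ε : ℝ)
    (A : Matrix m (Fin d) ℝ) (b : m → ℝ) (x : Fin d → ℝ) : Prop :=
  l2norm (A *ᵥ x - b) ≤
    ε * l2norm ((A * pinv (Aᵀ * A) * Aᵀ) *ᵥ b) + ⨅ y : Fin d → ℝ, l2norm (A *ᵥ y - b)

/-! The coordinator first finds a matrix `P` that is spectrally close to `AᵀA + λ`, paying about
`d²L` bits for rows and `sd(L + log κ)` for sketches. It then runs a preconditioned Richardson
iteration in which every round costs `sd(L + log κ)` bits up to logarithms and halves the error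
bound.

Regularization. A nonzero entry of `A` is at least `2^(-L)`, so `‖A‖` is too, and the condition
number forces every nonzero singular value above about `2^(-L)/κ`. A `λ` below the square of this by
a factor 256 is invisible on the row space, yet makes all matrices positive definite
(`exists_preimage_of_condNumber_le`).

Preconditioner. Rows are sampled with probability proportional to overestimates of their leverage
scores, and a matrix Chernoff bound (`prob_sampling_bad`, resting on the Golden–Thompson inequality
`trace_exp_add_le`) shows that the reweighted sample approximates the Gram matrix up to `1 ± 1/16`.
The overestimates come from repeated halving: leverage with respect to a uniformly random half of
the rows is an overestimate, and truncated at 1 it has expected sum at most `3d`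
(`avg_sum_min_lev_le`). Hence a chain of random halves, starting from no rows at all, where each
level is sampled with the help of the approximation of the level below. The machines do not learn
the previous matrix `M`, which would be too expensive, but only polylogarithmically many rounded
random vectors `C g` with `Cᵀ M C = 1`. As leverage is `|Cᵀ a|²`, such projections are large enough
with high probability. Sampled rows are sent exactly, and their number is bounded by Markov's
inequality only; so a trial that would exceed the cap is aborted and independent trials are
repeated. The approximation is asked to hold in all trials at once, so that the choice of a trial
that did not abort does no harm.

Iteration. With `P` between `AᵀA + λ` and `17/15` of it, a Richardson step contracts `‖A(x - x*)‖`
by `3/8` (`Preconditions.contraction`), which leaves room for rounding errors of relative size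
`1/16`, so the bound on the error halves. The scale of the error is known in advance: `AᵀA x* = Aᵀb`
is transmitted exactly, and its leverage with respect to `P` gives `‖A x*‖` up to a constant
(`scale_bounds`). In round `k` everything is therefore rounded to grids proportional to `2^(σ-k)`.
The machines send only the change of their rounded gradients, relative to the finer grid; this is an
integer whose length does not grow with `k` (`Fits.abs_answer_lt`), and that is what keeps the
factor `L + log κ` from being multiplied by a second `log ε⁻¹`.

Model. The algorithm is written as a program of broadcasts and questions and compiled into bits in
such a way that each bit of the coordinator is answered by one bit. Every machine decodes all
broadcasts, and the output is a function of the broadcasts, so all parties agree on it. -/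

/-! ### Bit-level programs -/

/-- A program of the coordinator at the level of bits: it sends a bit to a machine, gets one bit in
reply, and goes on depending on the reply. -/
inductive BitProg (s : ℕ) (α : Type) : Type
  | done (a : α) : BitProg s α
  | query (i : Fin s) (c : Bool) (k : Bool → BitProg s α) : BitProg s α

namespace BitProg

variable {s : ℕ} {α : Type}

/-- The result of the program on given channel transcripts, or the bit to be sent next. -/
def sim : BitProg s α → (Fin s → List Bool) → (Fin s × Bool) ⊕ α
  | done a, _ => Sum.inr a
  | query i c k, T =>
    match T i with
    | [] => Sum.inl (i, c)
    -- A default: transcripts are consumed in pairs, and on an odd one it is the machine's turn.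
    | [_] => Sum.inl (i, c)
    | _ :: r :: rest => (k r).sim (Function.update T i rest)

/-- The execution when machine `i` answers `f i R` after having received the bits `R`. -/
def run (f : Fin s → List Bool → Bool) : BitProg s α → (Fin s → List Bool) →
    α × (Fin s → List Bool)
  | done a, R => (a, R)
  | query i c k, R => (k (f i (R i ++ [c]))).run f (Function.update R i (R i ++ [c]))

/-- The entries at even positions. -/
def evens : List Bool → List Bool
  | [] => []
  | [c] => [c]
  | c :: _ :: rest => c :: evens rest

theorem evens_append (l₁ l₂ : List Bool) (h : l₁.length % 2 = 0) :
    evens (l₁ ++ l₂) = evens l₁ ++ evens l₂ := by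
  induction l₁ using evens.induct with
  | case1 => rfl
  | case2 c => simp at h
  | case3 c r rest ih =>
    simp only [List.length_cons] at h
    simp only [List.cons_append, evens]
    rw [ih (by omega)]

theorem two_mul_length_evens (l : List Bool) (h : l.length % 2 = 0) :
    2 * (evens l).length = l.length := by
  induction l using evens.induct with
  | case1 => rfl
  | case2 c => simp at h
  | case3 c r rest ih =>
    simp only [List.length_cons] at h
    simp only [evens, List.length_cons]
    have := ih (by omega)
    omega

variable {X Y Ω : Type}

/-- The protocol that executes a bit-level program. -/
def toProtocol (law : PMF Ω) (prog : Ω → BitProg s Y) (f : Ω → Fin s → X → List Bool → Bool)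
    (out : Ω → Fin s → X → List Bool → Y) (y₀ : Y) : CoordinatorProtocol s X Y where
  Seed := Ω
  law := law
  speaks := fun _ _ τ => τ.length % 2 == 1
  machine := fun ω i x τ => f ω i x (evens τ)
  coordinator := fun ω T => (prog ω).sim T |>.elim some (fun _ => none)
  machineOut := fun ω i x τ => out ω i x (evens τ)
  coordinatorOut := fun ω T => (prog ω).sim T |>.elim (fun _ => y₀) id

theorem toProtocol_next_even (law : PMF Ω) (prog : Ω → BitProg s Y)
    (f : Ω → Fin s → X → List Bool → Bool)
    (out : Ω → Fin s → X → List Bool → Y) (y₀ : Y) (ω : Ω) (x : Fin s → X)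
    (T : Fin s → List Bool) (hT : ∀ i, (T i).length % 2 = 0) :
    (toProtocol law prog f out y₀).next ω x T
      = ((prog ω).sim T).elim some (fun _ => none) := by
  unfold CoordinatorProtocol.next
  have : (List.finRange s).find? (fun i => (toProtocol law prog f out y₀).speaks ω i (T i))
      = none := by
    rw [List.find?_eq_none]
    intro i _
    simp [toProtocol, hT i]
  rw [this]
  rfl

theorem toProtocol_next_odd (law : PMF Ω) (prog : Ω → BitProg s Y)
    (f : Ω → Fin s → X → List Bool → Bool)
    (out : Ω → Fin s → X → List Bool → Y) (y₀ : Y) (ω : Ω) (x : Fin s → X)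
    (T : Fin s → List Bool) (i : Fin s) (hi : (T i).length % 2 = 1)
    (hT : ∀ j, j ≠ i → (T j).length % 2 = 0) :
    (toProtocol law prog f out y₀).next ω x T = some (i, f ω i (x i) (evens (T i))) := by
  unfold CoordinatorProtocol.next
  have : (List.finRange s).find? (fun i => (toProtocol law prog f out y₀).speaks ω i (T i))
      = some i := by
    cases h : (List.finRange s).find? (fun i => (toProtocol law prog f out y₀).speaks ω i (T i)) with
    | none =>
      rw [List.find?_eq_none] at h
      have := h i (List.mem_finRange i)
      simp [toProtocol, hi] at this
    | some j =>
      have := List.find?_some h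
      by_contra hne
      have hji : j ≠ i := fun e => hne (by rw [e])
      simp [toProtocol, hT j hji] at this
  rw [this]
  rfl

theorem step_of_next {P : CoordinatorProtocol s X Y} {ω : P.Seed} {x : Fin s → X}
    {T : Fin s → List Bool} {i : Fin s} {c : Bool} (h : P.next ω x T = some (i, c)) :
    P.step ω x T = Function.update T i (T i ++ [c]) := by
  unfold CoordinatorProtocol.step
  rw [h]

/-- The invariant says that the transcripts `T` have brought the program exactly to the remainder
`p`. It has to be stated for all continuations `E`, since the coordinator keeps no state and replays
the whole transcript before each bit. One query amounts to two protocol steps, after which all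
lengths are even again. -/
theorem exists_steps (law : PMF Ω) (prog : Ω → BitProg s Y)
    (f : Ω → Fin s → X → List Bool → Bool)
    (out : Ω → Fin s → X → List Bool → Y) (y₀ : Y) (ω : Ω) (x : Fin s → X) (p : BitProg s Y) :
    ∀ (T : Fin s → List Bool), (∀ i, (T i).length % 2 = 0) →
      (∀ E : Fin s → List Bool, (prog ω).sim (fun i => T i ++ E i) = p.sim E) →
      ∃ t : ℕ, ∃ T' : Fin s → List Bool,
        ((toProtocol law prog f out y₀).step ω x)^[t] T = T' ∧ (∀ i, (T' i).length % 2 = 0) ∧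
        (prog ω).sim T' = Sum.inr (p.run (fun i => f ω i (x i)) (fun i => evens (T i))).1 ∧
        (fun i => evens (T' i)) = (p.run (fun i => f ω i (x i)) (fun i => evens (T i))).2 := by
  induction p with
  | done a =>
    intro T hT hsim
    refine ⟨0, T, rfl, hT, ?_, rfl⟩
    have := hsim (fun _ => [])
    simp only [List.append_nil] at this
    exact this
  | query i c k ih =>
    intro T hT hsim
    set r := f ω i (x i) (evens (T i) ++ [c]) with hr
    set T₁ := Function.update T i (T i ++ [c]) with hT₁
    set T₂ := Function.update T i (T i ++ [c, r]) with hT₂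
    have hs1 : (toProtocol law prog f out y₀).step ω x T = T₁ := by
      refine step_of_next ((toProtocol_next_even law prog f out y₀ ω x T hT).trans ?_)
      have := hsim (fun _ => [])
      simp only [List.append_nil] at this
      change (prog ω).sim T = _ at this
      rw [this]
      simp [sim]
    have hs2 : (toProtocol law prog f out y₀).step ω x T₁ = T₂ := by
      refine (step_of_next (toProtocol_next_odd law prog f out y₀ ω x T₁ i ?_ ?_)).trans ?_
      · simp [hT₁]; have := hT i; omega
      · intro j hj
        simp [hT₁, hj, hT j]
      · simp [hT₁, hT₂, hr, evens_append _ _ (hT i), evens]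
    have hev : (fun j => evens (T₂ j))
        = Function.update (fun j => evens (T j)) i (evens (T i) ++ [c]) := by
      funext j
      by_cases hj : j = i
      · subst hj
        simp [hT₂, evens_append _ _ (hT j), evens]
      · simp [hT₂, hj]
    obtain ⟨t, T', h1, h2, h3, h4⟩ := ih r T₂ (by
        intro j
        by_cases hj : j = i
        · subst hj
          simp [hT₂]; have := hT j; omega
        · simp [hT₂, hj, hT j]) (by
        intro E
        have := hsim (fun j => if j = i then c :: r :: E i else E j)
        rw [sim] at this
        simp only [if_true] at this
        rw [show (fun j => T₂ j ++ E j) = (fun j => T j ++ if j = i then c :: r :: E i else E j) by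
          funext j
          by_cases hj : j = i
          · subst hj; simp [hT₂]
          · simp [hT₂, hj], this]
        congr 1
        funext j
        by_cases hj : j = i
        · subst hj; simp
        · simp [hj])
    refine ⟨t + 2, T', ?_, h2, ?_, ?_⟩
    · rw [Function.iterate_add_apply]
      simp only [Function.iterate_succ, Function.iterate_zero, Function.comp, id]
      rw [hs1, hs2, h1]
    · rw [h3, hev]
      simp only [run, hr]
    · rw [h4, hev]
      simp only [run, hr]

theorem toProtocol_endsWith (law : PMF Ω) (prog : Ω → BitProg s Y)
    (f : Ω → Fin s → X → List Bool → Bool)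
    (out : Ω → Fin s → X → List Bool → Y) (y₀ : Y) (ω : Ω) (x : Fin s → X) :
    ∃ T, (toProtocol law prog f out y₀).EndsWith ω x T ∧
      bitCount T = 2 * ∑ i, (((prog ω).run (fun i => f ω i (x i)) (fun _ => [])).2 i).length ∧
      (toProtocol law prog f out y₀).coordinatorOut ω T
        = ((prog ω).run (fun i => f ω i (x i)) (fun _ => [])).1 ∧
      ∀ i, (toProtocol law prog f out y₀).machineOut ω i (x i) (T i)
        = out ω i (x i) (((prog ω).run (fun i => f ω i (x i)) (fun _ => [])).2 i) := by
  obtain ⟨t, T, h1, h2, h3, h4⟩ := exists_steps law prog f out y₀ ω x (prog ω) (fun _ => [])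
    (by simp) (by simp)
  simp only [evens] at h3 h4
  refine ⟨T, ⟨⟨t, h1⟩, ?_⟩, ?_, ?_, ?_⟩
  · rw [toProtocol_next_even law prog f out y₀ ω x T h2, h3]
    rfl
  · rw [← h4, bitCount, Finset.mul_sum]
    exact Finset.sum_congr rfl fun i _ => (two_mul_length_evens _ (h2 i)).symm
  · simp [toProtocol, h3]
  · intro i
    simp [toProtocol, ← h4]

end BitProg

/-! ### Binary codes of finite types -/

/-- A code word of length `k` for an element of a finite type. -/
noncomputable def encodeBits {X : Type} [Fintype X] (k : ℕ) (x : X) : List Bool :=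
  List.ofFn fun i : Fin k => ((Fintype.equivFin X x : Fin _) : ℕ).testBit i

open Classical in
/-- The element with a given code word. -/
noncomputable def decodeBits {X : Type} [Fintype X] (k : ℕ) (l : List Bool) : Option X :=
  if h : ∃ x : X, encodeBits k x = l then some h.choose else none

section
variable {X : Type} [Fintype X] {k : ℕ}

@[simp] theorem length_encodeBits (x : X) : (encodeBits k x).length = k := by
  simp [encodeBits]

theorem encodeBits_injective (hk : Fintype.card X ≤ 2 ^ k) :
    Function.Injective (encodeBits k : X → List Bool) := by
  intro x y h
  have h1 := List.ofFn_injective h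
  apply (Fintype.equivFin X).injective
  apply Fin.ext
  apply Nat.eq_of_testBit_eq
  intro i
  by_cases hi : i < k
  · exact congrFun h1 ⟨i, hi⟩
  · have hle : (2 : ℕ) ^ k ≤ 2 ^ i := Nat.pow_le_pow_right (by norm_num) (by omega)
    rw [Nat.testBit_lt_two_pow (lt_of_lt_of_le (Fin.is_lt _) (hk.trans hle)),
      Nat.testBit_lt_two_pow (lt_of_lt_of_le (Fin.is_lt _) (hk.trans hle))]

theorem decodeBits_encodeBits (hk : Fintype.card X ≤ 2 ^ k) (x : X) :
    decodeBits k (encodeBits k x) = some x := by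
  unfold decodeBits
  have h : ∃ y : X, encodeBits k y = encodeBits k x := ⟨x, rfl⟩
  rw [dif_pos h]
  exact congrArg some (encodeBits_injective hk h.choose_spec)

theorem decodeBits_eq_none {l : List Bool} (h : l.length ≠ k) :
    decodeBits (X := X) k l = none := by
  unfold decodeBits
  rw [dif_neg]
  rintro ⟨x, rfl⟩
  exact h (length_encodeBits x)

end

/-! ### Programs with broadcasts and questions -/

/-- A program of the coordinator: it broadcasts an element of `V` to all machines, or asks
machine `i` the question `q`, to be answered with `rl q` bits. -/
inductive Prog (s : ℕ) (V Q : Type) (rl : Q → ℕ) (α : Type) : Type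
  | ret (a : α) : Prog s V Q rl α
  | bcast (v : V) (k : Prog s V Q rl α) : Prog s V Q rl α
  | ask (i : Fin s) (q : Q) (k : Fin (2 ^ rl q) → Prog s V Q rl α) : Prog s V Q rl α

namespace Prog

variable {s : ℕ} {V Q : Type} {rl : Q → ℕ} {α β : Type}

/-- Sequential composition. -/
def bind : Prog s V Q rl α → (α → Prog s V Q rl β) → Prog s V Q rl β
  | ret a, f => f a
  | bcast v k, f => bcast v (k.bind f)
  | ask i q k, f => ask i q fun r => (k r).bind f

/-- The result and the list of all broadcasts, latest first, when machine `i` answers `g i H q` to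
the question `q` after the broadcasts `H`. -/
def run (g : Fin s → List V → (q : Q) → Fin (2 ^ rl q)) : Prog s V Q rl α → List V → α × List V
  | ret a, H => (a, H)
  | bcast v k, H => k.run g (v :: H)
  | ask i q k, H => (k (g i H q)).run g H

/-- Whatever the answers, the total cost is at most `N`, where a broadcast costs `cb` and a
question `q` costs `cq + rl q`. -/
def CostLE (cb cq : ℕ) : Prog s V Q rl α → ℕ → Prop
  | ret _, _ => True
  | bcast _ k, N => ∃ N', k.CostLE cb cq N' ∧ cb + N' ≤ N
  | ask _ q k, N => ∃ N', (∀ r, (k r).CostLE cb cq N') ∧ cq + rl q + N' ≤ N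

theorem run_bind (g : Fin s → List V → (q : Q) → Fin (2 ^ rl q)) (p : Prog s V Q rl α)
    (f : α → Prog s V Q rl β) (H : List V) :
    (p.bind f).run g H = (f (p.run g H).1).run g (p.run g H).2 := by
  induction p generalizing H with
  | ret a => rfl
  | bcast v k ih => exact ih _
  | ask i q k ih => exact ih _ _

theorem CostLE.mono {cb cq : ℕ} {p : Prog s V Q rl α} {N N' : ℕ} (h : p.CostLE cb cq N)
    (hN : N ≤ N') : p.CostLE cb cq N' := by
  cases p with
  | ret a => trivial
  | bcast v k => obtain ⟨M, h1, h2⟩ := h; exact ⟨M, h1, h2.trans hN⟩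
  | ask i q k => obtain ⟨M, h1, h2⟩ := h; exact ⟨M, h1, h2.trans hN⟩

theorem CostLE.bind {cb cq : ℕ} {p : Prog s V Q rl α} {f : α → Prog s V Q rl β} {N N' : ℕ}
    (h : p.CostLE cb cq N) (hf : ∀ a, (f a).CostLE cb cq N') :
    (p.bind f).CostLE cb cq (N + N') := by
  induction p generalizing N with
  | ret a => exact (hf a).mono (by omega)
  | bcast v k ih =>
    obtain ⟨M, h1, h2⟩ := h
    exact ⟨M + N', ih h1, by omega⟩
  | ask i q k ih =>
    obtain ⟨M, h1, h2⟩ := h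
    exact ⟨M + N', fun r => ih r (h1 r), by omega⟩

/-- Broadcast of the elements of a list, the last one first. -/
def bcastList : List V → Prog s V Q rl Unit
  | [] => ret ()
  | v :: l => (bcastList l).bind fun _ => bcast v (ret ())

theorem run_bcastList (g : Fin s → List V → (q : Q) → Fin (2 ^ rl q)) (l : List V) (H : List V) :
    ((bcastList l).run g H).2 = l ++ H := by
  induction l with
  | nil => rfl
  | cons v l ih => simp [bcastList, run_bind, run, ih]

theorem costLE_bcastList (cb cq : ℕ) (l : List V) :
    (bcastList l : Prog s V Q rl Unit).CostLE cb cq (l.length * cb) := by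
  induction l with
  | nil => trivial
  | cons v l ih =>
    refine (CostLE.bind (f := fun _ => bcast v (ret ())) (N' := cb) ih
      fun _ => ⟨0, trivial, le_rfl⟩).mono ?_
    simp [Nat.succ_mul]

/-- Asks a list of questions and collects the decoded answers. -/
def gather {ι : Type} [DecidableEq ι] (dst : ι → Fin s) (qu : ι → Q)
    (dec : (q : Q) → Fin (2 ^ rl q) → ℤ) : List ι → Prog s V Q rl (ι → ℤ)
  | [] => ret fun _ => 0
  | a :: l => ask (dst a) (qu a) fun r =>
      (gather dst qu dec l).bind fun F => ret (Function.update F a (dec _ r))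

theorem run_gather {ι : Type} [DecidableEq ι] (dst : ι → Fin s) (qu : ι → Q)
    (dec : (q : Q) → Fin (2 ^ rl q) → ℤ) (g : Fin s → List V → (q : Q) → Fin (2 ^ rl q))
    (l : List ι) (H : List V) :
    ((gather dst qu dec l).run g H).2 = H ∧
    ∀ a ∈ l, ((gather dst qu dec l).run g H).1 a = dec (qu a) (g (dst a) H (qu a)) := by
  induction l with
  | nil => simp [gather, run]
  | cons a l ih =>
    simp only [gather, run, run_bind]
    refine ⟨ih.1, fun b hb => ?_⟩
    by_cases hab : b = a
    · subst hab; simp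
    · rw [Function.update_of_ne hab]
      exact ih.2 b (by simpa [hab] using hb)

theorem costLE_gather {ι : Type} [DecidableEq ι] (cb cq : ℕ) (dst : ι → Fin s) (qu : ι → Q)
    (dec : (q : Q) → Fin (2 ^ rl q) → ℤ) (l : List ι) (c : ℕ) (hc : ∀ a ∈ l, rl (qu a) ≤ c) :
    (gather dst qu dec l : Prog s V Q rl (ι → ℤ)).CostLE cb cq (l.length * (cq + c)) := by
  induction l with
  | nil => trivial
  | cons a l ih =>
    refine ⟨l.length * (cq + c) + 0, fun r => (ih fun b hb => hc b (by simp [hb])).bind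
      fun _ => trivial, ?_⟩
    have := hc a (by simp)
    simp [Nat.succ_mul]
    omega

/-! ### Compilation into bits -/

/-- What a machine keeps in mind: the broadcasts, an incomplete message, and the remaining bits of
the answer under way. -/
structure MState (V : Type) where
  hist : List V
  buf : List Bool
  out : List Bool

variable [Fintype V] [Fintype Q] (wv wq : ℕ)

/-- Decoding a message: a broadcast or a question. -/
noncomputable def decodeMsg : List Bool → Option (V ⊕ Q)
  | [] => none
  | true :: l => (decodeBits wv l).map Sum.inl
  | false :: l => (decodeBits wq l).map Sum.inr

/-- The change of a machine's state when it receives a bit. -/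
noncomputable def mstep (g : List V → (q : Q) → Fin (2 ^ rl q)) (st : MState V) (c : Bool) :
    MState V :=
  match st.out with
  | _ :: out => ⟨st.hist, st.buf, out⟩
  | [] =>
    match decodeMsg (V := V) (Q := Q) wv wq (st.buf ++ [c]) with
    | none => ⟨st.hist, st.buf ++ [c], []⟩
    | some (Sum.inl v) => ⟨v :: st.hist, [], []⟩
    | some (Sum.inr q) => ⟨st.hist, [], encodeBits (rl q) (g st.hist q)⟩

/-- The state of a machine that has received the bits `R`. -/
noncomputable def mstate (g : List V → (q : Q) → Fin (2 ^ rl q)) (R : List Bool) : MState V :=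
  R.foldl (mstep wv wq g) ⟨[], [], []⟩

/-- The bit a machine sends when it has received `R`. -/
noncomputable def mreply (g : List V → (q : Q) → Fin (2 ^ rl q)) (R : List Bool) : Bool :=
  ((mstate wv wq g R.dropLast).out).headD false

/-- Sending a list of bits to machine `i`. -/
def send {Y : Type} (i : Fin s) : List Bool → BitProg s Y → BitProg s Y
  | [], p => p
  | c :: l, p => BitProg.query i c fun _ => send i l p

/-- Sending a list of bits to each of several machines. -/
def sendAll {Y : Type} (l : List Bool) : List (Fin s) → BitProg s Y → BitProg s Y
  | [], p => p
  | i :: is, p => send i l (sendAll l is p)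

/-- Reading bits from machine `i`. -/
def read {Y : Type} (i : Fin s) : ℕ → (List Bool → BitProg s Y) → BitProg s Y
  | 0, k => k []
  | n + 1, k => BitProg.query i false fun b => read i n fun l => k (b :: l)

/-- The bit-level program that executes a program and outputs a function of the broadcasts. -/
noncomputable def toBit {Y : Type} (out : List V → Y) : Prog s V Q rl α → List V → BitProg s Y
  | ret _, H => BitProg.done (out H)
  | bcast v k, H => sendAll (true :: encodeBits wv v) (List.finRange s) (k.toBit out (v :: H))
  | ask i q k, H => send i (false :: encodeBits wq q) (read i (rl q) fun l =>
      (k ((decodeBits (rl q) l).getD ⟨0, by positivity⟩)).toBit out H)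

theorem run_send {Y : Type} (f : Fin s → List Bool → Bool) (i : Fin s) (l : List Bool)
    (p : BitProg s Y) (R : Fin s → List Bool) :
    (send i l p).run f R = p.run f (Function.update R i (R i ++ l)) := by
  induction l generalizing R with
  | nil => simp [send]
  | cons c l ih => simp [send, BitProg.run, ih]

theorem run_sendAll {Y : Type} (f : Fin s → List Bool → Bool) (l : List Bool)
    (is : List (Fin s)) (his : is.Nodup) (p : BitProg s Y) (R : Fin s → List Bool) :
    (sendAll l is p).run f R = p.run f (fun i => if i ∈ is then R i ++ l else R i) := by
  induction is generalizing R with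
  | nil => simp [sendAll]
  | cons i is ih =>
    rw [List.nodup_cons] at his
    simp only [sendAll, run_send, ih his.2]
    congr 1
    funext j
    by_cases hj : j = i
    · subst hj; simp [his.1]
    · simp [hj]

/-- Each bit of an answer is pulled by a dummy bit of the coordinator. The dummy removes the head of
the machine's output queue, which is why `mreply` looks at the state before its arrival. -/
theorem run_read {Y : Type} (g : Fin s → List V → (q : Q) → Fin (2 ^ rl q)) (i : Fin s)
    (H : List V) (l : List Bool)
    (k : List Bool → BitProg s Y) (R : Fin s → List Bool)
    (hR : mstate wv wq (g i) (R i) = ⟨H, [], l⟩) :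
    ∃ R', (read i l.length k).run (fun i => mreply wv wq (g i)) R
        = (k l).run (fun i => mreply wv wq (g i)) R' ∧
      mstate wv wq (g i) (R' i) = ⟨H, [], []⟩ ∧ (∀ j, j ≠ i → R' j = R j) ∧
      (R' i).length = (R i).length + l.length := by
  induction l generalizing R k with
  | nil => exact ⟨R, rfl, hR, fun _ _ => rfl, rfl⟩
  | cons b l ih =>
    have hb : mreply wv wq (g i) (R i ++ [false]) = b := by
      simp [mreply, hR]
    obtain ⟨R', h1, h2, h3, h4⟩ := ih (fun l => k (b :: l))
      (Function.update R i (R i ++ [false])) (by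
        simp only [Function.update_self]
        rw [mstate, List.foldl_append]
        change List.foldl _ (mstate wv wq (g i) (R i)) _ = _
        rw [hR]
        simp [mstep])
    refine ⟨R', ?_, h2, fun j hj => by rw [h3 j hj, Function.update_of_ne hj], ?_⟩
    · simp only [List.length_cons, read, BitProg.run, hb]
      exact h1
    · rw [h4]; simp; omega

theorem foldl_mstep_incomplete (g : List V → (q : Q) → Fin (2 ^ rl q)) (H : List V)
    (l : List Bool) : ∀ (buf : List Bool),
    (∀ l', l' ≠ [] → l' <+: l → decodeMsg (V := V) (Q := Q) wv wq (buf ++ l') = none) →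
    l.foldl (mstep wv wq g) ⟨H, buf, []⟩ = ⟨H, buf ++ l, []⟩ := by
  induction l with
  | nil => simp
  | cons c l ih =>
    intro buf h
    rw [List.foldl_cons]
    have h1 : mstep wv wq g ⟨H, buf, []⟩ c = ⟨H, buf ++ [c], []⟩ := by
      simp only [mstep]
      rw [h [c] (by simp) (by simp)]
    rw [h1, ih]
    · simp
    · intro l' hl' hp
      have := h (c :: l') (by simp) (by simpa using hp)
      simpa using this

/-- The first bit of a message fixes its length, and a shorter word is not a code word of that
length. So the buffer decodes at the last bit and not earlier. -/
theorem mstate_message (g : List V → (q : Q) → Fin (2 ^ rl q)) (H : List V) (R : List Bool)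
    (hR : mstate wv wq g R = ⟨H, [], []⟩) (t : Bool) (l : List Bool)
    (hl : l.length = if t then wv else wq) :
    mstate wv wq g (R ++ t :: l) =
      match decodeMsg (V := V) (Q := Q) wv wq (t :: l) with
      | none => ⟨H, t :: l, []⟩
      | some (Sum.inl v) => ⟨v :: H, [], []⟩
      | some (Sum.inr q) => ⟨H, [], encodeBits (rl q) (g H q)⟩ := by
  have hne : t :: l ≠ [] := by simp
  rw [mstate, List.foldl_append]
  change List.foldl _ (mstate wv wq g R) _ = _
  rw [hR]
  conv_lhs => rw [← List.dropLast_append_getLast hne]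
  rw [List.foldl_append, foldl_mstep_incomplete]
  · simp only [List.foldl_cons, List.foldl_nil, List.nil_append, mstep]
    rw [List.dropLast_append_getLast hne]
  · intro l' hl' hp
    rw [List.nil_append]
    have hlen : l'.length ≤ l.length := by
      have := hp.length_le
      simpa using this
    have hp2 : l' <+: t :: l := hp.trans (List.dropLast_prefix _)
    cases l' with
    | nil => exact absurd rfl hl'
    | cons c l' =>
      rw [List.cons_prefix_cons] at hp2
      obtain ⟨rfl, -⟩ := hp2
      simp only [List.length_cons] at hlen
      cases c
      · simp only [decodeMsg]
        rw [decodeBits_eq_none]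
        · rfl
        · simp at hl; omega
      · simp only [decodeMsg]
        rw [decodeBits_eq_none]
        · rfl
        · simp at hl; omega

/-- The invariant is that between two instructions all machines have the same history and empty
buffers. The count is of bits received by machines: a broadcast takes its tag and code once per
machine, a question its tag and code plus one dummy per bit of the answer. -/
theorem run_toBit {Y : Type} (hV : Fintype.card V ≤ 2 ^ wv) (hQ : Fintype.card Q ≤ 2 ^ wq)
    (g : Fin s → List V → (q : Q) → Fin (2 ^ rl q)) (out : List V → Y) (p : Prog s V Q rl α) :
    ∀ (H : List V) (R : Fin s → List Bool), (∀ i, mstate wv wq (g i) (R i) = ⟨H, [], []⟩) →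
    ((p.toBit wv wq out H).run (fun i => mreply wv wq (g i)) R).1 = out (p.run g H).2 ∧
    (∀ i, mstate wv wq (g i) (((p.toBit wv wq out H).run (fun i => mreply wv wq (g i)) R).2 i)
      = ⟨(p.run g H).2, [], []⟩) ∧
    ∀ N, p.CostLE (s * (1 + wv)) (1 + wq) N →
      ∑ i, (((p.toBit wv wq out H).run (fun i => mreply wv wq (g i)) R).2 i).length
        ≤ ∑ i, (R i).length + N := by
  induction p with
  | ret a =>
    intro H R hR
    refine ⟨rfl, hR, fun N _ => ?_⟩
    simp [toBit, BitProg.run]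
  | bcast v k ih =>
    intro H R hR
    have h1 : ∀ i, mstate wv wq (g i) (R i ++ true :: encodeBits wv v) = ⟨v :: H, [], []⟩ := by
      intro i
      rw [mstate_message wv wq (g i) H (R i) (hR i) true _ (by simp)]
      simp [decodeMsg, decodeBits_encodeBits hV]
    obtain ⟨h2, h3, h4⟩ := ih (v :: H) (fun i => R i ++ true :: encodeBits wv v) h1
    simp only [toBit, run_sendAll _ _ _ (List.nodup_finRange s), List.mem_finRange, if_true, run]
    refine ⟨h2, h3, fun N hN => ?_⟩
    obtain ⟨N', hN1, hN2⟩ := hN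
    refine (h4 N' hN1).trans ?_
    simp only [List.length_append, List.length_cons, length_encodeBits, Finset.sum_add_distrib,
      Finset.sum_const, Finset.card_univ, Fintype.card_fin, smul_eq_mul]
    rw [mul_add] at hN2
    omega
  | ask i q k ih =>
    intro H R hR
    have h1 : mstate wv wq (g i) (R i ++ false :: encodeBits wq q)
        = ⟨H, [], encodeBits (rl q) (g i H q)⟩ := by
      rw [mstate_message wv wq (g i) H (R i) (hR i) false _ (by simp)]
      simp [decodeMsg, decodeBits_encodeBits hQ]
    obtain ⟨R', hr1, hr2, hr3, hr4⟩ := run_read wv wq g i H (encodeBits (rl q) (g i H q))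
      (fun l => (k ((decodeBits (rl q) l).getD ⟨0, by positivity⟩)).toBit wv wq out H)
      (Function.update R i (R i ++ false :: encodeBits wq q)) (by simpa using h1)
    rw [length_encodeBits] at hr1 hr4
    rw [decodeBits_encodeBits (by simp)] at hr1
    simp only [Option.getD_some] at hr1
    have hR' : ∀ j, mstate wv wq (g j) (R' j) = ⟨H, [], []⟩ := by
      intro j
      by_cases hj : j = i
      · subst hj; exact hr2
      · rw [hr3 j hj, Function.update_of_ne hj]; exact hR j
    obtain ⟨h2, h3, h4⟩ := ih (g i H q) H R' hR'
    simp only [toBit, run_send, run]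
    rw [hr1]
    refine ⟨h2, h3, fun N hN => ?_⟩
    obtain ⟨N', hN1, hN2⟩ := hN
    refine (h4 N' (hN1 _)).trans ?_
    rw [← Finset.add_sum_erase _ _ (Finset.mem_univ i),
      ← Finset.add_sum_erase _ (fun i => (R i).length) (Finset.mem_univ i), hr4]
    have : ∑ j ∈ Finset.univ.erase i, (R' j).length = ∑ j ∈ Finset.univ.erase i, (R j).length := by
      refine Finset.sum_congr rfl fun j hj => ?_
      have hj := Finset.ne_of_mem_erase hj
      rw [hr3 j hj, Function.update_of_ne hj]
    rw [this]
    simp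
    omega

/-- The protocol that executes a program, with all parties' outputs a function of the
broadcasts. -/
noncomputable def toProtocol {X Y Ω : Type} (law : PMF Ω) (prog : Ω → Prog s V Q rl α)
    (g : Ω → Fin s → X → List V → (q : Q) → Fin (2 ^ rl q)) (out : Ω → List V → Y) :
    CoordinatorProtocol s X Y :=
  BitProg.toProtocol law (fun ω => (prog ω).toBit wv wq (out ω) [])
    (fun ω i x => mreply wv wq (g ω i x))
    (fun ω i x R => out ω (mstate wv wq (g ω i x) R).hist) (out law.support_nonempty.some [])

theorem toProtocol_endsWith {X Y Ω : Type} (hV : Fintype.card V ≤ 2 ^ wv)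
    (hQ : Fintype.card Q ≤ 2 ^ wq) (law : PMF Ω) (prog : Ω → Prog s V Q rl α)
    (g : Ω → Fin s → X → List V → (q : Q) → Fin (2 ^ rl q)) (out : Ω → List V → Y)
    (ω : Ω) (x : Fin s → X) :
    ∃ T, (toProtocol wv wq law prog g out).EndsWith ω x T ∧
      (∀ N, (prog ω).CostLE (s * (1 + wv)) (1 + wq) N → bitCount T ≤ 2 * N) ∧
      (toProtocol wv wq law prog g out).coordinatorOut ω T
        = out ω ((prog ω).run (fun i => g ω i (x i)) []).2 ∧
      ∀ i, (toProtocol wv wq law prog g out).machineOut ω i (x i) (T i)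
        = out ω ((prog ω).run (fun i => g ω i (x i)) []).2 := by
  obtain ⟨T, h1, h2, h3, h4⟩ := BitProg.toProtocol_endsWith law
    (fun ω => (prog ω).toBit wv wq (out ω) []) (fun ω i x => mreply wv wq (g ω i x))
    (fun ω i x R => out ω (mstate wv wq (g ω i x) R).hist) (out law.support_nonempty.some []) ω x
  obtain ⟨h5, h6, h7⟩ := run_toBit wv wq hV hQ (fun i => g ω i (x i)) (out ω) (prog ω) []
    (fun _ => []) (fun i => rfl)
  refine ⟨T, h1, fun N hN => ?_, h3.trans h5, fun i => ?_⟩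
  · rw [h2]
    have := h7 N hN
    simp only [List.length_nil, Finset.sum_const_zero, zero_add] at this
    omega
  · exact (h4 i).trans (by rw [h6 i])

end Prog

/-! ### The Golden–Thompson inequality -/

/-! ### The Lie product formula. -/

section LieProduct

open Filter Topology NormedSpace

variable {𝔸 : Type*} [NormedRing 𝔸] [NormOneClass 𝔸]

theorem norm_pow_sub_pow_le {a b : 𝔸} {r : ℝ} (hr : 1 ≤ r) (ha : ‖a‖ ≤ r) (hb : ‖b‖ ≤ r) (q : ℕ) :
    ‖a ^ q - b ^ q‖ ≤ q * r ^ q * ‖a - b‖ := by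
  induction q with
  | zero => simp
  | succ q ih =>
    have h : a ^ (q + 1) - b ^ (q + 1) = (a ^ q - b ^ q) * a + b ^ q * (a - b) := by
      rw [pow_succ, pow_succ]; noncomm_ring
    have hbq : ‖b ^ q‖ ≤ r ^ (q + 1) := (norm_pow_le b q).trans
      ((pow_le_pow_left₀ (norm_nonneg _) hb q).trans (pow_le_pow_right₀ hr (by omega)))
    have hr0 : 0 ≤ r := by linarith
    calc ‖a ^ (q + 1) - b ^ (q + 1)‖ ≤ ‖a ^ q - b ^ q‖ * ‖a‖ + ‖b ^ q‖ * ‖a - b‖ := by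
          rw [h]
          exact (norm_add_le _ _).trans (add_le_add (norm_mul_le _ _) (norm_mul_le _ _))
      _ ≤ (q * r ^ q * ‖a - b‖) * r + r ^ (q + 1) * ‖a - b‖ := by gcongr
      _ = _ := by push_cast; ring

theorem norm_exp_le_exp_norm [NormedAlgebra ℝ 𝔸] (x : 𝔸) : ‖exp x‖ ≤ Real.exp ‖x‖ := by
  rw [exp_eq_tsum ℝ, Real.exp_eq_exp_ℝ, exp_eq_tsum ℝ]
  refine (norm_tsum_le_tsum_norm (norm_expSeries_summable' (𝕂 := ℝ) x)).trans ?_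
  refine Summable.tsum_le_tsum (fun n => ?_) (norm_expSeries_summable' (𝕂 := ℝ) x)
    (expSeries_summable' (𝕂 := ℝ) ‖x‖)
  rw [norm_smul, norm_inv, smul_eq_mul, Real.norm_natCast]
  gcongr
  exact norm_pow_le _ _

/-- Compare the `q`-th powers of `exp(X/q) exp(Y/q)` and `exp((X+Y)/q)`. By `norm_pow_sub_pow_le`
their distance is at most a constant times `q ‖D(1/q)‖`, where `D` is the difference of the two
curves. It vanishes to first order at 0, so this tends to 0. -/
theorem tendsto_lie_product [NormedAlgebra ℝ 𝔸] [CompleteSpace 𝔸] (X Y : 𝔸) :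
    Tendsto (fun q : ℕ => (exp ((q : ℝ)⁻¹ • X) * exp ((q : ℝ)⁻¹ • Y)) ^ q) atTop
      (𝓝 (exp (X + Y))) := by
  set D : ℝ → 𝔸 := fun t => exp (t • X) * exp (t • Y) - exp (t • (X + Y)) with hD
  have hderiv : HasDerivAt D 0 0 := by
    have h1 := ((hasDerivAt_exp_smul_const (𝕂 := ℝ) X 0).mul
      (hasDerivAt_exp_smul_const (𝕂 := ℝ) Y 0)).sub (hasDerivAt_exp_smul_const (𝕂 := ℝ) (X + Y) 0)
    simp only [zero_smul, exp_zero, one_mul, mul_one, sub_self] at h1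
    exact h1
  have hD0 : D 0 = 0 := by simp [hD]
  have hlim : Tendsto (fun q : ℕ => (q : ℝ) * ‖D (q : ℝ)⁻¹‖) atTop (𝓝 0) := by
    have h := hderiv.tendsto_slope_zero
    have h2 : Tendsto (fun q : ℕ => ((q : ℝ)⁻¹)) atTop (𝓝[≠] 0) := by
      rw [tendsto_nhdsWithin_iff]
      refine ⟨tendsto_inv_atTop_nhds_zero_nat, ?_⟩
      filter_upwards [eventually_gt_atTop 0] with q hq
      simp [hq.ne']
    have h3 := (h.comp h2).norm
    simp only [norm_zero] at h3
    refine h3.congr fun q => ?_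
    simp [hD0, norm_smul]
  set c := ‖X‖ + ‖Y‖ with hc
  rw [tendsto_iff_norm_sub_tendsto_zero]
  refine squeeze_zero' (g := fun q : ℕ => Real.exp c * ((q : ℝ) * ‖D (q : ℝ)⁻¹‖))
    (Eventually.of_forall fun _ => norm_nonneg _) ?_ (by simpa using hlim.const_mul (Real.exp c))
  filter_upwards [eventually_gt_atTop 0] with q hq
  have hq' : (0 : ℝ) < q := by exact_mod_cast hq
  have hexp : exp (X + Y) = (exp ((q : ℝ)⁻¹ • (X + Y))) ^ q := by
    let : NormedAlgebra ℚ 𝔸 := .restrictScalars ℚ ℝ 𝔸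
    rw [← exp_nsmul, ← Nat.cast_smul_eq_nsmul ℝ, smul_smul, mul_inv_cancel₀ hq'.ne', one_smul]
  set r := Real.exp ((q : ℝ)⁻¹ * c) with hr
  have hr1 : 1 ≤ r := Real.one_le_exp (by positivity)
  have ha : ‖exp ((q : ℝ)⁻¹ • X) * exp ((q : ℝ)⁻¹ • Y)‖ ≤ r := by
    refine (norm_mul_le _ _).trans ((mul_le_mul (norm_exp_le_exp_norm _) (norm_exp_le_exp_norm _)
      (norm_nonneg _) (Real.exp_pos _).le).trans ?_)
    rw [← Real.exp_add, norm_smul, norm_smul, hr, hc]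
    simp [mul_add]
  have hb : ‖exp ((q : ℝ)⁻¹ • (X + Y))‖ ≤ r := by
    refine (norm_exp_le_exp_norm _).trans (Real.exp_le_exp.2 ?_)
    rw [norm_smul, norm_inv, Real.norm_natCast]
    gcongr
    exact norm_add_le _ _
  rw [hexp]
  refine (norm_pow_sub_pow_le hr1 ha hb q).trans (le_of_eq ?_)
  have : r ^ q = Real.exp c := by
    rw [hr, ← Real.exp_nat_mul, ← mul_assoc, mul_inv_cancel₀ hq'.ne', one_mul]
  rw [this, hD]
  ring

end LieProduct

/-! ### Trace inequalities for products of symmetric matrices. -/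

namespace Matrix

variable {m : Type*} [Fintype m]

/-- Cauchy–Schwarz for the Frobenius inner product of `A` and `Bᵀ`. -/
theorem trace_mul_sq_le (A B : Matrix m m ℝ) :
    (A * B).trace ^ 2 ≤ (A * Aᵀ).trace * (B * Bᵀ).trace := by
  have h : ∀ A B : Matrix m m ℝ, (A * Bᵀ).trace = ∑ p : m × m, A p.1 p.2 * B p.1 p.2 := by
    intro A B
    simp [trace, mul_apply, Fintype.sum_prod_type]
  have h1 : (A * B).trace = ∑ p : m × m, A p.1 p.2 * Bᵀ p.1 p.2 := by
    rw [← h, transpose_transpose]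
  have h2 : (B * Bᵀ).trace = ∑ p : m × m, Bᵀ p.1 p.2 * Bᵀ p.1 p.2 := by
    rw [trace_mul_comm, ← h, transpose_transpose]
  rw [h1, h2, h A A]
  have := Finset.sum_mul_sq_le_sq_mul_sq Finset.univ (fun p : m × m => A p.1 p.2)
    (fun p : m × m => Bᵀ p.1 p.2)
  simpa [pow_two] using this

theorem trace_mul_pow_comm [DecidableEq m] (A B : Matrix m m ℝ) (k : ℕ) :
    ((A * B) ^ k).trace = ((B * A) ^ k).trace := by
  cases k with
  | zero => simp
  | succ k =>
    have h : (A * B) ^ (k + 1) = A * ((B * A) ^ k * B) := by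
      induction k with
      | zero => simp
      | succ k ih =>
        rw [pow_succ, ih, pow_succ (B * A)]
        simp only [Matrix.mul_assoc]
    rw [h, trace_mul_comm, pow_succ, Matrix.mul_assoc]

/-- The two statements feed each other. The first at `k + 1` follows by applying it to `M²` at `k`,
rotating the trace to reach `(M Mᵀ)(Mᵀ M)`, splitting the power by the second at `k`, and
Cauchy–Schwarz. The second at `k + 1` follows from the first for `M = P Q`, since `P Q (P Q)ᵀ`
rotates to `P² Q²`, and the second for the squares. -/
theorem trace_pow_two_pow_le [DecidableEq m] (k : ℕ) :
    (∀ M : Matrix m m ℝ, (M ^ 2 ^ (k + 1)).trace ≤ ((M * Mᵀ) ^ 2 ^ k).trace) ∧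
    (∀ P Q : Matrix m m ℝ, P.IsSymm → Q.IsSymm →
      ((P * Q) ^ 2 ^ k).trace ≤ (P ^ 2 ^ k * Q ^ 2 ^ k).trace) := by
  induction k with
  | zero =>
    refine ⟨fun M => ?_, fun P Q _ _ => by simp⟩
    have h := trace_mul_sq_le M M
    have h0 : 0 ≤ (M * Mᵀ).trace := by
      simp only [trace, diag_apply, mul_apply, transpose_apply]
      exact Finset.sum_nonneg fun i _ => Finset.sum_nonneg fun j _ => mul_self_nonneg _
    rw [← pow_two (M * Mᵀ).trace] at h
    simpa [pow_two] using (abs_le_of_sq_le_sq' h h0).2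
  | succ k ih =>
    obtain ⟨hS, hG⟩ := ih
    constructor
    · intro M
      have e1 : (M * M * (M * M)ᵀ) = M * (M * Mᵀ * Mᵀ) := by
        rw [transpose_mul]; simp only [Matrix.mul_assoc]
      have e2 : (M * Mᵀ * Mᵀ) * M = (M * Mᵀ) * (Mᵀ * M) := by simp only [Matrix.mul_assoc]
      have s1 : (M * Mᵀ).IsSymm := by simp [IsSymm, transpose_mul]
      have s2 : (Mᵀ * M).IsSymm := by simp [IsSymm, transpose_mul]
      have h1 : (M ^ 2 ^ (k + 1 + 1)).trace ≤ (((M * Mᵀ) ^ 2 ^ k) * ((Mᵀ * M) ^ 2 ^ k)).trace := by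
        calc (M ^ 2 ^ (k + 1 + 1)).trace = ((M * M) ^ 2 ^ (k + 1)).trace := by
              rw [← pow_two, ← pow_mul]; congr 2; ring
          _ ≤ ((M * M * (M * M)ᵀ) ^ 2 ^ k).trace := hS _
          _ = (((M * Mᵀ) * (Mᵀ * M)) ^ 2 ^ k).trace := by rw [e1, trace_mul_pow_comm, e2]
          _ ≤ _ := hG _ _ s1 s2
      refine h1.trans ?_
      have h2 := trace_mul_sq_le ((M * Mᵀ) ^ 2 ^ k) ((Mᵀ * M) ^ 2 ^ k)
      rw [transpose_pow, transpose_pow, s1.eq, s2.eq, ← pow_add, ← pow_add, ← two_mul, ← pow_succ',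
        trace_mul_pow_comm Mᵀ M, ← pow_two] at h2
      refine (abs_le_of_sq_le_sq' h2 ?_).2
      have : (M * Mᵀ) ^ 2 ^ (k + 1) = ((M * Mᵀ) ^ 2 ^ k) * ((M * Mᵀ) ^ 2 ^ k)ᵀ := by
        rw [transpose_pow, s1.eq, ← pow_add, ← two_mul, ← pow_succ']
      rw [this]
      simp only [trace, diag_apply, mul_apply, transpose_apply]
      exact Finset.sum_nonneg fun i _ => Finset.sum_nonneg fun j _ => mul_self_nonneg _
    · intro P Q hP hQ
      have e1 : P * Q * (P * Q)ᵀ = P * (Q * Q * P) := by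
        rw [transpose_mul, hP.eq, hQ.eq]; simp only [Matrix.mul_assoc]
      have e2 : (Q * Q * P) * P = (Q * Q) * (P * P) := by simp only [Matrix.mul_assoc]
      calc ((P * Q) ^ 2 ^ (k + 1)).trace ≤ ((P * Q * (P * Q)ᵀ) ^ 2 ^ k).trace := hS _
        _ = (((P * P) * (Q * Q)) ^ 2 ^ k).trace := by
          rw [e1, trace_mul_pow_comm, e2, trace_mul_pow_comm]
        _ ≤ ((P * P) ^ 2 ^ k * (Q * Q) ^ 2 ^ k).trace := by
          apply hG
          · simp [IsSymm, transpose_mul, hP.eq]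
          · simp [IsSymm, transpose_mul, hQ.eq]
        _ = _ := by
          rw [← pow_two, ← pow_two, ← pow_mul, ← pow_mul, ← pow_succ']

-- The Golden–Thompson inequality. In the Lie product formula along `q = 2^k`, each approximant has
-- trace at most `tr(exp X exp Y)`, by `trace_pow_two_pow_le` for the symmetric matrices
-- `exp(X/2^k)` and `exp(Y/2^k)`.
open Filter Topology NormedSpace in
open scoped Matrix.Norms.L2Operator in
theorem trace_exp_add_le [DecidableEq m] (X Y : Matrix m m ℝ) (hX : X.IsSymm) (hY : Y.IsSymm) :
    (exp (X + Y)).trace ≤ (exp X * exp Y).trace := by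
  cases isEmpty_or_nonempty m with
  | inl h => simp [trace]
  | inr h =>
  have h1 := (tendsto_lie_product X Y).comp (tendsto_pow_atTop_atTop_of_one_lt (one_lt_two : (1:ℕ) < 2))
  have hcont : Continuous (fun M : Matrix m m ℝ => M.trace) :=
    continuous_id.matrix_trace
  have h2 := (hcont.tendsto _).comp h1
  refine le_of_tendsto h2 (Eventually.of_forall fun k => ?_)
  simp only [Function.comp]
  have key : ∀ Z : Matrix m m ℝ, exp ((((2 ^ k : ℕ) : ℝ))⁻¹ • Z) ^ 2 ^ k = exp Z := by
    intro Z
    rw [← exp_nsmul, ← Nat.cast_smul_eq_nsmul ℝ, smul_smul, mul_inv_cancel₀ (by positivity),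
      one_smul]
  have := (trace_pow_two_pow_le k).2 (exp ((((2 ^ k : ℕ) : ℝ))⁻¹ • X))
    (exp ((((2 ^ k : ℕ) : ℝ))⁻¹ • Y)) (IsSymm.exp (hX.smul _)) (IsSymm.exp (hY.smul _))
  rwa [key, key] at this

end Matrix

/-! ### Averages over finite types -/

section Average

variable {Ω α β ι : Type*} [Fintype Ω] [Fintype α] [Fintype β] [Fintype ι]

/-- The average of a real function on a finite type. -/
noncomputable def avg (f : Ω → ℝ) : ℝ := (∑ ω, f ω) / Fintype.card Ω

open Classical in
/-- The probability of an event under the uniform distribution. -/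
noncomputable def prob (p : Ω → Prop) : ℝ := avg fun ω => if p ω then 1 else 0

theorem avg_mono {f g : Ω → ℝ} (h : ∀ ω, f ω ≤ g ω) : avg f ≤ avg g := by
  unfold avg; gcongr; exact h _

theorem avg_nonneg {f : Ω → ℝ} (h : ∀ ω, 0 ≤ f ω) : 0 ≤ avg f :=
  div_nonneg (Finset.sum_nonneg fun ω _ => h ω) (Nat.cast_nonneg _)

theorem avg_const [Nonempty Ω] (c : ℝ) : avg (fun _ : Ω => c) = c := by
  simp [avg]

theorem avg_add (f g : Ω → ℝ) : avg (fun ω => f ω + g ω) = avg f + avg g := by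
  simp [avg, Finset.sum_add_distrib, add_div]

theorem avg_const_mul (c : ℝ) (f : Ω → ℝ) : avg (fun ω => c * f ω) = c * avg f := by
  simp [avg, ← Finset.mul_sum, mul_div_assoc]

theorem avg_sum {κ : Type*} (S : Finset κ) (f : κ → Ω → ℝ) :
    avg (fun ω => ∑ k ∈ S, f k ω) = ∑ k ∈ S, avg (f k) := by
  simp only [avg, ← Finset.sum_div]
  rw [Finset.sum_comm]

theorem avg_prod (f : α × β → ℝ) : avg f = avg fun a => avg fun b => f (a, b) := by
  simp only [avg, Fintype.sum_prod_type, Fintype.card_prod, ← Finset.sum_div, Nat.cast_mul]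
  rw [div_div, mul_comm]

/-- Resampling a coordinate does not change the mean: exchanging the `i`-th coordinate with a fresh
value is an involution of the product. All uses of independence between coordinates of a seed, and
all conditioning on the other coordinates, go through this identity. -/
theorem avg_update [DecidableEq ι] [Nonempty β] (i : ι) (f : (ι → β) → ℝ) :
    avg f = avg fun ω => avg fun v => f (Function.update ω i v) := by
  have h : ∑ ω : ι → β, ∑ v : β, f (Function.update ω i v) = Fintype.card β * ∑ ω, f ω := by
    let φ : (ι → β) × β ≃ (ι → β) × β :=
      { toFun := fun p => (Function.update p.1 i p.2, p.1 i)
        invFun := fun p => (Function.update p.1 i p.2, p.1 i)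
        left_inv := fun p => by simp
        right_inv := fun p => by simp }
    have h1 := φ.sum_comp (fun p => f p.1)
    rw [Fintype.sum_prod_type, Fintype.sum_prod_type] at h1
    simp only [φ, Equiv.coe_fn_mk, Finset.sum_const, Finset.card_univ, nsmul_eq_mul] at h1
    rw [h1, Finset.mul_sum]
  have hβ : (Fintype.card β : ℝ) ≠ 0 := by positivity
  simp only [avg, ← Finset.sum_div]
  rw [h, mul_div_cancel_left₀ _ hβ]

theorem prob_nonneg (p : Ω → Prop) : 0 ≤ prob p :=
  avg_nonneg fun ω => by split_ifs <;> norm_num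

theorem prob_le_one [Nonempty Ω] (p : Ω → Prop) : prob p ≤ 1 := by
  rw [← avg_const (Ω := Ω) 1]
  exact avg_mono fun ω => by split_ifs <;> norm_num

theorem prob_mono {p q : Ω → Prop} (h : ∀ ω, p ω → q ω) : prob p ≤ prob q :=
  avg_mono fun ω => by
    by_cases h1 : p ω
    · simp [h1, h ω h1]
    · simp only [h1, if_false]; split_ifs <;> norm_num

theorem prob_or (p q : Ω → Prop) : prob (fun ω => p ω ∨ q ω) ≤ prob p + prob q := by
  rw [prob, prob, prob, ← avg_add]
  refine avg_mono fun ω => ?_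
  by_cases h1 : p ω <;> by_cases h2 : q ω <;> simp [h1, h2]

theorem prob_exists {κ : Type*} (S : Finset κ) (p : κ → Ω → Prop) :
    prob (fun ω => ∃ k ∈ S, p k ω) ≤ ∑ k ∈ S, prob (p k) := by
  classical
  simp only [prob]
  rw [← avg_sum]
  refine avg_mono fun ω => ?_
  split_ifs with h
  · obtain ⟨k, hk, hp⟩ := h
    refine le_trans ?_ (Finset.single_le_sum (f := fun k => if p k ω then (1 : ℝ) else 0)
      (fun k _ => by split_ifs <;> norm_num) hk)
    simp [hp]
  · exact Finset.sum_nonneg fun k _ => by split_ifs <;> norm_num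

theorem prob_not [Nonempty Ω] (p : Ω → Prop) : prob (fun ω => ¬ p ω) = 1 - prob p := by
  have : prob (fun ω => ¬ p ω) + prob p = 1 := by
    rw [prob, prob, ← avg_add]
    refine Eq.trans ?_ (avg_const (Ω := Ω) 1)
    congr 1
    funext ω
    by_cases h : p ω <;> simp [h]
  linarith

theorem prob_lt_le_div {f : Ω → ℝ} (hf : ∀ ω, 0 ≤ f ω) {c : ℝ} (hc : 0 < c) :
    prob (fun ω => c < f ω) ≤ avg f / c := by
  rw [le_div_iff₀ hc, mul_comm, prob, ← avg_const_mul]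
  refine avg_mono fun ω => ?_
  split_ifs with h
  · simpa using h.le
  · simpa using hf ω

theorem prob_prod (p : α × β → Prop) : prob p = avg fun a => prob fun b => p (a, b) :=
  avg_prod _

theorem prob_update [DecidableEq ι] [Nonempty β] (i : ι) (p : (ι → β) → Prop) :
    prob p = avg fun ω => prob fun v => p (Function.update ω i v) :=
  avg_update i _

end Average

/-! ### A matrix Chernoff bound -/

namespace Matrix

variable {m : Type*} [Fintype m] [DecidableEq m]

theorem IsSymm.exists_diagonalization {S : Matrix m m ℝ} (hS : S.IsSymm) :
    ∃ (U : Matrix m m ℝ) (l : m → ℝ), Uᵀ * U = 1 ∧ S = U * diagonal l * Uᵀ := by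
  have hH : S.IsHermitian := by
    rw [IsHermitian, conjTranspose_eq_transpose_of_trivial]; exact hS
  refine ⟨hH.eigenvectorUnitary, hH.eigenvalues, ?_, ?_⟩
  · have := Unitary.coe_star_mul_self hH.eigenvectorUnitary
    rwa [star_eq_conjTranspose, conjTranspose_eq_transpose_of_trivial] at this
  · have := hH.spectral_theorem
    rw [Unitary.conjStarAlgAut_apply] at this
    simpa [Function.comp_def, star_eq_conjTranspose] using this

theorem exp_diagonalization {U : Matrix m m ℝ} (hU : Uᵀ * U = 1) (l : m → ℝ) :
    NormedSpace.exp (U * diagonal l * Uᵀ) = U * diagonal (fun i => Real.exp (l i)) * Uᵀ := by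
  have h1 : U * Uᵀ = 1 := mul_eq_one_comm.1 hU
  have hinv : U⁻¹ = Uᵀ := inv_eq_left_inv hU
  rw [← hinv, exp_conj U _ (IsUnit.of_mul_eq_one _ h1), exp_diagonal]
  congr 3
  funext i
  rw [Pi.coe_exp, Real.exp_eq_exp_ℝ]

theorem dotProduct_diagonalization (U : Matrix m m ℝ) (l : m → ℝ) (x : m → ℝ) :
    x ⬝ᵥ ((U * diagonal l * Uᵀ) *ᵥ x) = ∑ i, l i * (Uᵀ *ᵥ x) i ^ 2 := by
  rw [← mulVec_mulVec, ← mulVec_mulVec, dotProduct_mulVec, ← mulVec_transpose]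
  simp only [dotProduct, mulVec_diagonal]
  exact Finset.sum_congr rfl fun i _ => by ring

theorem sum_sq_transpose_mulVec {U : Matrix m m ℝ} (hU : Uᵀ * U = 1) (x : m → ℝ) :
    ∑ i, (Uᵀ *ᵥ x) i ^ 2 = x ⬝ᵥ x := by
  have h := dotProduct_diagonalization U (fun _ => 1) x
  rw [diagonal_one, Matrix.mul_one, mul_eq_one_comm.1 hU, one_mulVec] at h
  simp [h]

theorem trace_diagonalization_mul (U : Matrix m m ℝ) (l : m → ℝ) (W : Matrix m m ℝ) :
    (U * diagonal l * Uᵀ * W).trace = ∑ i, l i * ((U.col i) ⬝ᵥ (W *ᵥ U.col i)) := by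
  rw [Matrix.mul_assoc, Matrix.mul_assoc, trace_mul_comm, Matrix.mul_assoc, trace]
  refine Finset.sum_congr rfl fun i _ => ?_
  rw [diag_apply, diagonal_mul]
  congr 1
  simp [mul_apply, dotProduct, mulVec, Finset.mul_sum, Finset.sum_mul, mul_assoc]
  rw [Finset.sum_comm]

/-- No lower bound on `x` is needed, so the matrices in the Chernoff bound have to be bounded from
above only. -/
theorem exp_le_one_add_add_sq {x : ℝ} (hx : x ≤ 1) : Real.exp x ≤ 1 + x + x ^ 2 := by
  by_cases h : -1 ≤ x
  · have := (abs_le.1 (Real.abs_exp_sub_one_sub_id_le (abs_le.2 ⟨h, hx⟩))).2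
    linarith
  · push Not at h
    have : Real.exp x ≤ 1 := Real.exp_le_one_iff.2 (by linarith)
    nlinarith

theorem dotProduct_exp_le {Z : Matrix m m ℝ} (hZ : Z.IsSymm)
    (h1 : ∀ x, x ⬝ᵥ (Z *ᵥ x) ≤ x ⬝ᵥ x) (x : m → ℝ) :
    x ⬝ᵥ (NormedSpace.exp Z *ᵥ x) ≤ x ⬝ᵥ ((1 + Z + Z * Z) *ᵥ x) := by
  obtain ⟨U, l, hU, rfl⟩ := hZ.exists_diagonalization
  have hU' : U * Uᵀ = 1 := mul_eq_one_comm.1 hU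
  have hl : ∀ i, l i ≤ 1 := by
    intro i
    have h2 := h1 (U *ᵥ Pi.single i 1)
    have e1 : Uᵀ *ᵥ (U *ᵥ Pi.single i 1) = Pi.single i (1 : ℝ) := by
      rw [mulVec_mulVec, hU, one_mulVec]
    rw [dotProduct_diagonalization, ← sum_sq_transpose_mulVec hU, e1] at h2
    simpa [Pi.single_apply, Finset.sum_ite_eq] using h2
  have e2 : 1 + U * diagonal l * Uᵀ + U * diagonal l * Uᵀ * (U * diagonal l * Uᵀ)
      = U * diagonal (fun i => 1 + l i + l i ^ 2) * Uᵀ := by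
    have e3 : U * diagonal l * Uᵀ * (U * diagonal l * Uᵀ) = U * diagonal (fun i => l i ^ 2) * Uᵀ := by
      calc _ = U * diagonal l * (Uᵀ * U) * diagonal l * Uᵀ := by simp only [Matrix.mul_assoc]
        _ = _ := by
          rw [hU, Matrix.mul_one, Matrix.mul_assoc U, diagonal_mul_diagonal]
          simp [pow_two]
    have e4 : (1 : Matrix m m ℝ) = U * diagonal (fun _ => 1) * Uᵀ := by
      rw [diagonal_one, Matrix.mul_one, hU']
    rw [e3]
    conv_lhs => rw [e4]
    rw [← Matrix.add_mul, ← Matrix.mul_add, ← Matrix.add_mul, ← Matrix.mul_add,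
      diagonal_add, diagonal_add]
  rw [e2, exp_diagonalization hU, dotProduct_diagonalization, dotProduct_diagonalization]
  refine Finset.sum_le_sum fun i _ => ?_
  gcongr
  exact exp_le_one_add_add_sq (hl i)

/-- The trace of `exp S` dominates the exponential of each eigenvalue. -/
theorem dotProduct_le_of_trace_exp_le {S : Matrix m m ℝ} (hS : S.IsSymm) {t : ℝ}
    (h : (NormedSpace.exp S).trace ≤ Real.exp t) (x : m → ℝ) :
    x ⬝ᵥ (S *ᵥ x) ≤ t * (x ⬝ᵥ x) := by
  obtain ⟨U, l, hU, rfl⟩ := hS.exists_diagonalization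
  have htr : (NormedSpace.exp (U * diagonal l * Uᵀ)).trace = ∑ i, Real.exp (l i) := by
    rw [exp_diagonalization hU, Matrix.mul_assoc, trace_mul_comm, Matrix.mul_assoc, hU,
      Matrix.mul_one, trace_diagonal]
  rw [htr] at h
  rw [dotProduct_diagonalization, ← sum_sq_transpose_mulVec hU, Finset.mul_sum]
  refine Finset.sum_le_sum fun i _ => ?_
  gcongr
  rw [← Real.exp_le_exp]
  exact (Finset.single_le_sum (f := fun i => Real.exp (l i)) (fun i _ => (Real.exp_pos _).le)
    (Finset.mem_univ i)).trans h

/-- The summands are integrated out one at a time. Golden–Thompson separates `exp(H + Z)` into `exp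
H` and `exp Z`, and `exp Z ≤ 1 + Z + Z²` as a quadratic form. Tested on the eigenvectors of `H`, the
mean of `Z + Z²` contributes nothing positive. What is left at the end is the trace of the identity.
-/
theorem avg_trace_exp_sum_le {ι β : Type*} [Fintype ι] [DecidableEq ι] [Fintype β] [Nonempty β]
    (Z : ι → β → Matrix m m ℝ) (hs : ∀ i v, (Z i v).IsSymm)
    (h1 : ∀ i v x, x ⬝ᵥ (Z i v *ᵥ x) ≤ x ⬝ᵥ x) (S : Finset ι)
    (h2 : ∀ i ∈ S, ∀ x, avg (fun v => x ⬝ᵥ ((Z i v + Z i v * Z i v) *ᵥ x)) ≤ 0) :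
    avg (fun ω : ι → β => (NormedSpace.exp (∑ i ∈ S, Z i (ω i))).trace) ≤ Fintype.card m := by
  induction S using Finset.induction_on with
  | empty => simp [NormedSpace.exp_zero, avg_const]
  | insert i S hi ih =>
    refine le_trans ?_ (ih fun j hj => h2 j (Finset.mem_insert_of_mem hj))
    rw [avg_update i]
    refine avg_mono fun ω => ?_
    set H := ∑ j ∈ S, Z j (ω j) with hH
    have hrest : ∀ v, ∑ j ∈ insert i S, Z j (Function.update ω i v j) = H + Z i v := by
      intro v
      rw [Finset.sum_insert hi, Function.update_self, add_comm]
      congr 1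
      refine Finset.sum_congr rfl fun j hj => ?_
      rw [Function.update_of_ne]
      rintro rfl
      exact hi hj
    have hHs : H.IsSymm := by
      rw [hH, IsSymm, transpose_sum]
      exact Finset.sum_congr rfl fun j _ => hs j _
    obtain ⟨U, l, hU, hUl⟩ := hHs.exists_diagonalization
    have hexp := exp_diagonalization hU l
    rw [← hUl] at hexp
    have key : ∀ v, (NormedSpace.exp (∑ j ∈ insert i S, Z j (Function.update ω i v j))).trace
        ≤ (NormedSpace.exp H).trace + ∑ k, Real.exp (l k) *
          ((U.col k) ⬝ᵥ ((Z i v + Z i v * Z i v) *ᵥ U.col k)) := by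
      intro v
      rw [hrest]
      refine (trace_exp_add_le H (Z i v) hHs (hs i v)).trans ?_
      have e1 : (NormedSpace.exp H).trace + ∑ k, Real.exp (l k) *
          ((U.col k) ⬝ᵥ ((Z i v + Z i v * Z i v) *ᵥ U.col k))
          = ∑ k, Real.exp (l k) * ((U.col k) ⬝ᵥ ((1 + Z i v + Z i v * Z i v) *ᵥ U.col k)) := by
        rw [← trace_diagonalization_mul, ← trace_diagonalization_mul, hexp, add_assoc (1 : Matrix m m ℝ),
          Matrix.mul_add _ (1 : Matrix m m ℝ), Matrix.mul_one, trace_add]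
      rw [e1, hexp, trace_diagonalization_mul]
      refine Finset.sum_le_sum fun k _ => ?_
      gcongr
      exact dotProduct_exp_le (hs i v) (h1 i v) _
    refine (avg_mono key).trans ?_
    rw [avg_add, avg_const, avg_sum]
    have : ∑ k, avg (fun v => Real.exp (l k) *
        ((U.col k) ⬝ᵥ ((Z i v + Z i v * Z i v) *ᵥ U.col k))) ≤ 0 := by
      refine Finset.sum_nonpos fun k _ => ?_
      rw [avg_const_mul]
      exact mul_nonpos_of_nonneg_of_nonpos (Real.exp_pos _).le
        (h2 i (Finset.mem_insert_self _ _) _)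
    linarith

theorem dotProduct_vecMulVec_mulVec {m : Type*} [Fintype m] (w x : m → ℝ) :
    x ⬝ᵥ (vecMulVec w w *ᵥ x) = (w ⬝ᵥ x) ^ 2 := by
  rw [vecMulVec_mulVec]
  simp [dotProduct_smul, dotProduct_comm x w, pow_two]

end Matrix

-- For `Z = c w wᵀ` one has `Z² = c² |w|² w wᵀ`, which turns the matrix condition on the mean into a
-- scalar one. Then Markov's inequality applies to the trace of the exponential.
open Matrix in
theorem prob_sum_rankOne_gt {m ι β : Type*} [Fintype m] [DecidableEq m] [Fintype ι] [DecidableEq ι]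
    [Fintype β] [Nonempty β] (w : ι → m → ℝ) (c : ι → β → ℝ) (S : Finset ι)
    (h1 : ∀ i ∈ S, ∀ v, c i v * (w i ⬝ᵥ w i) ≤ 1)
    (h2 : ∀ i ∈ S, avg (fun v => c i v + c i v ^ 2 * (w i ⬝ᵥ w i)) ≤ 0) (t : ℝ) :
    prob (fun ω : ι → β => ∃ x, t * (x ⬝ᵥ x) < ∑ i ∈ S, c i (ω i) * (w i ⬝ᵥ x) ^ 2)
      ≤ Fintype.card m * Real.exp (-t) := by
  classical
  set Z : ι → β → Matrix m m ℝ := fun i v => if i ∈ S then c i v • vecMulVec (w i) (w i) else 0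
    with hZ
  have hZS : ∀ i ∈ S, ∀ v, Z i v = c i v • vecMulVec (w i) (w i) := fun i hi v => by simp [hZ, hi]
  have hs : ∀ i v, (Z i v).IsSymm := by
    intro i v
    by_cases hi : i ∈ S
    · rw [hZS i hi]
      exact IsSymm.smul (by rw [IsSymm, transpose_vecMulVec]) _
    · simp [hZ, hi]
  have hq : ∀ i ∈ S, ∀ v x, x ⬝ᵥ (Z i v *ᵥ x) = c i v * (w i ⬝ᵥ x) ^ 2 := by
    intro i hi v x
    rw [hZS i hi, smul_mulVec, dotProduct_smul, dotProduct_vecMulVec_mulVec, smul_eq_mul]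
  have hcs : ∀ i x, (w i ⬝ᵥ x) ^ 2 ≤ (w i ⬝ᵥ w i) * (x ⬝ᵥ x) := by
    intro i x
    have := Finset.sum_mul_sq_le_sq_mul_sq Finset.univ (w i) x
    simpa [dotProduct, pow_two] using this
  have hnn : ∀ x : m → ℝ, 0 ≤ x ⬝ᵥ x := fun x => Finset.sum_nonneg fun i _ => mul_self_nonneg _
  have hmain := avg_trace_exp_sum_le Z hs (by
    intro i v x
    by_cases hi : i ∈ S
    · rw [hq i hi]
      by_cases hc : 0 ≤ c i v
      · calc c i v * (w i ⬝ᵥ x) ^ 2 ≤ c i v * ((w i ⬝ᵥ w i) * (x ⬝ᵥ x)) := by gcongr; exact hcs i x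
          _ = c i v * (w i ⬝ᵥ w i) * (x ⬝ᵥ x) := by ring
          _ ≤ 1 * (x ⬝ᵥ x) := mul_le_mul_of_nonneg_right (h1 i hi v) (hnn x)
          _ = _ := one_mul _
      · push Not at hc
        nlinarith [hnn x, sq_nonneg (w i ⬝ᵥ x)]
    · simp [hZ, hi, hnn x]) S (by
    intro i hi x
    have : ∀ v, x ⬝ᵥ ((Z i v + Z i v * Z i v) *ᵥ x)
        = (w i ⬝ᵥ x) ^ 2 * (c i v + c i v ^ 2 * (w i ⬝ᵥ w i)) := by
      intro v
      rw [add_mulVec, dotProduct_add, hq i hi, ← mulVec_mulVec, hZS i hi]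
      simp only [smul_mulVec, vecMulVec_mulVec, mulVec_smul, dotProduct_smul, smul_eq_mul,
        op_smul_eq_smul, dotProduct_comm x (w i)]
      ring
    simp only [this]
    rw [avg_const_mul]
    exact mul_nonpos_of_nonneg_of_nonpos (sq_nonneg _) (h2 i hi))
  have htr : ∀ ω : ι → β, 0 ≤ (NormedSpace.exp (∑ i ∈ S, Z i (ω i))).trace := by
    intro ω
    have hs' : (∑ i ∈ S, Z i (ω i)).IsSymm := by
      rw [IsSymm, transpose_sum]
      exact Finset.sum_congr rfl fun j _ => hs j _
    obtain ⟨U, l, hU, hUl⟩ := hs'.exists_diagonalization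
    rw [hUl, exp_diagonalization hU, Matrix.mul_assoc, trace_mul_comm, Matrix.mul_assoc, hU,
      Matrix.mul_one, trace_diagonal]
    exact Finset.sum_nonneg fun i _ => (Real.exp_pos _).le
  calc _ ≤ prob (fun ω : ι → β => Real.exp t < (NormedSpace.exp (∑ i ∈ S, Z i (ω i))).trace) := by
        refine prob_mono fun ω => ?_
        rintro ⟨x, hx⟩
        by_contra hle
        push Not at hle
        have hs' : (∑ i ∈ S, Z i (ω i)).IsSymm := by
          rw [IsSymm, transpose_sum]
          exact Finset.sum_congr rfl fun j _ => hs j _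
        have := dotProduct_le_of_trace_exp_le hs' hle x
        rw [sum_mulVec, dotProduct_sum, Finset.sum_congr rfl fun i hi => hq i hi (ω i) x] at this
        linarith
    _ ≤ _ := prob_lt_le_div htr (Real.exp_pos t)
    _ ≤ Fintype.card m / Real.exp t := by gcongr
    _ = _ := by rw [Real.exp_neg, div_eq_mul_inv]

theorem avg_coin {N q : ℕ} (hq : q ≤ N) (a b : ℝ) :
    avg (fun v : Fin N => if (v : ℕ) < q then a else b) = (q * a + (N - q) * b) / N := by
  rw [avg, Finset.sum_ite]
  have h1 : (Finset.univ.filter fun v : Fin N => (v : ℕ) < q).card = q := by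
    rw [Fin.card_filter_val_lt, min_eq_right hq]
  have h2 : (Finset.univ.filter fun v : Fin N => ¬ (v : ℕ) < q).card = N - q := by
    have := Finset.card_filter_add_card_filter_not (s := Finset.univ) (fun v : Fin N => (v : ℕ) < q)
    rw [h1, Finset.card_univ, Fintype.card_fin] at this
    omega
  rw [Finset.sum_const, Finset.sum_const, h1, h2, Fintype.card_fin, nsmul_eq_mul, nsmul_eq_mul,
    Nat.cast_sub hq]

/-- Independent sampling of rank-one matrices concentrates around the mean. -/
theorem prob_sampling_bad {m ι : Type*} [Fintype m] [DecidableEq m] [Fintype ι] [DecidableEq ι]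
    {N : ℕ} (hN : 0 < N) (w : ι → m → ℝ) (q : ι → ℕ) (hq0 : ∀ i, 0 < q i) (hqN : ∀ i, q i ≤ N)
    {R α t : ℝ} (hR : 0 < R) (hα : 0 < α) (hα1 : α ≤ 1) (ht : t ≤ α ^ 2 * R)
    (hw : ∀ i, q i = N ∨ R * (w i ⬝ᵥ w i) ≤ q i / N)
    (hsum : ∀ x, ∑ i, (w i ⬝ᵥ x) ^ 2 ≤ x ⬝ᵥ x) :
    prob (fun ω : ι → Fin N => ∃ x, 2 * α * (x ⬝ᵥ x) <
      |∑ i, ((if (ω i : ℕ) < q i then (N : ℝ) / q i else 0) - 1) * (w i ⬝ᵥ x) ^ 2|)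
      ≤ 2 * (Fintype.card m * Real.exp (-t)) := by
  have : Nonempty (Fin N) := ⟨⟨0, hN⟩⟩
  have hN' : (0 : ℝ) < N := by exact_mod_cast hN
  -- Rows with `q i = N` are taken with certainty and weight 1, so they do not deviate; they need
  -- not satisfy any bound on `w i`.
  set S : Finset ι := Finset.univ.filter fun i => q i ≠ N with hS
  set θ := α * R with hθ
  have hθ0 : 0 < θ := by positivity
  set D : (ι → Fin N) → (m → ℝ) → ℝ := fun ω x =>
    ∑ i, ((if (ω i : ℕ) < q i then (N : ℝ) / q i else 0) - 1) * (w i ⬝ᵥ x) ^ 2 with hD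
  have hDS : ∀ ω x, D ω x
      = ∑ i ∈ S, ((if (ω i : ℕ) < q i then (N : ℝ) / q i else 0) - 1) * (w i ⬝ᵥ x) ^ 2 := by
    intro ω x
    rw [hD, hS, Finset.sum_filter]
    refine Finset.sum_congr rfl fun i _ => ?_
    by_cases h : q i = N
    · have : ((ω i : Fin N) : ℕ) < q i := by rw [h]; exact (ω i).2
      simp [h, hN'.ne']
    · simp [h]
  have main : ∀ σ : ℝ, (σ = 1 ∨ σ = -1) →
      prob (fun ω : ι → Fin N => ∃ x, 2 * α * (x ⬝ᵥ x) < σ * D ω x)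
        ≤ Fintype.card m * Real.exp (-t) := by
    intro σ hσ
    have hσ2 : σ ^ 2 = 1 := by rcases hσ with rfl | rfl <;> norm_num
    -- The centred weights are shifted by `-α` to make room for the second moment, and scaled by `θ
    -- = αR`. A deviation above `2α` loses `α` to the shift, and the remaining `θα = α²R` is at
    -- least `t`.
    set c : ι → Fin N → ℝ := fun i v =>
      θ * (σ * ((if (v : ℕ) < q i then (N : ℝ) / q i else 0) - 1) - α) with hc
    refine le_trans (prob_mono ?_) (prob_sum_rankOne_gt w c S ?_ ?_ t)
    · rintro ω ⟨x, hx⟩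
      refine ⟨x, ?_⟩
      have e : ∑ i ∈ S, c i (ω i) * (w i ⬝ᵥ x) ^ 2
          = θ * (σ * D ω x) - θ * α * ∑ i ∈ S, (w i ⬝ᵥ x) ^ 2 := by
        rw [hDS, Finset.mul_sum, Finset.mul_sum, Finset.mul_sum, ← Finset.sum_sub_distrib]
        exact Finset.sum_congr rfl fun i _ => by rw [hc]; ring
      have h3 : ∑ i ∈ S, (w i ⬝ᵥ x) ^ 2 ≤ x ⬝ᵥ x :=
        (Finset.sum_le_sum_of_subset_of_nonneg (Finset.subset_univ S)
          fun i _ _ => sq_nonneg _).trans (hsum x)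
      have hxx : 0 ≤ x ⬝ᵥ x := Finset.sum_nonneg fun i _ => mul_self_nonneg _
      rw [e]
      have h4 : θ * α * ∑ i ∈ S, (w i ⬝ᵥ x) ^ 2 ≤ θ * α * (x ⬝ᵥ x) := by gcongr
      have h5 : t * (x ⬝ᵥ x) ≤ θ * α * (x ⬝ᵥ x) := by
        refine mul_le_mul_of_nonneg_right (ht.trans (le_of_eq ?_)) hxx
        rw [hθ]; ring
      have h6 : θ * (2 * α * (x ⬝ᵥ x)) < θ * (σ * D ω x) := by gcongr
      linarith
    · intro i hi v
      have hiN : q i ≠ N := (Finset.mem_filter.1 hi).2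
      have hw' := (hw i).resolve_left hiN
      have hq' : (0 : ℝ) < q i := by exact_mod_cast hq0 i
      have hqN' : (q i : ℝ) ≤ N := by exact_mod_cast hqN i
      have hww : 0 ≤ w i ⬝ᵥ w i := Finset.sum_nonneg fun i _ => mul_self_nonneg _
      have hb : 1 ≤ (N : ℝ) / q i := by rw [le_div_iff₀ hq']; linarith
      have h3 : c i v ≤ θ * (N / q i) := by
        simp only [hc]
        gcongr
        rcases hσ with rfl | rfl <;> split_ifs <;> linarith
      calc c i v * (w i ⬝ᵥ w i) ≤ θ * (N / q i) * (w i ⬝ᵥ w i) := by gcongr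
        _ = α * (N / q i) * (R * (w i ⬝ᵥ w i)) := by rw [hθ]; ring
        _ ≤ α * (N / q i) * (q i / N) := by gcongr
        _ = α := by field_simp
        _ ≤ 1 := hα1
    · intro i hi
      have hiN : q i ≠ N := (Finset.mem_filter.1 hi).2
      have hw' := (hw i).resolve_left hiN
      have hq' : (0 : ℝ) < q i := by exact_mod_cast hq0 i
      have hww : 0 ≤ w i ⬝ᵥ w i := Finset.sum_nonneg fun i _ => mul_self_nonneg _
      set W := w i ⬝ᵥ w i
      set u := (N : ℝ) / q i with hu
      have huq : (q i : ℝ) * u = N := by rw [hu]; field_simp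
      have hfun : (fun v => c i v + c i v ^ 2 * W) = fun v : Fin N => if (v : ℕ) < q i then
          θ * (σ * (u - 1) - α) + (θ * (σ * (u - 1) - α)) ^ 2 * W else
          θ * (σ * (0 - 1) - α) + (θ * (σ * (0 - 1) - α)) ^ 2 * W := by
        funext v
        simp only [hc]
        split_ifs <;> rfl
      rw [hfun, avg_coin (hqN i)]
      refine div_nonpos_of_nonpos_of_nonneg ?_ hN'.le
      have hb2 : θ * (u * W) ≤ α := by
        have : R * W * u ≤ q i / N * u := by gcongr
        have h3 : (q i : ℝ) / N * u = 1 := by rw [hu]; field_simp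
        rw [hθ]; nlinarith
      -- Before scaling by `θ`, the weight has mean `-α` and second moment `(u - 1) + α²`. The sign
      -- drops out through `σ² = 1`.
      have e : (q i : ℝ) * (θ * (σ * (u - 1) - α) + (θ * (σ * (u - 1) - α)) ^ 2 * W) +
          ((N : ℝ) - q i) * (θ * (σ * (0 - 1) - α) + (θ * (σ * (0 - 1) - α)) ^ 2 * W)
          = N * θ * (-α + θ * W * (u - 1 + α ^ 2)) := by
        rw [← huq]
        linear_combination (q i : ℝ) * θ ^ 2 * W * u * (u - 1) * hσ2
      rw [e]
      refine mul_nonpos_of_nonneg_of_nonpos (by positivity) ?_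
      have : θ * W * (u - 1 + α ^ 2) ≤ θ * W * u := by
        gcongr
        nlinarith
      nlinarith
  refine le_trans (prob_mono (q := fun ω => (∃ x, 2 * α * (x ⬝ᵥ x) < 1 * D ω x) ∨
    (∃ x, 2 * α * (x ⬝ᵥ x) < -1 * D ω x)) ?_) ((prob_or _ _).trans ?_)
  · rintro ω ⟨x, hx⟩
    rcases lt_abs.1 hx with h | h
    · exact Or.inl ⟨x, by simpa [hD] using h⟩
    · exact Or.inr ⟨x, by simpa [hD] using h⟩
  · rw [two_mul (_ * _)]
    exact add_le_add (main 1 (Or.inl rfl)) (main (-1) (Or.inr rfl))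

/-! ### Positive definite matrices and leverage -/

/-- Real symmetric positive definite matrices. -/
structure IsSPD {m : Type*} [Fintype m] (M : Matrix m m ℝ) : Prop where
  symm : M.IsSymm
  pos : ∀ x, x ≠ 0 → 0 < x ⬝ᵥ (M *ᵥ x)

/-- The leverage `aᵀ M⁻¹ a` of a vector. -/
noncomputable def lev {m : Type*} [Fintype m] [DecidableEq m] (M : Matrix m m ℝ) (a : m → ℝ) : ℝ :=
  a ⬝ᵥ (M⁻¹ *ᵥ a)

theorem dotProduct_self_nonneg' {m : Type*} [Fintype m] (x : m → ℝ) : 0 ≤ x ⬝ᵥ x :=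
  Finset.sum_nonneg fun _ _ => mul_self_nonneg _

theorem dotProduct_sq_le {m : Type*} [Fintype m] (x y : m → ℝ) :
    (x ⬝ᵥ y) ^ 2 ≤ (x ⬝ᵥ x) * (y ⬝ᵥ y) := by
  have := Finset.sum_mul_sq_le_sq_mul_sq Finset.univ x y
  simpa [dotProduct, pow_two] using this

theorem mulVec_dotProduct_mulVec {m n : Type*} [Fintype m] [Fintype n] (A : Matrix m n ℝ)
    (x : n → ℝ) (y : m → ℝ) : (A *ᵥ x) ⬝ᵥ y = x ⬝ᵥ (Aᵀ *ᵥ y) := by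
  rw [Matrix.dotProduct_mulVec, Matrix.vecMul_transpose]

namespace IsSPD

variable {m : Type*} [Fintype m] [DecidableEq m] {M P : Matrix m m ℝ}

theorem exists_whitening (hM : IsSPD M) : ∃ C : Matrix m m ℝ, Cᵀ * M * C = 1 := by
  obtain ⟨U, l, hU, rfl⟩ := hM.symm.exists_diagonalization
  have hl : ∀ i, 0 < l i := by
    intro i
    have e1 : Uᵀ *ᵥ (U *ᵥ Pi.single i 1) = Pi.single i (1 : ℝ) := by
      rw [Matrix.mulVec_mulVec, hU, Matrix.one_mulVec]
    have h := hM.pos (U *ᵥ Pi.single i 1) (by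
      intro h0
      rw [h0, Matrix.mulVec_zero] at e1
      have := congrFun e1 i
      simp at this)
    rw [Matrix.dotProduct_diagonalization, e1] at h
    simpa [Pi.single_apply, Finset.sum_ite_eq] using h
  refine ⟨U * Matrix.diagonal fun i => (Real.sqrt (l i))⁻¹, ?_⟩
  rw [Matrix.transpose_mul, Matrix.diagonal_transpose]
  calc _ = Matrix.diagonal (fun i => (Real.sqrt (l i))⁻¹) * (Uᵀ * U) * Matrix.diagonal l
        * (Uᵀ * U) * Matrix.diagonal (fun i => (Real.sqrt (l i))⁻¹) := by
        simp only [Matrix.mul_assoc]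
    _ = 1 := by
      rw [hU, Matrix.mul_one, Matrix.mul_one, Matrix.diagonal_mul_diagonal,
        Matrix.diagonal_mul_diagonal, ← Matrix.diagonal_one]
      congr 1
      funext i
      have h1 := Real.sq_sqrt (hl i).le
      have h2 := Real.sqrt_pos.2 (hl i)
      field_simp
      linarith

theorem inv_eq_of_whitening {C : Matrix m m ℝ} (hC : Cᵀ * M * C = 1) : M⁻¹ = C * Cᵀ := by
  apply Matrix.inv_eq_left_inv
  have h1 : C * (Cᵀ * M) = 1 := mul_eq_one_comm.1 hC
  rw [Matrix.mul_assoc, h1]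

theorem mul_inv (hM : IsSPD M) : M * M⁻¹ = 1 := by
  obtain ⟨C, hC⟩ := hM.exists_whitening
  rw [inv_eq_of_whitening hC]
  have h1 : C * (Cᵀ * M) = 1 := mul_eq_one_comm.1 hC
  rw [mul_eq_one_comm, Matrix.mul_assoc, h1]

theorem inv_mul (hM : IsSPD M) : M⁻¹ * M = 1 := mul_eq_one_comm.1 hM.mul_inv

theorem lev_eq {C : Matrix m m ℝ} (hC : Cᵀ * M * C = 1) (a : m → ℝ) :
    lev M a = (Cᵀ *ᵥ a) ⬝ᵥ (Cᵀ *ᵥ a) := by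
  rw [lev, inv_eq_of_whitening hC, ← Matrix.mulVec_mulVec, mulVec_dotProduct_mulVec,
    Matrix.transpose_transpose]

theorem lev_nonneg (hM : IsSPD M) (a : m → ℝ) : 0 ≤ lev M a := by
  obtain ⟨C, hC⟩ := hM.exists_whitening
  rw [lev_eq hC]
  exact dotProduct_self_nonneg' _

theorem sq_dotProduct_le (hM : IsSPD M) (a x : m → ℝ) :
    (a ⬝ᵥ x) ^ 2 ≤ lev M a * (x ⬝ᵥ (M *ᵥ x)) := by
  obtain ⟨C, hC⟩ := hM.exists_whitening
  have h1 : C * (Cᵀ * M) = 1 := mul_eq_one_comm.1 hC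
  set z := (Cᵀ * M) *ᵥ x with hz
  have hx : C *ᵥ z = x := by rw [hz, Matrix.mulVec_mulVec, h1, Matrix.one_mulVec]
  have h2 : a ⬝ᵥ x = (Cᵀ *ᵥ a) ⬝ᵥ z := by
    rw [mulVec_dotProduct_mulVec, Matrix.transpose_transpose, hx]
  have h3 : z ⬝ᵥ z = x ⬝ᵥ (M *ᵥ x) := by
    have h4 : (C *ᵥ z) ⬝ᵥ (M *ᵥ (C *ᵥ z)) = z ⬝ᵥ z := by
      rw [mulVec_dotProduct_mulVec, Matrix.mulVec_mulVec, Matrix.mulVec_mulVec, hC,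
        Matrix.one_mulVec]
    rw [← h4, hx]
  rw [h2, lev_eq hC, ← h3]
  exact dotProduct_sq_le _ _

theorem inv_mulVec_dot (hM : IsSPD M) (a : m → ℝ) :
    (M⁻¹ *ᵥ a) ⬝ᵥ (M *ᵥ (M⁻¹ *ᵥ a)) = lev M a := by
  rw [Matrix.mulVec_mulVec, hM.mul_inv, Matrix.one_mulVec, dotProduct_comm, lev]

/-- Inversion reverses the order of positive definite matrices: apply Cauchy–Schwarz for `P` to `a`
and `M⁻¹ a`, and divide by the leverage. -/
theorem lev_le_mul (hM : IsSPD M) (hP : IsSPD P) {c : ℝ} (hc : 0 ≤ c)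
    (h : ∀ x, x ⬝ᵥ (P *ᵥ x) ≤ c * (x ⬝ᵥ (M *ᵥ x))) (a : m → ℝ) : lev M a ≤ c * lev P a := by
  have h1 := hP.sq_dotProduct_le a (M⁻¹ *ᵥ a)
  have h2 := h (M⁻¹ *ᵥ a)
  rw [hM.inv_mulVec_dot] at h2
  change lev M a ^ 2 ≤ _ at h1
  have h3 := hM.lev_nonneg a
  have h4 := hP.lev_nonneg a
  have h5 : lev M a * lev M a ≤ (c * lev P a) * lev M a := by
    have := mul_le_mul_of_nonneg_left h2 h4
    nlinarith
  rcases h3.eq_or_lt with h0 | h0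
  · rw [← h0]; positivity
  · exact le_of_mul_le_mul_right h5 h0

/-- The Sherman–Morrison formula, tested on `a` itself. -/
theorem lev_add_vecMulVec (hM : IsSPD M) (a : m → ℝ)
    (hP : IsSPD (M + Matrix.vecMulVec a a)) :
    lev (M + Matrix.vecMulVec a a) a = lev M a / (1 + lev M a) := by
  have h0 := hM.lev_nonneg a
  set P := M + Matrix.vecMulVec a a with hPdef
  have h1 : P *ᵥ (M⁻¹ *ᵥ a) = (1 + lev M a) • a := by
    rw [hPdef, Matrix.add_mulVec, Matrix.mulVec_mulVec, hM.mul_inv, Matrix.one_mulVec,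
      Matrix.vecMulVec_mulVec, add_smul, one_smul, op_smul_eq_smul]
    rfl
  have h2 : P⁻¹ *ᵥ a = (1 + lev M a)⁻¹ • (M⁻¹ *ᵥ a) := by
    have h3 : M⁻¹ *ᵥ a = (1 + lev M a) • (P⁻¹ *ᵥ a) := by
      rw [← Matrix.mulVec_smul, ← h1, Matrix.mulVec_mulVec, hP.inv_mul, Matrix.one_mulVec]
    rw [h3, smul_smul, inv_mul_cancel₀ (by positivity), one_smul]
  rw [lev, h2, dotProduct_smul, smul_eq_mul, ← lev]
  field_simp

end IsSPD

/-! ### Regularized Gram matrices -/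

section Gram

variable {m ι : Type*} [Fintype m] [DecidableEq m] [Fintype ι]

/-- `lam I + ∑ c_r a_r a_rᵀ`. -/
noncomputable def gram {m : Type*} [DecidableEq m] (lam : ℝ) (a : ι → m → ℝ) (c : ι → ℝ) : Matrix m m ℝ :=
  lam • 1 + ∑ r, c r • Matrix.vecMulVec (a r) (a r)

theorem dotProduct_gram (lam : ℝ) (a : ι → m → ℝ) (c : ι → ℝ) (x : m → ℝ) :
    x ⬝ᵥ (gram lam a c *ᵥ x) = lam * (x ⬝ᵥ x) + ∑ r, c r * (a r ⬝ᵥ x) ^ 2 := by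
  rw [gram, Matrix.add_mulVec, Matrix.sum_mulVec, dotProduct_add, dotProduct_sum,
    Matrix.smul_mulVec, Matrix.one_mulVec, dotProduct_smul, smul_eq_mul]
  congr 1
  refine Finset.sum_congr rfl fun r _ => ?_
  rw [Matrix.smul_mulVec, dotProduct_smul, Matrix.dotProduct_vecMulVec_mulVec, smul_eq_mul]

theorem gram_isSymm {m : Type*} [DecidableEq m] (lam : ℝ) (a : ι → m → ℝ) (c : ι → ℝ) : (gram lam a c).IsSymm := by
  rw [Matrix.IsSymm, gram, Matrix.transpose_add, Matrix.transpose_sum, Matrix.transpose_smul,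
    Matrix.transpose_one]
  congr 1
  exact Finset.sum_congr rfl fun r _ => by
    rw [Matrix.transpose_smul, Matrix.transpose_vecMulVec]

theorem dotProduct_self_pos {m : Type*} [Fintype m] {x : m → ℝ} (hx : x ≠ 0) : 0 < x ⬝ᵥ x := by
  refine lt_of_le_of_ne (dotProduct_self_nonneg' x) fun h => hx ?_
  exact dotProduct_self_eq_zero.1 h.symm

theorem gram_isSPD {lam : ℝ} (hl : 0 < lam) (a : ι → m → ℝ) {c : ι → ℝ} (hc : ∀ r, 0 ≤ c r) :
    IsSPD (gram lam a c) := by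
  refine ⟨gram_isSymm lam a c, fun x hx => ?_⟩
  rw [dotProduct_gram]
  have h1 := mul_pos hl (dotProduct_self_pos hx)
  have h2 : 0 ≤ ∑ r, c r * (a r ⬝ᵥ x) ^ 2 :=
    Finset.sum_nonneg fun r _ => mul_nonneg (hc r) (sq_nonneg _)
  linarith

/-- The sum is `tr(G⁻¹ (G - lam))`, which is the dimension minus a nonnegative trace. -/
theorem sum_lev_gram_le {lam : ℝ} (hl : 0 < lam) (a : ι → m → ℝ) {c : ι → ℝ}
    (hc : ∀ r, 0 ≤ c r) : ∑ r, c r * lev (gram lam a c) (a r) ≤ Fintype.card m := by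
  set G := gram lam a c with hG
  have hS : IsSPD G := gram_isSPD hl a hc
  have h1 : ∑ r, c r * lev G (a r) = (G⁻¹ * (G - lam • 1)).trace := by
    have : G - lam • 1 = ∑ r, c r • Matrix.vecMulVec (a r) (a r) := by simp [hG, gram]
    rw [this, Matrix.mul_sum, Matrix.trace_sum]
    refine Finset.sum_congr rfl fun r _ => ?_
    rw [Matrix.mul_smul, Matrix.trace_smul, Matrix.mul_vecMulVec, Matrix.trace_vecMulVec, lev,
      dotProduct_comm, smul_eq_mul]
  obtain ⟨C, hC⟩ := hS.exists_whitening
  have h2 : 0 ≤ (G⁻¹).trace := by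
    rw [IsSPD.inv_eq_of_whitening hC]
    simp only [Matrix.trace, Matrix.diag_apply, Matrix.mul_apply, Matrix.transpose_apply]
    exact Finset.sum_nonneg fun i _ => Finset.sum_nonneg fun j _ => mul_self_nonneg _
  rw [h1, Matrix.mul_sub, hS.inv_mul, Matrix.mul_smul, Matrix.mul_one, Matrix.trace_sub,
    Matrix.trace_one, Matrix.trace_smul, smul_eq_mul]
  have := mul_nonneg hl.le h2
  linarith

/-- A uniformly random half of the rows yields leverage overestimates of small total size. -/
theorem avg_sum_min_lev_le [DecidableEq ι] {lam : ℝ} (hl : 0 < lam) (a : ι → m → ℝ) :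
    avg (fun h : ι → Bool => ∑ r, min 1 (lev (gram lam a fun t => if h t then 1 else 0) (a r)))
      ≤ 3 * Fintype.card m := by
  set G : (ι → Bool) → Matrix m m ℝ := fun h => gram lam a fun t => if h t then 1 else 0 with hG
  have hSPD : ∀ h, IsSPD (G h) := fun h => gram_isSPD hl a fun r => by split_ifs <;> norm_num
  have hupd : ∀ h r, G (Function.update h r true)
      = G (Function.update h r false) + Matrix.vecMulVec (a r) (a r) := by
    intro h r
    simp only [hG, gram]
    rw [add_assoc]
    congr 1
    rw [← Finset.add_sum_erase _ _ (Finset.mem_univ r),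
      ← Finset.add_sum_erase Finset.univ
        (fun t => (if Function.update h r false t = true then (1 : ℝ) else 0)
          • Matrix.vecMulVec (a t) (a t)) (Finset.mem_univ r)]
    simp only [Function.update_self, if_true, one_smul, Bool.false_eq_true, if_false, zero_smul,
      zero_add]
    rw [add_comm]
    congr 1
    refine Finset.sum_congr rfl fun t ht => ?_
    rw [Function.update_of_ne (Finset.ne_of_mem_erase ht),
      Function.update_of_ne (Finset.ne_of_mem_erase ht)]
  -- Average over the coin of row `r` alone. If `x` is its leverage without itself, it becomes `x /
  -- (1 + x)` with itself; since `min 1 x ≤ 2x/(1 + x)`, both outcomes together cost at most three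
  -- times the leverage of `r` when present. These last leverages sum to at most the dimension.
  have hone : ∀ r, avg (fun h => min 1 (lev (G h) (a r)))
      ≤ 3 * avg (fun h => (if h r then 1 else 0) * lev (G h) (a r)) := by
    intro r
    rw [← avg_const_mul, avg_update r, avg_update r (fun h => 3 * _)]
    refine avg_mono fun h => ?_
    simp only [avg, Fintype.sum_bool, Function.update_self, Bool.false_eq_true, if_true, if_false]
    refine div_le_div_of_nonneg_right ?_ (Nat.cast_nonneg _)
    have h1 : IsSPD (G (Function.update h r false) + Matrix.vecMulVec (a r) (a r)) := by
      rw [← hupd]; exact hSPD _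
    rw [hupd, (hSPD _).lev_add_vecMulVec (a r) h1]
    set x := lev (G (Function.update h r false)) (a r) with hx
    have hx0 : 0 ≤ x := (hSPD _).lev_nonneg _
    have h2 : min 1 x ≤ 2 * (x / (1 + x)) := by
      rw [← mul_div_assoc, le_div_iff₀ (by positivity)]
      rcases le_total 1 x with h | h
      · rw [min_eq_left h]; linarith
      · rw [min_eq_right h]; nlinarith
    have h3 : min 1 (x / (1 + x)) ≤ x / (1 + x) := min_le_right _ _
    linarith
  rw [avg_sum]
  refine (Finset.sum_le_sum fun r _ => hone r).trans ?_
  rw [← Finset.mul_sum, ← avg_sum]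
  gcongr
  rw [← avg_const (Ω := ι → Bool) (Fintype.card m : ℝ)]
  exact avg_mono fun h => sum_lev_gram_le hl a fun r => by split_ifs <;> norm_num

end Gram

/-! ### Random signs -/

section Signs

/-- The sign of a bit. -/
def sgn (b : Bool) : ℝ := if b then 1 else -1

theorem sgn_true : sgn true = 1 := rfl

theorem sgn_false : sgn false = -1 := rfl

variable {m : Type*} [Fintype m] [DecidableEq m]

theorem avg_signs_sum (v : m → ℝ) (S : Finset m) :
    avg (fun g : m → Bool => (∑ i ∈ S, v i * sgn (g i)) ^ 2) = ∑ i ∈ S, v i ^ 2 ∧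
    avg (fun g : m → Bool => (∑ i ∈ S, v i * sgn (g i)) ^ 4) ≤ 3 * (∑ i ∈ S, v i ^ 2) ^ 2 := by
  induction S using Finset.induction_on with
  | empty => simp [avg_const]
  | insert i S hi ih =>
    have hsum : ∀ (g : m → Bool) (b : Bool), ∑ j ∈ insert i S, v j * sgn (Function.update g i b j)
        = v i * sgn b + ∑ j ∈ S, v j * sgn (g j) := by
      intro g b
      rw [Finset.sum_insert hi, Function.update_self]
      congr 1
      refine Finset.sum_congr rfl fun j hj => ?_
      rw [Function.update_of_ne]
      rintro rfl
      exact hi hj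
    rw [Finset.sum_insert hi]
    constructor
    · rw [avg_update i, ← ih.1]
      have : ∀ g : m → Bool, avg (fun b => (∑ j ∈ insert i S, v j * sgn (Function.update g i b j)) ^ 2)
          = v i ^ 2 + (∑ j ∈ S, v j * sgn (g j)) ^ 2 := by
        intro g
        simp only [hsum, avg, Fintype.sum_bool, sgn_true, sgn_false, Fintype.card_bool]
        push_cast
        ring
      simp only [this, avg_add, avg_const]
    · rw [avg_update i]
      have : ∀ g : m → Bool, avg (fun b => (∑ j ∈ insert i S, v j * sgn (Function.update g i b j)) ^ 4)
          = v i ^ 4 + (6 * v i ^ 2 * (∑ j ∈ S, v j * sgn (g j)) ^ 2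
            + (∑ j ∈ S, v j * sgn (g j)) ^ 4) := by
        intro g
        simp only [hsum, avg, Fintype.sum_bool, sgn_true, sgn_false, Fintype.card_bool]
        push_cast
        ring
      simp only [this, avg_add, avg_const, avg_const_mul, ih.1]
      nlinarith [ih.2, sq_nonneg (v i ^ 2)]

theorem avg_signs_sq (v : m → ℝ) :
    avg (fun g : m → Bool => (v ⬝ᵥ fun i => sgn (g i)) ^ 2) = v ⬝ᵥ v := by
  have := (avg_signs_sum v Finset.univ).1
  simpa [dotProduct, pow_two] using this

theorem avg_signs_pow_four (v : m → ℝ) :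
    avg (fun g : m → Bool => (v ⬝ᵥ fun i => sgn (g i)) ^ 4) ≤ 3 * (v ⬝ᵥ v) ^ 2 := by
  have := (avg_signs_sum v Finset.univ).2
  simpa [dotProduct, pow_two] using this

/-- A Paley–Zygmund argument with the second and fourth moments. The probability is far from small,
but it is bounded away from 1, and independent repetitions do the rest. -/
theorem prob_signs_small (v : m → ℝ) :
    prob (fun g : m → Bool => (v ⬝ᵥ fun i => sgn (g i)) ^ 2 < v ⬝ᵥ v / 2) ≤ 9 / 10 := by
  set V := v ⬝ᵥ v with hV
  have hV0 : 0 ≤ V := dotProduct_self_nonneg' v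
  rcases hV0.eq_or_lt with h0 | hpos
  · rw [← h0]
    have : prob (fun g : m → Bool => (v ⬝ᵥ fun i => sgn (g i)) ^ 2 < 0 / 2) ≤ prob (fun g : m → Bool => False) :=
      prob_mono fun g hg => by nlinarith [sq_nonneg (v ⬝ᵥ fun i => sgn (g i))]
    refine this.trans ?_
    simp only [prob, avg, if_false, Finset.sum_const_zero, zero_div]
    norm_num
  · have h2 := avg_signs_sq v
    have h4 := avg_signs_pow_four v
    -- The indicator of `y < 1/2`, with `y = X / V`, lies below the parabola `1 + 16/361 (y - 1/2)(y
    -- - 10)`, whose minimum, at `y = 21/4`, is 0. With mean 1 and second moment at most 3 the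
    -- parabola averages to at most `1 - 40/361`.
    have hb : prob (fun g : m → Bool => (v ⬝ᵥ fun i => sgn (g i)) ^ 2 < V / 2)
        ≤ avg (fun g : m → Bool => 1 + (4 / 361 / V ^ 2 * (4 * (v ⬝ᵥ fun i => sgn (g i)) ^ 4)
          + -(42 * 4 / 361 / V) * (v ⬝ᵥ fun i => sgn (g i)) ^ 2 + 20 * 4 / 361)) := by
      refine avg_mono fun g => ?_
      set X := (v ⬝ᵥ fun i => sgn (g i)) ^ 2 with hX
      have e4 : (v ⬝ᵥ fun i => sgn (g i)) ^ 4 = X ^ 2 := by rw [hX]; ring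
      have hX0 : 0 ≤ X := sq_nonneg _
      rw [e4]
      have e : 1 + (4 / 361 / V ^ 2 * (4 * X ^ 2) + -(42 * 4 / 361 / V) * X + 20 * 4 / 361)
          = 1 + 16 / 361 * ((X / V) - 1 / 2) * (X / V - 10) := by
        field_simp; ring
      rw [e]
      set y := X / V with hy
      have hy0 : 0 ≤ y := by positivity
      split_ifs with h
      · have : y < 1 / 2 := by rw [hy, div_lt_iff₀ hpos]; linarith
        nlinarith
      · nlinarith [sq_nonneg (y - 21 / 4)]
    refine hb.trans ?_
    rw [avg_add, avg_add, avg_add, avg_const, avg_const, avg_const_mul, avg_const_mul,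
      avg_const_mul, h2]
    have h5 : 4 / 361 / V ^ 2 * (4 * avg (fun g : m → Bool => (v ⬝ᵥ fun i => sgn (g i)) ^ 4))
        ≤ 4 / 361 / V ^ 2 * (4 * (3 * V ^ 2)) := by gcongr
    have h6 : 4 / 361 / V ^ 2 * (4 * (3 * V ^ 2)) = 48 / 361 := by field_simp; norm_num
    have h7 : -(42 * 4 / 361 / V) * V = -(168 / 361) := by field_simp; norm_num
    rw [← hV, h7]
    linarith

theorem avg_prod_pi {ι β : Type*} [Fintype ι] [DecidableEq ι] [Fintype β] (f : β → ℝ) :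
    avg (fun ω : ι → β => ∏ i, f (ω i)) = avg f ^ Fintype.card ι := by
  have h := Finset.prod_univ_sum (fun _ : ι => (Finset.univ : Finset β)) (fun _ v => f v)
  rw [Fintype.piFinset_univ] at h
  rw [avg, ← h, avg, div_pow]
  simp

theorem prob_forall {ι β : Type*} [Fintype ι] [DecidableEq ι] [Fintype β] (p : β → Prop) :
    prob (fun ω : ι → β => ∀ i, p (ω i)) = prob p ^ Fintype.card ι := by
  classical
  rw [prob, prob, ← avg_prod_pi]
  congr 1
  funext ω
  by_cases h : ∀ i, p (ω i)
  · simp [h]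
  · rw [if_neg h]
    push Not at h
    obtain ⟨i, hi⟩ := h
    exact (Finset.prod_eq_zero (Finset.mem_univ i) (by simp [hi])).symm

end Signs

/-! ### One step of leverage score sampling -/

section Sampling

variable {m ι : Type*} [Fintype m] [DecidableEq m] [Fintype ι] {K : ℕ}

open Classical in
/-- A matrix `C` with `Cᵀ M C = 1`. -/
noncomputable def whitening (M : Matrix m m ℝ) : Matrix m m ℝ :=
  if h : ∃ C : Matrix m m ℝ, Cᵀ * M * C = 1 then h.choose else 0

theorem IsSPD.whitening_spec {M : Matrix m m ℝ} (hM : IsSPD M) :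
    (whitening M)ᵀ * M * whitening M = 1 := by
  have h := hM.exists_whitening
  rw [whitening, dif_pos h]
  exact h.choose_spec

/-- The vectors `C g_k`, for sign vectors `g_k` and `Cᵀ M C = 1`, rounded to the grid `grd ℤ`. -/
noncomputable def sketch (grd : ℝ) (M : Matrix m m ℝ) (g : Fin K → m → Bool) : Fin K → m → ℤ :=
  fun k c => ⌊(whitening M *ᵥ fun i => sgn (g k i)) c / grd⌋

/-- The estimate of the leverage of `a` from the sketch `y`. -/
noncomputable def levEst {m : Type*} [Fintype m] (grd : ℝ) (N : ℕ) (y : Fin K → m → ℤ) (a : m → ℝ) : ℝ :=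
  5 * ∑ k, (∑ c, a c * (grd * y k c)) ^ 2 + 1 / N

/-- A row is sampled when its coin in `{0, …, N - 1}` is below this threshold. -/
noncomputable def threshold {m : Type*} [Fintype m] (grd R : ℝ) (N : ℕ) (y : Fin K → m → ℤ) (a : m → ℝ) : ℕ :=
  ⌈N * min 1 (R * levEst grd N y a)⌉₊

/-- The matrix obtained from the sampled rows. -/
noncomputable def sampleMatrix (lam grd R : ℝ) {N : ℕ} (a : ι → m → ℝ) (M : Matrix m m ℝ)
    (σ : (Fin K → m → Bool) × (ι → Fin N)) : Matrix m m ℝ :=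
  gram lam a fun r => if (σ.2 r : ℕ) < threshold grd R N (sketch grd M σ.1) (a r) then
    (N : ℝ) / threshold grd R N (sketch grd M σ.1) (a r) else 0

/-- `M` approximates `G` up to the factor `1 ± 1/16`. -/
def Approx (M G : Matrix m m ℝ) : Prop :=
  ∀ x, |x ⬝ᵥ (M *ᵥ x) - x ⬝ᵥ (G *ᵥ x)| ≤ 1 / 16 * (x ⬝ᵥ (G *ᵥ x))

theorem sampleMatrix_isSPD {lam : ℝ} (hl : 0 < lam) (grd R : ℝ) {N : ℕ} (a : ι → m → ℝ)
    (M : Matrix m m ℝ) (σ : (Fin K → m → Bool) × (ι → Fin N)) :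
    IsSPD (sampleMatrix lam grd R a M σ) :=
  gram_isSPD hl a fun r => by split_ifs <;> positivity

theorem levEst_pos {m : Type*} [Fintype m] (grd : ℝ) (N : ℕ) (y : Fin K → m → ℤ) (a : m → ℝ) :
    1 / (N : ℝ) ≤ levEst grd N y a := by
  have : 0 ≤ ∑ k, (∑ c, a c * (grd * y k c)) ^ 2 := Finset.sum_nonneg fun k _ => sq_nonneg _
  unfold levEst
  linarith

theorem threshold_pos {m : Type*} [Fintype m] {grd R : ℝ} (hR : 0 < R) {N : ℕ} (hN : 0 < N) (y : Fin K → m → ℤ)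
    (a : m → ℝ) : 0 < threshold grd R N y a := by
  have hN' : (0 : ℝ) < N := by exact_mod_cast hN
  have := levEst_pos grd N y a
  have h1 : 0 < levEst grd N y a := lt_of_lt_of_le (by positivity) this
  exact Nat.ceil_pos.2 (mul_pos hN' (lt_min one_pos (mul_pos hR h1)))

theorem threshold_le {m : Type*} [Fintype m] {grd R : ℝ} {N : ℕ} (y : Fin K → m → ℤ)
    (a : m → ℝ) : threshold grd R N y a ≤ N := by
  refine Nat.ceil_le.2 ?_
  have : (0 : ℝ) ≤ N := Nat.cast_nonneg _
  nlinarith [min_le_left 1 (R * levEst grd N y a)]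

theorem abs_sketch_sub_le {grd : ℝ} (hg : 0 < grd) (M : Matrix m m ℝ) (g : Fin K → m → Bool)
    (k : Fin K) {a : m → ℝ} {e : ℝ} (he : grd * ∑ c, |a c| ≤ e) :
    |∑ c, a c * (grd * sketch grd M g k c) - a ⬝ᵥ (whitening M *ᵥ fun i => sgn (g k i))| ≤ e := by
  rw [dotProduct, ← Finset.sum_sub_distrib]
  refine (Finset.abs_sum_le_sum_abs _ _).trans (le_trans ?_ he)
  rw [Finset.mul_sum]
  refine Finset.sum_le_sum fun c _ => ?_
  rw [← mul_sub, abs_mul, mul_comm]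
  gcongr
  set y := (whitening M *ᵥ fun i => sgn (g k i)) c with hy
  have h1 : (sketch grd M g k c : ℝ) ≤ y / grd := Int.floor_le _
  have h2 : y / grd < sketch grd M g k c + 1 := Int.lt_floor_add_one _
  rw [le_div_iff₀ hg] at h1
  rw [div_lt_iff₀ hg] at h2
  rw [abs_le]
  constructor <;> nlinarith

theorem whitening_dotProduct_sign {M : Matrix m m ℝ} (a : m → ℝ) (g : m → Bool) :
    a ⬝ᵥ (whitening M *ᵥ fun i => sgn (g i)) = ((whitening M)ᵀ *ᵥ a) ⬝ᵥ fun i => sgn (g i) := by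
  rw [mulVec_dotProduct_mulVec, Matrix.transpose_transpose]

/-- A single projection that captures half of `|v|²` already makes the estimate large enough, so
failure requires all `K` of them to be small. The factor 5 in `levEst` covers 2 for that half, 2 for
the rounding and `17/16` for the quality of `M`; the summand `1/N` absorbs the square of the
rounding error. -/
theorem prob_levEst_small {M G₀ G₁ : Matrix m m ℝ} (hM : IsSPD M) (hG₀ : IsSPD G₀)
    (hG₁ : IsSPD G₁) (h01 : ∀ x, x ⬝ᵥ (G₀ *ᵥ x) ≤ x ⬝ᵥ (G₁ *ᵥ x))
    (hM0 : ∀ x, x ⬝ᵥ (M *ᵥ x) ≤ 17 / 16 * (x ⬝ᵥ (G₀ *ᵥ x))) {grd : ℝ} (hg : 0 < grd) {N : ℕ}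
    {a : m → ℝ} {e : ℝ} (he : grd * ∑ c, |a c| ≤ e) (heN : 5 * e ^ 2 ≤ 1 / N) :
    prob (fun g : Fin K → m → Bool => levEst grd N (sketch grd M g) a < lev G₁ a)
      ≤ (9 / 10) ^ K := by
  set v := (whitening M)ᵀ *ᵥ a with hv
  have hlev : lev M a = v ⬝ᵥ v := IsSPD.lev_eq hM.whitening_spec a
  have h1 := prob_forall (ι := Fin K) (fun g : m → Bool => (v ⬝ᵥ fun i => sgn (g i)) ^ 2 < v ⬝ᵥ v / 2)
  have h2 := prob_signs_small v
  rw [Fintype.card_fin] at h1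
  refine le_trans (prob_mono fun g hg' => ?_) (h1.le.trans (pow_le_pow_left₀ (prob_nonneg _) h2 K))
  intro k
  by_contra hk
  push Not at hk
  have h3 := abs_sketch_sub_le hg M g k he
  rw [whitening_dotProduct_sign] at h3
  have h4 : lev G₁ a ≤ 1 * lev G₀ a := hG₁.lev_le_mul hG₀ zero_le_one (by simpa using h01) a
  have h5 : lev G₀ a ≤ 17 / 16 * lev M a := hG₀.lev_le_mul hM (by norm_num) hM0 a
  have h6 : (∑ c, a c * (grd * sketch grd M g k c)) ^ 2
      ≤ ∑ k, (∑ c, a c * (grd * sketch grd M g k c)) ^ 2 :=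
    Finset.single_le_sum (f := fun k => (∑ c, a c * (grd * sketch grd M g k c)) ^ 2)
      (fun k _ => sq_nonneg _) (Finset.mem_univ k)
  rw [← hv] at h3
  set A := ∑ c, a c * (grd * sketch grd M g k c) with hA
  set B := v ⬝ᵥ fun i => sgn (g k i) with hB
  have h7 : B ^ 2 ≤ 2 * A ^ 2 + 2 * e ^ 2 := by
    have h8 : (A - B) ^ 2 ≤ e ^ 2 := by
      rw [← sq_abs (A - B)]; exact pow_le_pow_left₀ (abs_nonneg _) h3 2
    nlinarith [sq_nonneg (2 * A - B)]
  rw [levEst] at hg'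
  rw [hlev] at h5
  nlinarith [sq_nonneg A, sq_nonneg e]

/-- The signs are fixed first. If all estimates exceed the true leverages, `prob_sampling_bad`
applies in coordinates in which the full Gram matrix is the identity, with `α = 1/32`: then `2α` is
the accuracy in `Approx` and `α² R = R / 1024`. -/
theorem prob_sampleMatrix_bad [DecidableEq ι] {lam grd R : ℝ} (hl : 0 < lam) (hg : 0 < grd)
    (hR : 0 < R) {N : ℕ} (hN : 0 < N) (a : ι → m → ℝ) {M G₀ : Matrix m m ℝ}
    (hM : IsSPD M) (hG₀ : IsSPD G₀)
    (h01 : ∀ x, x ⬝ᵥ (G₀ *ᵥ x) ≤ x ⬝ᵥ (gram lam a (fun _ => 1) *ᵥ x)) (hM0 : Approx M G₀)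
    {e t : ℝ} (he : ∀ r, grd * ∑ c, |a r c| ≤ e) (heN : 5 * e ^ 2 ≤ 1 / N) (ht : t ≤ R / 1024) :
    prob (fun σ : (Fin K → m → Bool) × (ι → Fin N) =>
      ¬ Approx (sampleMatrix lam grd R a M σ) (gram lam a fun _ => 1))
      ≤ Fintype.card ι * (9 / 10) ^ K + 2 * (Fintype.card m * Real.exp (-t)) := by
  classical
  have hfin : Nonempty (Fin N) := ⟨⟨0, hN⟩⟩
  have hN' : (0 : ℝ) < N := by exact_mod_cast hN
  set G₁ := gram lam a fun _ => 1 with hG₁def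
  have hG₁ : IsSPD G₁ := gram_isSPD hl a fun _ => zero_le_one
  have hM0' : ∀ x, x ⬝ᵥ (M *ᵥ x) ≤ 17 / 16 * (x ⬝ᵥ (G₀ *ᵥ x)) := fun x => by
    have := (abs_le.1 (hM0 x)).2; linarith
  obtain ⟨C, hC⟩ := hG₁.exists_whitening
  have hCC : C * (Cᵀ * G₁) = 1 := mul_eq_one_comm.1 hC
  have hnorm : ∀ z, (C *ᵥ z) ⬝ᵥ (G₁ *ᵥ (C *ᵥ z)) = z ⬝ᵥ z := fun z => by
    rw [mulVec_dotProduct_mulVec, Matrix.mulVec_mulVec, Matrix.mulVec_mulVec, hC, Matrix.one_mulVec]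
  rw [prob_prod]
  have key : ∀ g : Fin K → m → Bool,
      prob (fun ω : ι → Fin N => ¬ Approx (sampleMatrix lam grd R a M (g, ω)) G₁)
      ≤ (if ∃ r ∈ Finset.univ, levEst grd N (sketch grd M g) (a r) < lev G₁ (a r) then 1 else 0)
        + 2 * (Fintype.card m * Real.exp (-t)) := by
    intro g
    split_ifs with hbad
    · have := prob_le_one (fun ω : ι → Fin N => ¬ Approx (sampleMatrix lam grd R a M (g, ω)) G₁)
      have h2 : 0 ≤ 2 * (Fintype.card m * Real.exp (-t)) := by positivity
      linarith
    · push Not at hbad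
      rw [zero_add]
      have hch := prob_sampling_bad hN (fun r => Cᵀ *ᵥ a r)
        (fun r => threshold grd R N (sketch grd M g) (a r))
        (fun r => threshold_pos hR hN _ _) (fun r => threshold_le _ _) (α := 1 / 32) (t := t) hR
        (by norm_num) (by norm_num) (by norm_num; linarith) ?_ ?_
      · refine le_trans (prob_mono fun ω hω => ?_) hch
        rw [Approx] at hω
        push Not at hω
        obtain ⟨y, hy⟩ := hω
        set z := (Cᵀ * G₁) *ᵥ y with hz
        have hyz : C *ᵥ z = y := by rw [hz, Matrix.mulVec_mulVec, hCC, Matrix.one_mulVec]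
        refine ⟨z, ?_⟩
        have h3 : ∀ r, (Cᵀ *ᵥ a r) ⬝ᵥ z = a r ⬝ᵥ y := fun r => by
          rw [mulVec_dotProduct_mulVec, Matrix.transpose_transpose, hyz]
        rw [← hnorm, hyz]
        simp only [h3]
        rw [hG₁def, sampleMatrix, dotProduct_gram, dotProduct_gram] at hy
        rw [hG₁def, dotProduct_gram]
        rw [add_sub_add_left_eq_sub, ← Finset.sum_sub_distrib] at hy
        have h4 : (2 * (1 / 32) : ℝ) = 1 / 16 := by norm_num
        rw [h4]
        refine hy.trans_eq (congrArg _ (Finset.sum_congr rfl fun r _ => ?_))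
        rw [sub_mul]
      · intro r
        rw [← IsSPD.lev_eq hC]
        rcases le_total 1 (R * levEst grd N (sketch grd M g) (a r)) with h | h
        · left
          rw [threshold, min_eq_left h, mul_one, Nat.ceil_natCast]
        · right
          rw [threshold, min_eq_right h, le_div_iff₀ hN']
          refine le_trans ?_ (Nat.le_ceil _)
          rw [mul_comm (N : ℝ)]
          gcongr
          exact hbad r (Finset.mem_univ r)
      · intro x
        have h3 : ∀ r, (Cᵀ *ᵥ a r) ⬝ᵥ x = a r ⬝ᵥ (C *ᵥ x) := fun r => by
          rw [mulVec_dotProduct_mulVec, Matrix.transpose_transpose]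
        simp only [h3]
        rw [← hnorm, hG₁def, dotProduct_gram]
        simp only [one_mul]
        have := mul_nonneg hl.le (dotProduct_self_nonneg' (C *ᵥ x))
        linarith
  refine (avg_mono key).trans ?_
  rw [avg_add, avg_const]
  gcongr
  have h5 := prob_exists (Ω := Fin K → m → Bool) (Finset.univ : Finset ι)
    (fun r g => levEst grd N (sketch grd M g) (a r) < lev G₁ (a r))
  have h6 : ∑ r, prob (fun g : Fin K → m → Bool => levEst grd N (sketch grd M g) (a r) < lev G₁ (a r))
      ≤ ∑ _r : ι, (9 / 10 : ℝ) ^ K :=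
    Finset.sum_le_sum fun r _ => prob_levEst_small hM hG₀ hG₁ h01 hM0' hg (he r) heN
  rw [Finset.sum_const, Finset.card_univ, nsmul_eq_mul] at h6
  refine le_trans (le_of_eq ?_) (h5.trans h6)
  rw [prob]
  refine congrArg avg (funext fun ω => ?_)
  congr

/-- The projections are summed, not averaged, so the overestimate costs a factor of order `K`. This
is logarithmic and only enlarges the sample. -/
theorem avg_levEst_le {M : Matrix m m ℝ} (hM : IsSPD M) {grd : ℝ} (hg : 0 < grd) {N : ℕ}
    {a : m → ℝ} {e : ℝ} (he : grd * ∑ c, |a c| ≤ e) (heN : 5 * e ^ 2 ≤ 1 / N) :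
    avg (fun g : Fin K → m → Bool => levEst grd N (sketch grd M g) a)
      ≤ 10 * K * lev M a + (2 * K + 1) / N := by
  set v := (whitening M)ᵀ *ᵥ a with hv
  have hlev : lev M a = v ⬝ᵥ v := IsSPD.lev_eq hM.whitening_spec a
  have hpt : ∀ g : Fin K → m → Bool, levEst grd N (sketch grd M g) a
      ≤ (∑ k, 10 * (v ⬝ᵥ fun i => sgn (g k i)) ^ 2) + (2 * K + 1) / N := by
    intro g
    have h1 : ∀ k, 5 * (∑ c, a c * (grd * sketch grd M g k c)) ^ 2
        ≤ 10 * (v ⬝ᵥ fun i => sgn (g k i)) ^ 2 + 2 / N := by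
      intro k
      have h3 := abs_sketch_sub_le hg M g k he
      rw [whitening_dotProduct_sign, ← hv] at h3
      set A := ∑ c, a c * (grd * sketch grd M g k c) with hA
      set B := v ⬝ᵥ fun i => sgn (g k i) with hB
      have h8 : (A - B) ^ 2 ≤ e ^ 2 := by
        rw [← sq_abs (A - B)]; exact pow_le_pow_left₀ (abs_nonneg _) h3 2
      have h9 : (2 : ℝ) / N = 2 * (1 / N) := by ring
      rw [h9]
      nlinarith [sq_nonneg (A - 2 * B)]
    have h2 := Finset.sum_le_sum fun k (_ : k ∈ (Finset.univ : Finset (Fin K))) => h1 k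
    rw [Finset.sum_add_distrib, ← Finset.mul_sum, Finset.sum_const, Finset.card_univ,
      Fintype.card_fin, nsmul_eq_mul] at h2
    rw [levEst]
    have h9 : (2 * (K : ℝ) + 1) / N = K * (2 / N) + 1 / N := by ring
    rw [h9]
    linarith
  refine (avg_mono hpt).trans ?_
  rw [avg_add, avg_const, avg_sum]
  have h4 : ∀ k : Fin K, avg (fun g : Fin K → m → Bool => 10 * (v ⬝ᵥ fun i => sgn (g k i)) ^ 2)
      = 10 * lev M a := by
    intro k
    rw [avg_update k, hlev]
    simp only [Function.update_self, avg_const_mul, avg_signs_sq, avg_const]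
  simp only [h4, Finset.sum_const, Finset.card_univ, Fintype.card_fin, nsmul_eq_mul]
  linarith

/-- Given the signs, a row is taken with probability at most `min 1 (R * levEst)` plus `1/N` for the
ceiling. The constant 11 exceeds `10 * 16/15`, the ratio coming from the quality of `M`. As there
are `N` rows, the terms of order `1/N` add up to a constant multiple of `K R`. -/
theorem avg_card_sample_le [DecidableEq ι] {grd R : ℝ} (hg : 0 < grd)
    (hR : 1 ≤ R) (hK : 1 ≤ K) {N : ℕ} (hN : 0 < N) (hNι : Fintype.card ι = N) (a : ι → m → ℝ)
    {M G₀ : Matrix m m ℝ} (hM : IsSPD M) (hG₀ : IsSPD G₀) (hM0 : Approx M G₀)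
    {e : ℝ} (he : ∀ r, grd * ∑ c, |a r c| ≤ e) (heN : 5 * e ^ 2 ≤ 1 / N) :
    avg (fun σ : (Fin K → m → Bool) × (ι → Fin N) =>
      ∑ r, if (σ.2 r : ℕ) < threshold grd R N (sketch grd M σ.1) (a r) then (1 : ℝ) else 0)
      ≤ 11 * K * R * ∑ r, min 1 (lev G₀ (a r)) + 4 * K * R := by
  have hfin : Nonempty (Fin N) := ⟨⟨0, hN⟩⟩
  have hN' : (0 : ℝ) < N := by exact_mod_cast hN
  have hK' : (1 : ℝ) ≤ K := by exact_mod_cast hK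
  have hrow : ∀ r, avg (fun σ : (Fin K → m → Bool) × (ι → Fin N) =>
      if (σ.2 r : ℕ) < threshold grd R N (sketch grd M σ.1) (a r) then (1 : ℝ) else 0)
      ≤ 11 * K * R * min 1 (lev G₀ (a r)) + 4 * K * R / N := by
    intro r
    rw [avg_prod]
    have h1 : ∀ g : Fin K → m → Bool, avg (fun ω : ι → Fin N =>
        if (ω r : ℕ) < threshold grd R N (sketch grd M g) (a r) then (1 : ℝ) else 0)
        ≤ min 1 (R * levEst grd N (sketch grd M g) (a r)) + 1 / N := by
      intro g
      rw [avg_update r]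
      simp only [Function.update_self]
      rw [avg_const, avg_coin (threshold_le _ _), mul_one, mul_zero, add_zero, threshold,
        div_le_iff₀ hN', add_mul, one_div, inv_mul_cancel₀ hN'.ne', mul_comm (min _ _)]
      refine (Nat.ceil_lt_add_one ?_).le
      have := levEst_pos grd N (sketch grd M g) (a r)
      have h2 : 0 ≤ levEst grd N (sketch grd M g) (a r) := le_trans (by positivity) this
      positivity
    refine (avg_mono h1).trans ?_
    rw [avg_add, avg_const]
    have h2 : avg (fun g : Fin K → m → Bool => min 1 (R * levEst grd N (sketch grd M g) (a r)))
        ≤ min 1 (R * (10 * K * lev M (a r) + (2 * K + 1) / N)) := by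
      refine le_min ?_ ?_
      · exact (avg_mono fun g => min_le_left _ _).trans (avg_const 1).le
      · refine (avg_mono fun g => min_le_right _ _).trans ?_
        rw [avg_const_mul]
        exact mul_le_mul_of_nonneg_left (avg_levEst_le hM hg (he r) heN) (by linarith)
    have hM0' : ∀ x, x ⬝ᵥ (G₀ *ᵥ x) ≤ 16 / 15 * (x ⬝ᵥ (M *ᵥ x)) := fun x => by
      have := (abs_le.1 (hM0 x)).1; linarith
    have h3 : lev M (a r) ≤ 16 / 15 * lev G₀ (a r) := hM.lev_le_mul hG₀ (by norm_num) hM0' _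
    have h4 := hG₀.lev_nonneg (a r)
    set ℓ := lev G₀ (a r)
    have hKR : 1 ≤ K * R := by nlinarith
    have h5 : min 1 (R * (10 * K * lev M (a r) + (2 * K + 1) / N))
        ≤ 11 * K * R * min 1 ℓ + 3 * K * R / N := by
      have h6 : 0 ≤ 3 * K * R / N := by positivity
      rcases le_total 1 ℓ with h | h
      · rw [min_eq_left h]
        have := min_le_left 1 (R * (10 * K * lev M (a r) + (2 * K + 1) / N))
        linarith
      · rw [min_eq_right h]
        refine (min_le_right _ _).trans ?_
        have h7 : R * (10 * K * lev M (a r)) ≤ 11 * K * R * ℓ := by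
          have : (K * R) * lev M (a r) ≤ (K * R) * (16 / 15 * ℓ) := by gcongr
          nlinarith
        have h8 : R * ((2 * K + 1) / N) ≤ 3 * K * R / N := by
          rw [← mul_div_assoc]
          refine div_le_div_of_nonneg_right ?_ hN'.le
          nlinarith [mul_nonneg (by linarith : (0 : ℝ) ≤ R) (by linarith : (0 : ℝ) ≤ (K : ℝ) - 1)]
        linarith
    have h9 : 1 / (N : ℝ) ≤ K * R / N := by gcongr
    have h10 : 4 * K * R / N = 3 * K * R / N + K * R / (N : ℝ) := by ring
    linarith
  rw [avg_sum]
  refine (Finset.sum_le_sum fun r _ => hrow r).trans ?_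
  rw [Finset.sum_add_distrib, ← Finset.mul_sum, Finset.sum_const, Finset.card_univ, hNι,
    nsmul_eq_mul, mul_div_cancel₀ _ hN'.ne']

end Sampling

/-! ### Repeated halving -/

section Chain

set_option linter.unusedSectionVars false

variable {m ι : Type*} [Fintype m] [DecidableEq m] [Fintype ι] {K N lv : ℕ}

/-- The random bits of a single trial: random halves of the set of rows for each level, and for
each level the random signs and coins. -/
abbrev TrialSeed (m ι : Type*) (K N lv : ℕ) : Type _ :=
  (Fin lv → ι → Bool) × (Fin lv → (Fin K → m → Bool) × (ι → Fin N))

/-- Whether row `r` is present at level `j`. -/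
def atLevel (h : Fin lv → ι → Bool) (j : ℕ) (r : ι) : Bool :=
  decide (∀ l : Fin lv, j ≤ l → h l r = true)

/-- The rows at level `j`, the others being replaced by zero. -/
def levelRows (a : ι → m → ℝ) (h : Fin lv → ι → Bool) (j : ℕ) (r : ι) : m → ℝ :=
  if atLevel h j r then a r else 0

/-- The approximate Gram matrices of the levels, each sampled with the help of the previous one. -/
noncomputable def chain (lam grd R : ℝ) (a : ι → m → ℝ) (ω : TrialSeed m ι K N lv) :
    ℕ → Matrix m m ℝ
  | 0 => lam • 1
  | j + 1 => if hj : j < lv then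
      sampleMatrix lam grd R (levelRows a ω.1 (j + 1)) (chain lam grd R a ω j) (ω.2 ⟨j, hj⟩)
    else chain lam grd R a ω j

/-- Row `r` is sampled from level `j + 1`. -/
def IsSampled (grd R : ℝ) (a : ι → m → ℝ) (ω : TrialSeed m ι K N lv) (j : Fin lv)
    (M : Matrix m m ℝ) (r : ι) : Prop :=
  atLevel ω.1 (j + 1) r = true ∧
    ((ω.2 j).2 r : ℕ) < threshold grd R N (sketch grd M (ω.2 j).1) (a r)

open Classical in
/-- The number of rows sampled from level `j + 1`. -/
noncomputable def sampleCount (lam grd R : ℝ) (a : ι → m → ℝ) (ω : TrialSeed m ι K N lv)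
    (j : Fin lv) : ℕ :=
  (Finset.univ.filter (IsSampled grd R a ω j (chain lam grd R a ω j))).card

variable {lam grd R : ℝ} {a : ι → m → ℝ}

theorem chain_isSPD (hl : 0 < lam) (ω : TrialSeed m ι K N lv) (j : ℕ) :
    IsSPD (chain lam grd R a ω j) := by
  induction j with
  | zero =>
    have := gram_isSPD (ι := Empty) hl (fun _ => (0 : m → ℝ)) (c := fun _ => 0) (fun _ => le_rfl)
    simpa [gram, chain] using this
  | succ j ih =>
    rw [chain]
    split_ifs with hj
    · exact sampleMatrix_isSPD hl _ _ _ _ _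
    · exact ih

/-- This makes the signs and coins of level `j` fresh, that is, independent of the matrix with which
they are used. -/
theorem chain_congr (h : Fin lv → ι → Bool) (σ σ' : Fin lv → (Fin K → m → Bool) × (ι → Fin N))
    (j : ℕ) (hσ : ∀ l : Fin lv, (l : ℕ) < j → σ l = σ' l) :
    chain lam grd R a (h, σ) j = chain lam grd R a (h, σ') j := by
  induction j with
  | zero => rfl
  | succ j ih =>
    rw [chain, chain, ih fun l hl => hσ l (by omega)]
    split_ifs with hj
    · simp only [hσ ⟨j, hj⟩ (by simp)]
    · rfl

theorem atLevel_succ (h : Fin lv → ι → Bool) (j : Fin lv) (r : ι) :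
    atLevel h j r = (atLevel h (j + 1) r && h j r) := by
  rw [Bool.eq_iff_iff]
  simp only [atLevel, decide_eq_true_eq, Bool.and_eq_true]
  constructor
  · intro hh
    exact ⟨fun l hl => hh l (by omega), hh j le_rfl⟩
  · rintro ⟨h1, h2⟩ l hl
    rcases hl.eq_or_lt with h3 | h3
    · rwa [← Fin.ext h3]
    · exact h1 l h3

theorem atLevel_top (h : Fin lv → ι → Bool) (r : ι) : atLevel h lv r = true := by
  simp only [atLevel, decide_eq_true_eq]
  intro l hl
  have := l.2
  omega

theorem levelRows_top (h : Fin lv → ι → Bool) : levelRows a h lv = a := by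
  funext r
  simp [levelRows, atLevel_top]

/-- The Gram matrix of level `j`. -/
noncomputable def levelGram (lam : ℝ) (a : ι → m → ℝ) (h : Fin lv → ι → Bool) (j : ℕ) :
    Matrix m m ℝ :=
  gram lam (levelRows a h j) fun _ => 1

theorem levelGram_isSPD (hl : 0 < lam) (h : Fin lv → ι → Bool) (j : ℕ) :
    IsSPD (levelGram lam a h j) := gram_isSPD hl _ fun _ => zero_le_one

theorem levelGram_eq (h : Fin lv → ι → Bool) (j : Fin lv) :
    levelGram lam a h j
      = gram lam (levelRows a h (j + 1)) fun r => if h j r then 1 else 0 := by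
  rw [levelGram, gram, gram]
  congr 1
  refine Finset.sum_congr rfl fun r _ => ?_
  simp only [levelRows, atLevel_succ h j r]
  by_cases h1 : atLevel h (j + 1) r <;> by_cases h2 : h j r <;> simp [h1, h2]

theorem levelGram_mono (h : Fin lv → ι → Bool) (j : Fin lv) (x : m → ℝ) :
    x ⬝ᵥ (levelGram lam a h j *ᵥ x) ≤ x ⬝ᵥ (levelGram lam a h (j + 1) *ᵥ x) := by
  rw [levelGram_eq, levelGram, dotProduct_gram, dotProduct_gram]
  gcongr
  split_ifs <;> norm_num

theorem sum_abs_levelRows_le {e : ℝ} (he : ∀ r, grd * ∑ c, |a r c| ≤ e)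
    (he0 : 0 ≤ e) (h : Fin lv → ι → Bool) (j : ℕ) (r : ι) :
    grd * ∑ c, |levelRows a h j r c| ≤ e := by
  rw [levelRows]
  split_ifs
  · exact he r
  · simpa using he0

theorem prob_step_bad [DecidableEq ι] (hl : 0 < lam) (hg : 0 < grd) (hR : 0 < R) (hN : 0 < N)
    {e t : ℝ} (he : ∀ r, grd * ∑ c, |a r c| ≤ e) (he0 : 0 ≤ e) (heN : 5 * e ^ 2 ≤ 1 / N)
    (ht : t ≤ R / 1024) (h : Fin lv → ι → Bool) (j : Fin lv) :
    prob (fun σ : Fin lv → (Fin K → m → Bool) × (ι → Fin N) =>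
      Approx (chain lam grd R a (h, σ) j) (levelGram lam a h j) ∧
      ¬ Approx (chain lam grd R a (h, σ) (j + 1)) (levelGram lam a h (j + 1)))
      ≤ Fintype.card ι * (9 / 10) ^ K + 2 * (Fintype.card m * Real.exp (-t)) := by
  have hfin : Nonempty (Fin N) := ⟨⟨0, hN⟩⟩
  set δ := Fintype.card ι * (9 / 10 : ℝ) ^ K + 2 * (Fintype.card m * Real.exp (-t)) with hδ
  have hδ0 : 0 ≤ δ := by positivity
  rw [prob_update j, ← avg_const (Ω := Fin lv → (Fin K → m → Bool) × (ι → Fin N)) δ]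
  refine avg_mono fun σ => ?_
  have h1 : ∀ v, chain lam grd R a (h, Function.update σ j v) j = chain lam grd R a (h, σ) j :=
    fun v => chain_congr h _ _ _ fun l hlj => by
      rw [Function.update_of_ne]
      rintro rfl
      exact lt_irrefl _ hlj
  have h2 : ∀ v, chain lam grd R a (h, Function.update σ j v) (j + 1)
      = sampleMatrix lam grd R (levelRows a h (j + 1)) (chain lam grd R a (h, σ) j) v := by
    intro v
    rw [chain, dif_pos j.2, h1]
    simp
  simp only [h1, h2]
  by_cases hA : Approx (chain lam grd R a (h, σ) j) (levelGram lam a h j)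
  · simp only [hA, true_and]
    exact prob_sampleMatrix_bad hl hg hR hN (levelRows a h (j + 1)) (chain_isSPD hl _ _)
      (levelGram_isSPD hl h j) (levelGram_mono h j) hA
      (sum_abs_levelRows_le he he0 h _) heN ht
  · simp only [hA, false_and]
    refine le_trans (le_of_eq ?_) hδ0
    simp [prob, avg]

theorem prob_atLevel_zero [DecidableEq ι] :
    prob (fun h : Fin lv → ι → Bool => ∃ r ∈ Finset.univ, atLevel h 0 r = true)
      ≤ Fintype.card ι * (1 / 2) ^ lv := by
  refine (prob_exists _ _).trans ?_
  rw [← nsmul_eq_mul, ← Finset.card_univ, ← Finset.sum_const]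
  refine Finset.sum_le_sum fun r _ => ?_
  have h1 := prob_forall (ι := Fin lv) (fun b : ι → Bool => b r = true)
  rw [Fintype.card_fin] at h1
  have h2 : prob (fun b : ι → Bool => b r = true) = 1 / 2 := by
    rw [prob_update r]
    simp only [Function.update_self, prob, avg_const]
    simp [avg]
  rw [h2] at h1
  rw [← h1]
  refine prob_mono fun h hh l => ?_
  simp only [atLevel, decide_eq_true_eq] at hh
  exact hh l (Nat.zero_le _)

/-- With high probability no row survives all the halvings, and then the starting matrix is exact.
Errors do not accumulate along the chain: each level is sampled from its own true rows, and the
previous matrix enters through leverage estimates only. -/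
theorem prob_chain_bad [DecidableEq ι] (hl : 0 < lam) (hg : 0 < grd) (hR : 0 < R) (hN : 0 < N)
    {e t : ℝ} (he : ∀ r, grd * ∑ c, |a r c| ≤ e) (he0 : 0 ≤ e) (heN : 5 * e ^ 2 ≤ 1 / N)
    (ht : t ≤ R / 1024) :
    prob (fun ω : TrialSeed m ι K N lv =>
      ∃ j ≤ lv, ¬ Approx (chain lam grd R a ω j) (levelGram lam a ω.1 j))
      ≤ Fintype.card ι * (1 / 2) ^ lv
        + lv * (Fintype.card ι * (9 / 10) ^ K + 2 * (Fintype.card m * Real.exp (-t))) := by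
  have hfin : Nonempty (Fin N) := ⟨⟨0, hN⟩⟩
  set δ := Fintype.card ι * (9 / 10 : ℝ) ^ K + 2 * (Fintype.card m * Real.exp (-t)) with hδ
  refine le_trans (prob_mono (q := fun ω : TrialSeed m ι K N lv =>
    (∃ r ∈ Finset.univ, atLevel ω.1 0 r = true) ∨ ∃ j ∈ (Finset.univ : Finset (Fin lv)),
      (Approx (chain lam grd R a (ω.1, ω.2) j) (levelGram lam a ω.1 j) ∧
      ¬ Approx (chain lam grd R a (ω.1, ω.2) (j + 1)) (levelGram lam a ω.1 (j + 1)))) ?_) ?_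
  · rintro ω ⟨j, hj, hbad⟩
    by_contra hcon
    push Not at hcon
    obtain ⟨h0, hstep⟩ := hcon
    apply hbad
    clear hbad
    induction j with
    | zero =>
      have : levelGram lam a ω.1 0 = lam • 1 := by
        rw [levelGram, gram]
        have : ∀ r, levelRows a ω.1 0 r = 0 := fun r => by
          have := h0 r (Finset.mem_univ r)
          simp [levelRows, this]
        simp [this]
      rw [this, chain]
      intro x
      rw [sub_self, abs_zero, Matrix.smul_mulVec, Matrix.one_mulVec, dotProduct_smul, smul_eq_mul]
      have := dotProduct_self_nonneg' x
      positivity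
    | succ j ih => exact hstep ⟨j, hj⟩ (Finset.mem_univ _) (ih (by omega))
  · refine (prob_or _ _).trans (add_le_add ?_ ?_)
    · rw [prob_prod]
      simp only
      have : ∀ (h : Fin lv → ι → Bool), prob (fun _ : Fin lv → (Fin K → m → Bool) × (ι → Fin N) =>
          ∃ r ∈ Finset.univ, atLevel h 0 r = true)
          = if ∃ r ∈ Finset.univ, atLevel h 0 r = true then 1 else 0 := by
        intro h
        rw [prob, avg_const]
        congr
      simp only [this]
      refine le_trans (le_of_eq ?_) prob_atLevel_zero
      rw [prob]
      refine congrArg avg (funext fun ω => ?_)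
      congr
    · refine (prob_exists _ _).trans ?_
      have h1 : ∀ j ∈ (Finset.univ : Finset (Fin lv)), prob (fun ω : TrialSeed m ι K N lv =>
          Approx (chain lam grd R a (ω.1, ω.2) j) (levelGram lam a ω.1 j) ∧
          ¬ Approx (chain lam grd R a (ω.1, ω.2) (j + 1)) (levelGram lam a ω.1 (j + 1))) ≤ δ := by
        intro j _
        rw [prob_prod, ← avg_const (Ω := Fin lv → ι → Bool) δ]
        exact avg_mono fun h => prob_step_bad hl hg hR hN he he0 heN ht h j
      refine (Finset.sum_le_sum h1).trans (le_of_eq ?_)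
      simp

-- Two kinds of fresh randomness are used: the signs and coins of the level, and the halving `h j`,
-- by which level `j` is a uniformly random half of level `j + 1`. The count is cut off where the
-- previous matrix is bad, since nothing is known about the leverage estimates there.
open Classical in
theorem avg_sampleCount_le [DecidableEq ι] (hl : 0 < lam) (hg : 0 < grd) (hR : 1 ≤ R)
    (hK : 1 ≤ K) (hN : 0 < N) (hNι : Fintype.card ι = N)
    {e : ℝ} (he : ∀ r, grd * ∑ c, |a r c| ≤ e) (he0 : 0 ≤ e) (heN : 5 * e ^ 2 ≤ 1 / N)
    (j : Fin lv) :
    avg (fun ω : TrialSeed m ι K N lv =>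
      if Approx (chain lam grd R a ω j) (levelGram lam a ω.1 j) then
        (sampleCount lam grd R a ω j : ℝ) else 0)
      ≤ 11 * K * R * (3 * Fintype.card m) + 4 * K * R := by
  have hfin : Nonempty (Fin N) := ⟨⟨0, hN⟩⟩
  have hKR : 0 ≤ 11 * (K : ℝ) * R := by positivity
  rw [avg_prod]
  have hh : ∀ h : Fin lv → ι → Bool,
      avg (fun σ : Fin lv → (Fin K → m → Bool) × (ι → Fin N) =>
        if Approx (chain lam grd R a (h, σ) j) (levelGram lam a h j) then
        (sampleCount lam grd R a (h, σ) j : ℝ) else 0)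
      ≤ 11 * K * R * ∑ r, min 1 (lev (levelGram lam a h j) (levelRows a h (j + 1) r))
        + 4 * K * R := by
    intro h
    set B := 11 * K * R * ∑ r, min 1 (lev (levelGram lam a h j) (levelRows a h (j + 1) r))
        + 4 * K * R with hB
    have hB0 : 0 ≤ B := by
      have : 0 ≤ ∑ r, min 1 (lev (levelGram lam a h j) (levelRows a h (j + 1) r)) :=
        Finset.sum_nonneg fun r _ => le_min zero_le_one ((levelGram_isSPD hl h j).lev_nonneg _)
      positivity
    rw [avg_update j, ← avg_const (Ω := Fin lv → (Fin K → m → Bool) × (ι → Fin N)) B]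
    refine avg_mono fun σ => ?_
    have h1 : ∀ v, chain lam grd R a (h, Function.update σ j v) j = chain lam grd R a (h, σ) j :=
      fun v => chain_congr h _ _ _ fun l hlj => by
        rw [Function.update_of_ne]
        rintro rfl
        exact lt_irrefl _ hlj
    simp only [h1]
    by_cases hA : Approx (chain lam grd R a (h, σ) j) (levelGram lam a h j)
    · simp only [hA, if_true]
      refine le_trans (avg_mono fun v => ?_) (avg_card_sample_le hg hR hK hN hNι
        (levelRows a h (j + 1)) (chain_isSPD hl (h, σ) j) (levelGram_isSPD hl h j) hA
        (sum_abs_levelRows_le he he0 h _) heN)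
      rw [sampleCount, h1, Finset.card_filter]
      push_cast
      refine Finset.sum_le_sum fun r _ => ?_
      simp only [IsSampled, Function.update_self]
      split_ifs with h3 h4 h4
      · exact le_rfl
      · exfalso
        apply h4
        rw [levelRows, if_pos h3.1]
        exact h3.2
      · exact zero_le_one
      · exact le_rfl
    · simp only [hA, if_false, avg_const]
      exact hB0
  refine (avg_mono hh).trans ?_
  rw [avg_add, avg_const, avg_const_mul]
  gcongr
  -- The rows of level `j + 1` depend on later halvings only, so resampling `h j` leaves them alone
  -- and `avg_sum_min_lev_le` applies to them.
  rw [avg_update j, ← avg_const (Ω := Fin lv → ι → Bool) (3 * (Fintype.card m : ℝ))]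
  refine avg_mono fun h => ?_
  have h2 : ∀ v, levelRows a (Function.update h j v) (j + 1) = levelRows a h (j + 1) := by
    intro v
    funext r
    have : atLevel (Function.update h j v) (j + 1) r = atLevel h (j + 1) r := by
      rw [Bool.eq_iff_iff]
      simp only [atLevel, decide_eq_true_eq]
      refine forall_congr' fun l => forall_congr' fun hjl => ?_
      rw [Function.update_of_ne]
      rintro rfl
      omega
    simp only [levelRows, this]
  refine le_trans (le_of_eq ?_) (avg_sum_min_lev_le hl (levelRows a h (j + 1)))
  refine congrArg avg (funext fun v => Finset.sum_congr rfl fun r _ => ?_)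
  rw [levelGram_eq, h2]
  simp

/-- Apart from an event of small probability, few rows are sampled. -/
theorem prob_sampleCount_gt [DecidableEq ι] (hl : 0 < lam) (hg : 0 < grd) (hR : 1 ≤ R)
    (hK : 1 ≤ K) (hN : 0 < N) (hNι : Fintype.card ι = N)
    {e t : ℝ} (he : ∀ r, grd * ∑ c, |a r c| ≤ e) (he0 : 0 ≤ e) (heN : 5 * e ^ 2 ≤ 1 / N)
    (ht : t ≤ R / 1024) {cap : ℕ} (hcap : 0 < cap) :
    prob (fun ω : TrialSeed m ι K N lv => ∃ j, cap < sampleCount lam grd R a ω j)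
      ≤ Fintype.card ι * (1 / 2) ^ lv
        + lv * (Fintype.card ι * (9 / 10) ^ K + 2 * (Fintype.card m * Real.exp (-t)))
        + lv * ((11 * K * R * (3 * Fintype.card m) + 4 * K * R) / cap) := by
  classical
  have hcap' : (0 : ℝ) < cap := by exact_mod_cast hcap
  refine le_trans (prob_mono (q := fun ω : TrialSeed m ι K N lv =>
      (∃ j ≤ lv, ¬ Approx (chain lam grd R a ω j) (levelGram lam a ω.1 j)) ∨
      ∃ j ∈ (Finset.univ : Finset (Fin lv)), (cap : ℝ) <
        (if Approx (chain lam grd R a ω j) (levelGram lam a ω.1 j) then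
          (sampleCount lam grd R a ω j : ℝ) else 0)) ?_) ?_
  · rintro ω ⟨j, hj⟩
    by_cases hA : Approx (chain lam grd R a ω j) (levelGram lam a ω.1 j)
    · right
      refine ⟨j, Finset.mem_univ _, ?_⟩
      rw [if_pos hA]
      exact_mod_cast hj
    · exact Or.inl ⟨j, j.2.le, hA⟩
  · refine (prob_or _ _).trans (add_le_add (prob_chain_bad hl hg (by linarith) hN he he0 heN ht) ?_)
    refine (prob_exists _ _).trans ?_
    refine (Finset.sum_le_sum fun j _ => (prob_lt_le_div (fun ω => ?_) hcap').trans
      (div_le_div_of_nonneg_right (avg_sampleCount_le hl hg hR hK hN hNι he he0 heN j)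
        hcap'.le)).trans (le_of_eq ?_)
    · split_ifs <;> positivity
    · simp

end Chain

/-! ### Preconditioned Richardson iteration with rounding -/

section Norm

variable {ι : Type*} [Fintype ι]

theorem l2norm_sq (v : ι → ℝ) : l2norm v ^ 2 = v ⬝ᵥ v := by
  rw [l2norm, EuclideanSpace.norm_sq_eq]
  simp [dotProduct, pow_two]

theorem l2norm_nonneg (v : ι → ℝ) : 0 ≤ l2norm v := norm_nonneg _

theorem l2norm_add_le (v w : ι → ℝ) : l2norm (v + w) ≤ l2norm v + l2norm w := by
  rw [l2norm, l2norm, l2norm, WithLp.toLp_add]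
  exact norm_add_le _ _

theorem l2norm_neg (v : ι → ℝ) : l2norm (-v) = l2norm v := by
  rw [l2norm, l2norm, WithLp.toLp_neg, norm_neg]

theorem l2norm_le_of_sq_le {v : ι → ℝ} {c : ℝ} (hc : 0 ≤ c) (h : v ⬝ᵥ v ≤ c ^ 2) :
    l2norm v ≤ c := by
  rw [← l2norm_sq] at h
  exact abs_le_of_sq_le_sq' h hc |>.2

theorem abs_le_l2norm (v : ι → ℝ) (i : ι) : |v i| ≤ l2norm v := by
  refine abs_le_of_sq_le_sq ?_ (l2norm_nonneg v)
  rw [l2norm_sq, pow_two]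
  exact Finset.single_le_sum (f := fun i => v i * v i) (fun i _ => mul_self_nonneg _)
    (Finset.mem_univ i)

theorem dotProduct_self_le_of_abs_le {v : ι → ℝ} {c : ℝ} (h : ∀ i, |v i| ≤ c) :
    v ⬝ᵥ v ≤ Fintype.card ι * c ^ 2 := by
  rw [← nsmul_eq_mul, ← Finset.card_univ, ← Finset.sum_const]
  refine Finset.sum_le_sum fun i _ => ?_
  have := h i
  rw [← pow_two, ← sq_abs]
  exact pow_le_pow_left₀ (abs_nonneg _) this 2

end Norm

/-- `P` is a good preconditioner for least squares problems with the matrix `A`. -/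
structure Preconditions {ι m : Type*} [Fintype ι] [Fintype m] [DecidableEq m]
    (lam : ℝ) (A : Matrix ι m ℝ) (P : Matrix m m ℝ) : Prop where
  spd : IsSPD P
  lower : ∀ x, (A *ᵥ x) ⬝ᵥ (A *ᵥ x) + lam * (x ⬝ᵥ x) ≤ x ⬝ᵥ (P *ᵥ x)
  upper : ∀ x, x ⬝ᵥ (P *ᵥ x) ≤ 17 / 15 * ((A *ᵥ x) ⬝ᵥ (A *ᵥ x) + lam * (x ⬝ᵥ x))
  rowSpace : ∀ e, ∃ z, A *ᵥ z = A *ᵥ e ∧ 256 * (lam * (z ⬝ᵥ z)) ≤ (A *ᵥ z) ⬝ᵥ (A *ᵥ z)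

namespace Preconditions

theorem dot_normal {ι m : Type*} [Fintype ι] [Fintype m] (A : Matrix ι m ℝ) (e z : m → ℝ) :
    (Aᵀ *ᵥ (A *ᵥ e)) ⬝ᵥ z = (A *ᵥ e) ⬝ᵥ (A *ᵥ z) := by
  rw [mulVec_dotProduct_mulVec, Matrix.transpose_transpose]

variable {ι m : Type*} [Fintype ι] [Fintype m] [DecidableEq m] {lam : ℝ} {A : Matrix ι m ℝ}
  {P : Matrix m m ℝ}

theorem image_le_lev (h : Preconditions lam A P) (hl : 0 < lam) (g : m → ℝ) :
    (A *ᵥ (P⁻¹ *ᵥ g)) ⬝ᵥ (A *ᵥ (P⁻¹ *ᵥ g)) ≤ lev P g := by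
  have h1 := h.lower (P⁻¹ *ᵥ g)
  rw [h.spd.inv_mulVec_dot] at h1
  have := mul_nonneg hl.le (dotProduct_self_nonneg' (P⁻¹ *ᵥ g))
  linarith

theorem inv_sq_le_lev (h : Preconditions lam A P) (g : m → ℝ) :
    lam * ((P⁻¹ *ᵥ g) ⬝ᵥ (P⁻¹ *ᵥ g)) ≤ lev P g := by
  have h1 := h.lower (P⁻¹ *ᵥ g)
  rw [h.spd.inv_mulVec_dot] at h1
  have := dotProduct_self_nonneg' (A *ᵥ (P⁻¹ *ᵥ g))
  linarith

theorem lev_le_div (h : Preconditions lam A P) (hl : 0 < lam) (g : m → ℝ) :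
    lam * lev P g ≤ g ⬝ᵥ g := by
  have h1 := h.inv_sq_le_lev g
  have h2 := dotProduct_sq_le g (P⁻¹ *ᵥ g)
  change lev P g ^ 2 ≤ _ at h2
  have h3 := h.spd.lev_nonneg g
  have h4 := dotProduct_self_nonneg' g
  rcases h3.eq_or_lt with h0 | h0
  · rw [← h0]; simpa using h4
  · refine le_of_mul_le_mul_right ?_ h0
    calc lam * lev P g * lev P g = lam * lev P g ^ 2 := by ring
      _ ≤ lam * (g ⬝ᵥ g * ((P⁻¹ *ᵥ g) ⬝ᵥ (P⁻¹ *ᵥ g))) := by gcongr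
      _ = (g ⬝ᵥ g) * (lam * ((P⁻¹ *ᵥ g) ⬝ᵥ (P⁻¹ *ᵥ g))) := by ring
      _ ≤ (g ⬝ᵥ g) * lev P g := by gcongr

/-- Upper bound: `P` dominates `AᵀA`. Lower bound: test with a `z` that has the same image as `e`
and for which `lam |z|²` is at most `1/256` of `|A z|²`; there `P` is at most `17/15 * 257/256 ≤
8/7` times `AᵀA`. For rank-deficient `A` such a replacement of `e` is essential. -/
theorem lev_normal (h : Preconditions lam A P) (hl : 0 < lam) (e : m → ℝ) :
    lev P (Aᵀ *ᵥ (A *ᵥ e)) ≤ (A *ᵥ e) ⬝ᵥ (A *ᵥ e) ∧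
    7 / 8 * ((A *ᵥ e) ⬝ᵥ (A *ᵥ e)) ≤ lev P (Aᵀ *ᵥ (A *ᵥ e)) := by
  set g := Aᵀ *ᵥ (A *ᵥ e) with hg
  set E := (A *ᵥ e) ⬝ᵥ (A *ᵥ e) with hE
  have hE0 : 0 ≤ E := dotProduct_self_nonneg' _
  have hF0 := h.spd.lev_nonneg g
  constructor
  · have h1 : lev P g = (A *ᵥ e) ⬝ᵥ (A *ᵥ (P⁻¹ *ᵥ g)) := by rw [lev, hg, dot_normal]
    have h2 := dotProduct_sq_le (A *ᵥ e) (A *ᵥ (P⁻¹ *ᵥ g))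
    rw [← h1, ← hE] at h2
    have h3 := h.image_le_lev hl g
    rcases hF0.eq_or_lt with h0 | h0
    · rw [← h0]; exact hE0
    · refine le_of_mul_le_mul_right ?_ h0
      nlinarith
  · obtain ⟨z, hz, hz2⟩ := h.rowSpace e
    have h1 := h.spd.sq_dotProduct_le g z
    have h2 : g ⬝ᵥ z = E := by rw [hg, dot_normal, hz]
    have h3 := h.upper z
    rw [hz, ← hE] at h3 hz2
    rw [h2] at h1
    have h4 : z ⬝ᵥ (P *ᵥ z) ≤ 8 / 7 * E := by linarith
    rcases hE0.eq_or_lt with h0 | h0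
    · rw [← h0]; simpa using hF0
    · have h5 : E ^ 2 ≤ lev P g * (8 / 7 * E) := h1.trans (by gcongr)
      have h6 : E * E ≤ (8 / 7 * lev P g) * E := by nlinarith
      have := le_of_mul_le_mul_right h6 h0
      linarith

/-- With `E = |A e|²` and `F` the leverage of `AᵀA e`, expanding the square gives `E - 2F + |A P⁻¹
g|² ≤ E - F ≤ E / 8`, and `1/8 ≤ (3/8)²`. -/
theorem contraction (h : Preconditions lam A P) (hl : 0 < lam) (e : m → ℝ) :
    l2norm (A *ᵥ (e - P⁻¹ *ᵥ (Aᵀ *ᵥ (A *ᵥ e)))) ≤ 3 / 8 * l2norm (A *ᵥ e) := by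
  refine l2norm_le_of_sq_le (by have := l2norm_nonneg (A *ᵥ e); positivity) ?_
  rw [mul_pow, l2norm_sq]
  set g := Aᵀ *ᵥ (A *ᵥ e) with hg
  have h1 : lev P g = (A *ᵥ e) ⬝ᵥ (A *ᵥ (P⁻¹ *ᵥ g)) := by rw [lev, hg, dot_normal]
  have h3 := h.image_le_lev hl g
  have h4 := (h.lev_normal hl e).2
  rw [← hg] at h4
  rw [Matrix.mulVec_sub, sub_dotProduct, dotProduct_sub, dotProduct_sub,
    dotProduct_comm (A *ᵥ (P⁻¹ *ᵥ g)) (A *ᵥ e), ← h1]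
  have := dotProduct_self_nonneg' (A *ᵥ e)
  linarith

theorem lev_add_le (h : Preconditions lam A P) (p q : m → ℝ) :
    lev P (p + q) ≤ 2 * lev P p + 2 * lev P q := by
  obtain ⟨C, hC⟩ := h.spd.exists_whitening
  rw [IsSPD.lev_eq hC, IsSPD.lev_eq hC, IsSPD.lev_eq hC, Matrix.mulVec_add]
  set u := Cᵀ *ᵥ p
  set v := Cᵀ *ᵥ q
  have := dotProduct_self_nonneg' (u - v)
  rw [sub_dotProduct, dotProduct_sub, dotProduct_sub] at this
  rw [add_dotProduct, dotProduct_add, dotProduct_add]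
  linarith

/-- One rounded Richardson step halves the error bound. -/
theorem step (h : Preconditions lam A P) (hl : 0 < lam) {τ grd zb : ℝ} (hτ : 0 < τ)
    (hgrd : 0 < grd) {x xs rt : m → ℝ} (hx : l2norm (A *ᵥ (x - xs)) ≤ τ)
    (hrt : ∀ c, |rt c - (Aᵀ *ᵥ (A *ᵥ (xs - x))) c| ≤ zb)
    (hzb : 256 * (Fintype.card m * zb ^ 2) ≤ lam * τ ^ 2)
    (hA : ∀ η : m → ℝ, (∀ c, |η c| ≤ grd) → l2norm (A *ᵥ η) ≤ τ / 16) :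
    (∀ c, lam * ((P⁻¹ *ᵥ rt) c) ^ 2 ≤ 4 * τ ^ 2) ∧
    l2norm (A *ᵥ ((x + fun c => grd * (⌊(P⁻¹ *ᵥ rt) c / grd⌋ : ℤ)) - xs)) ≤ τ / 2 := by
  set g := Aᵀ *ᵥ (A *ᵥ (xs - x)) with hg
  set ζ := rt - g with hζ
  have hrtζ : rt = g + ζ := by rw [hζ]; abel
  have hζ2 : lev P ζ ≤ (τ / 16) ^ 2 := by
    have h1 : ζ ⬝ᵥ ζ ≤ Fintype.card m * zb ^ 2 := dotProduct_self_le_of_abs_le hrt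
    have h2 := h.lev_le_div hl ζ
    have h3 : lam * lev P ζ ≤ lam * (τ / 16) ^ 2 := by nlinarith
    exact le_of_mul_le_mul_left h3 hl
  have hx' : l2norm (A *ᵥ (xs - x)) ≤ τ := by
    rw [← neg_sub, Matrix.mulVec_neg, l2norm_neg]; exact hx
  have hg2 : lev P g ≤ τ ^ 2 := by
    refine (h.lev_normal hl (xs - x)).1.trans ?_
    rw [← l2norm_sq]
    exact pow_le_pow_left₀ (l2norm_nonneg _) hx' 2
  constructor
  · intro c
    have h1 := h.inv_sq_le_lev rt
    have h2 : ((P⁻¹ *ᵥ rt) c) ^ 2 ≤ (P⁻¹ *ᵥ rt) ⬝ᵥ (P⁻¹ *ᵥ rt) := by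
      rw [pow_two]
      exact Finset.single_le_sum (f := fun c => (P⁻¹ *ᵥ rt) c * (P⁻¹ *ᵥ rt) c)
        (fun i _ => mul_self_nonneg _) (Finset.mem_univ c)
    have h3 := h.lev_add_le g ζ
    rw [← hrtζ] at h3
    have h4 : lam * ((P⁻¹ *ᵥ rt) c) ^ 2 ≤ lam * ((P⁻¹ *ᵥ rt) ⬝ᵥ (P⁻¹ *ᵥ rt)) := by gcongr
    nlinarith
  · set η : m → ℝ := (fun c => grd * (⌊(P⁻¹ *ᵥ rt) c / grd⌋ : ℤ)) - P⁻¹ *ᵥ rt with hη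
    have hηb : l2norm (A *ᵥ η) ≤ τ / 16 := by
      refine hA η fun c => ?_
      rw [hη]
      simp only [Pi.sub_apply]
      have h1 := Int.floor_le ((P⁻¹ *ᵥ rt) c / grd)
      have h2 := Int.lt_floor_add_one ((P⁻¹ *ᵥ rt) c / grd)
      rw [le_div_iff₀ hgrd] at h1
      rw [div_lt_iff₀ hgrd] at h2
      rw [abs_le]
      constructor <;> nlinarith
    have hζb : l2norm (A *ᵥ (P⁻¹ *ᵥ ζ)) ≤ τ / 16 :=
      l2norm_le_of_sq_le (by positivity) ((h.image_le_lev hl ζ).trans hζ2)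
    -- The budget is `3/8` for the exact step, `1/16` for the inexact gradient and `1/16` for the
    -- rounded increment, in total `1/2`.
    have hcon := h.contraction hl (xs - x)
    have e1 : A *ᵥ ((x + fun c => grd * (⌊(P⁻¹ *ᵥ rt) c / grd⌋ : ℤ)) - xs)
        = -(A *ᵥ ((xs - x) - P⁻¹ *ᵥ (Aᵀ *ᵥ (A *ᵥ (xs - x))))) + (A *ᵥ (P⁻¹ *ᵥ ζ) + A *ᵥ η) := by
      rw [← hg, ← Matrix.mulVec_neg, ← Matrix.mulVec_add, ← Matrix.mulVec_add]
      congr 1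
      have : P⁻¹ *ᵥ rt = P⁻¹ *ᵥ g + P⁻¹ *ᵥ ζ := by rw [← Matrix.mulVec_add, ← hrtζ]
      rw [hη, this]
      abel
    rw [e1]
    refine (l2norm_add_le _ _).trans ?_
    have h5 := l2norm_add_le (A *ᵥ (P⁻¹ *ᵥ ζ)) (A *ᵥ η)
    rw [l2norm_neg]
    linarith

end Preconditions

/-! ### The protocol -/

/-- An integer as a word of `b + 1` bits. -/
def toWord (b : ℕ) (z : ℤ) : Fin (2 ^ (b + 1)) :=
  ⟨((z + 2 ^ b) % 2 ^ (b + 1)).toNat, by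
    have h1 : (0 : ℤ) < 2 ^ (b + 1) := by positivity
    have h2 := Int.emod_lt_of_pos (z + 2 ^ b) h1
    have h3 := Int.emod_nonneg (z + 2 ^ b) h1.ne'
    zify
    rw [Int.toNat_of_nonneg h3]
    exact h2⟩

/-- The integer represented by a word of `b + 1` bits. -/
def ofWord (b : ℕ) (w : Fin (2 ^ (b + 1))) : ℤ := (w : ℕ) - 2 ^ b

theorem ofWord_toWord {b : ℕ} {z : ℤ} (h : |z| < 2 ^ b) : ofWord b (toWord b z) = z := by
  rw [abs_lt] at h
  have h1 : (2 : ℤ) ^ (b + 1) = 2 * 2 ^ b := by ring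
  have h2 : (z + 2 ^ b) % 2 ^ (b + 1) = z + 2 ^ b :=
    Int.emod_eq_of_lt (by linarith) (by linarith)
  simp only [ofWord, toWord, h2]
  rw [Int.toNat_of_nonneg (by linarith)]
  ring

/-- The rows of a machine, continued by zero rows. -/
noncomputable def extRow {d : ℕ} (n : ℕ) (D : LocalData d) (r : Fin n) : Fin d → ℝ :=
  if h : (r : ℕ) < D.1 then D.2.1 ⟨r, h⟩ else 0

/-- The right-hand side of a machine, continued by zeros. -/
noncomputable def extRhs {d : ℕ} (n : ℕ) (D : LocalData d) (r : Fin n) : ℝ :=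
  if h : (r : ℕ) < D.1 then D.2.2 ⟨r, h⟩ else 0

/-- The parameters of the protocol: `T` trials of sampling with `lv` levels, `K` sketching vectors
and at most `cap` samples per level, with oversampling factor `R`; then `it` iterations.
Numbers are sent as words of `W + 1` bits. -/
structure Setup where
  (s n d L ell Lam T lv K R cap it W : ℕ)

namespace Setup

variable (S : Setup)

/-- Each machine is treated as if it held `n` rows, the missing ones being zero. So the seed does
not depend on how the rows are distributed; sampled zero rows do not change the Gram matrix. -/
abbrev Idx : Type := Fin S.s × Fin S.n

abbrev Vec : Type := Fin S.d → Fin (2 ^ (S.W + 1))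

/-- The questions: the number of samples, an entry of a sampled row, an entry of the local
right-hand side of the normal equations, and an update of an entry of the local gradient. -/
abbrev Query : Type :=
  (Fin S.T × Fin S.lv) ⊕ (Fin S.T × Fin S.lv × Fin S.cap × Fin S.d) ⊕ Fin S.d ⊕ (Fin S.it × Fin S.d)

/-- The number of bits, without sign, of the answer to a question. -/
def bits : S.Query → ℕ
  | .inl _ => S.W
  | .inr (.inl _) => 2 * S.L
  | .inr (.inr (.inl _)) => S.W
  | .inr (.inr (.inr _)) => S.W

/-- The length of an answer. -/
def rl (q : S.Query) : ℕ := S.bits q + 1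

abbrev Seed : Type := Fin S.T → TrialSeed (Fin S.d) S.Idx S.K (S.s * S.n) S.lv

/-- `16 mu` is a lower bound for the nonzero singular values of `A`; squaring gives the factor 256
in `Preconditions.rowSpace`. -/
noncomputable def mu : ℝ := (2 ^ (S.L + S.ell + 4))⁻¹

noncomputable def lam : ℝ := S.mu ^ 2

/-- Fine enough that rounding a sketch vector changes its product with a row by at most
`2^(-Lam-2)`, whose square is negligible against `1/N`. -/
noncomputable def grd : ℝ := (2 ^ (2 * S.Lam + S.L + 2))⁻¹

/-- The step of the grid on which the `k`-th increment of the solution lies. -/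
noncomputable def xgrid (σ : ℤ) (k : ℕ) : ℝ := 2 ^ (σ - k - ((2 * S.Lam + S.L + 4 : ℕ) : ℤ))

/-- The step of the grid to which gradients at the `k`-th iterate are rounded. -/
noncomputable def qgrid (σ : ℤ) (k : ℕ) : ℝ := 2 ^ (σ - k - ((2 * S.Lam + S.L + S.ell + 8 : ℕ) : ℤ))

/-- The code of an integer vector. -/
def encV (z : Fin S.d → ℤ) : S.Vec := fun c => toWord S.W (z c)

/-- The integer vector with a given code. -/
def decV (v : S.Vec) : Fin S.d → ℤ := fun c => ofWord S.W (v c)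

/-- The iterate obtained from the increments, latest first. -/
noncomputable def iterate (σ : ℤ) : List (Fin S.d → ℤ) → Fin S.d → ℝ
  | [] => 0
  | z :: zs => iterate σ zs + fun c => S.xgrid σ zs.length * z c

/-- The entries of `Aᵢᵀ (bᵢ - Aᵢ x)`. -/
noncomputable def localGrad (D : LocalData S.d) (x : Fin S.d → ℝ) (c : Fin S.d) : ℝ :=
  ∑ r : Fin S.n, extRow S.n D r c * (extRhs S.n D r - extRow S.n D r ⬝ᵥ x)

/-- The rows that a machine samples. -/
noncomputable def sampledRows (ω : TrialSeed (Fin S.d) S.Idx S.K (S.s * S.n) S.lv) (j : Fin S.lv)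
    (i : Fin S.s) (D : LocalData S.d) (y : Fin S.K → Fin S.d → ℤ) : List (Fin S.n) :=
  (List.finRange S.n).filter fun r => decide (atLevel ω.1 (j + 1) (i, r) = true ∧
    ((ω.2 j).2 (i, r) : ℕ) < threshold S.grd S.R (S.s * S.n) y (extRow S.n D r))

/-- The sketch that a machine finds in the latest broadcasts. -/
def readSketch (H : List S.Vec) : Fin S.K → Fin S.d → ℤ := fun k => S.decV (H.getD k (S.encV 0))

/-- What the machines answer. -/
noncomputable def answer (ω : S.Seed) (i : Fin S.s) (D : LocalData S.d) (H : List S.Vec) :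
    (q : S.Query) → Fin (2 ^ S.rl q)
  | .inl (t, j) => toWord S.W (S.sampledRows (ω t) j i D (S.readSketch H)).length
  | .inr (.inl (t, j, k, c)) => toWord (2 * S.L) ⌊2 ^ S.L *
      ((S.sampledRows (ω t) j i D (S.readSketch H))[(k : ℕ)]?.elim 0 (extRow S.n D)) c⌋
  | .inr (.inr (.inl c)) => toWord S.W ⌊4 ^ S.L * S.localGrad D 0 c⌋
  -- At this moment the latest `k + 1` broadcasts are the increments, and the scale lies just below
  -- them; the tail gives the previous iterate. The previous floor is doubled because the grid of
  -- iterate `k + 1` is half as wide as that of iterate `k`.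
  | .inr (.inr (.inr (k, c))) =>
    let σ := S.decV (H.getD (k + 1) (S.encV 0)) c
    let zs := (H.take (k + 1)).map S.decV
    toWord S.W (⌊S.localGrad D (S.iterate σ zs) c / S.qgrid σ (k + 1)⌋
      - 2 * ⌊S.localGrad D (S.iterate σ zs.tail) c / S.qgrid σ k⌋)

/-- The output, from the broadcasts. -/
noncomputable def output (H : List S.Vec) : Fin S.d → ℝ := fun c =>
  S.iterate (S.decV (H.getD S.it (S.encV 0)) c) ((H.take S.it).map S.decV) c

abbrev SProg (α : Type) : Type := Prog S.s S.Vec S.Query S.rl α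

abbrev Mat : Type := Matrix (Fin S.d) (Fin S.d) ℝ

/-- Decoding of answers. -/
def decA (q : S.Query) (w : Fin (2 ^ S.rl q)) : ℤ := ofWord (S.bits q) w

/-- The matrix from the received rows. -/
noncomputable def assemble (y : Fin S.K → Fin S.d → ℤ) (cnt : Fin S.s → ℤ)
    (F : Fin S.s × Fin S.cap × Fin S.d → ℤ) : S.Mat :=
  S.lam • 1 + ∑ i, ∑ k : Fin S.cap, if (k : ℤ) < cnt i then
    (((S.s * S.n : ℕ) : ℝ) /
      threshold S.grd S.R (S.s * S.n) y (fun c => (F (i, k, c) : ℝ) / 2 ^ S.L)) •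
      Matrix.vecMulVec (fun c => (F (i, k, c) : ℝ) / 2 ^ S.L) (fun c => (F (i, k, c) : ℝ) / 2 ^ S.L)
    else 0

/-- The entries to be asked for. -/
noncomputable def entryList (cnt : Fin S.s → ℤ) : List (Fin S.s × Fin S.cap × Fin S.d) :=
  (Finset.univ.filter fun p : Fin S.s × Fin S.cap × Fin S.d => (p.2.1 : ℤ) < cnt p.1).toList

/-- Sampling of one level, given the matrix of the previous one. -/
noncomputable def levelProg (ω : S.Seed) (t : Fin S.T) (j : Fin S.lv) (M : S.Mat) :
    S.SProg (Option S.Mat) :=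
  (Prog.bcastList (List.ofFn fun k => S.encV (sketch S.grd M ((ω t).2 j).1 k))).bind fun _ =>
  (Prog.gather id (fun _ => .inl (t, j)) S.decA (List.finRange S.s)).bind fun cnt =>
  if (∀ i, 0 ≤ cnt i) ∧ ∑ i, cnt i ≤ S.cap then
    (Prog.gather (fun p => p.1) (fun p => .inr (.inl (t, j, p.2.1, p.2.2))) S.decA
      (S.entryList cnt)).bind fun F =>
    .ret (some (S.assemble (sketch S.grd M ((ω t).2 j).1) cnt F))
  else .ret none

/-- The first `j` levels of a trial. -/
noncomputable def chainProg (ω : S.Seed) (t : Fin S.T) : ℕ → S.SProg (Option S.Mat)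
  | 0 => .ret (some (S.lam • 1))
  | j + 1 => (chainProg ω t j).bind fun o =>
    match o with
    | none => .ret none
    | some M => if hj : j < S.lv then S.levelProg ω t ⟨j, hj⟩ M else .ret (some M)

/-- The first `t` trials, ending with the first success. -/
noncomputable def trialsProg (ω : S.Seed) : ℕ → S.SProg (Option S.Mat)
  | 0 => .ret none
  | t + 1 => (trialsProg ω t).bind fun o =>
    match o with
    | some M => .ret (some M)
    | none => if ht : t < S.T then S.chainProg ω ⟨t, ht⟩ S.lv else .ret none

/-- The increment of the iterate from the rounded gradients `f`. -/
noncomputable def increment (P : S.Mat) (σ : ℤ) (k : ℕ) (f : Fin S.s × Fin S.d → ℤ) :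
    Fin S.d → ℤ := fun c =>
  ⌊(P⁻¹ *ᵥ fun c => ∑ i, S.qgrid σ k * f (i, c)) c / S.xgrid σ k⌋

/-- All pairs of a machine and a coordinate. -/
noncomputable def allEntries : List (Fin S.s × Fin S.d) := Finset.univ.toList

/-- The first `k` iterations. -/
noncomputable def iterProg (P : S.Mat) (σ : ℤ) (f₀ : Fin S.s × Fin S.d → ℤ) :
    ℕ → S.SProg (Fin S.s × Fin S.d → ℤ)
  | 0 => .ret f₀
  | k + 1 => (iterProg P σ f₀ k).bind fun f =>
    if hk : k < S.it then
      .bcast (S.encV (S.increment P σ k f))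
        ((Prog.gather (fun p => p.1) (fun p => .inr (.inr (.inr (⟨k, hk⟩, p.2)))) S.decA
          S.allEntries).bind fun F => .ret fun p => 2 * f p + F p)
    else .ret f

/-- The right-hand side of the normal equations. -/
noncomputable def rhsVec (F : Fin S.s × Fin S.d → ℤ) : Fin S.d → ℝ := fun c =>
  ∑ i, (F (i, c) : ℝ) / 4 ^ S.L

/-- The binary exponent of the scale of the solution. -/
noncomputable def scale (P : S.Mat) (r : Fin S.d → ℝ) : ℤ := Int.log 2 (Real.sqrt (lev P r)) + 2

open Classical in
/-- Solution of the least squares problem with a preconditioner. -/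
noncomputable def solveProg (P : S.Mat) : S.SProg Unit :=
  (Prog.gather (fun p => p.1) (fun p => .inr (.inr (.inl p.2))) S.decA S.allEntries).bind fun F =>
  -- The solution is then 0 and has no scale. Zero words in place of the scale and of all increments
  -- make everybody output 0.
  if S.rhsVec F = 0 then Prog.bcastList (List.replicate (S.it + 1) (S.encV 0))
  else .bcast (S.encV fun _ => S.scale P (S.rhsVec F))
    ((S.iterProg P (S.scale P (S.rhsVec F))
      (fun p => ⌊(F p : ℝ) / 4 ^ S.L / S.qgrid (S.scale P (S.rhsVec F)) 0⌋) S.it).bind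
        fun _ => .ret ())

/-- The whole program. -/
noncomputable def mainProg (ω : S.Seed) : S.SProg Unit :=
  -- The identity is a default for the case that all trials abort; the bound on communication holds
  -- even then.
  (S.trialsProg ω S.T).bind fun o => S.solveProg ((16 / 15 : ℝ) • o.getD 1)

/-! ### Cost -/

/-- The cap is on the total number of rows over all machines, checked before any row is sent. Hence
the price of the rows has no factor `s`. -/
theorem costLE_levelProg (cb cq : ℕ) (ω : S.Seed) (t : Fin S.T) (j : Fin S.lv) (M : S.Mat) :
    (S.levelProg ω t j M).CostLE cb cq
      (S.K * cb + (S.s * (cq + (S.W + 1)) + S.cap * S.d * (cq + (2 * S.L + 1)))) := by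
  refine Prog.CostLE.bind ?_ fun _ => Prog.CostLE.bind ?_ fun cnt => ?_
  · refine (Prog.costLE_bcastList cb cq _).mono ?_
    simp
  · refine Prog.CostLE.mono (Prog.costLE_gather cb cq _ _ _ _ (S.W + 1) fun a _ => le_rfl) ?_
    simp
  · split_ifs with h
    · refine Prog.CostLE.mono (Prog.CostLE.bind (N' := 0) (Prog.costLE_gather cb cq _ _ _ _
        (2 * S.L + 1) fun a _ => le_rfl) fun F => trivial) ?_
      rw [add_zero]
      gcongr
      rw [entryList, Finset.length_toList]
      have h1 : (Finset.univ.filter fun p : Fin S.s × Fin S.cap × Fin S.d =>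
          (p.2.1 : ℤ) < cnt p.1).card ≤ ∑ i, (cnt i).toNat * S.d := by
        rw [Finset.card_filter, Fintype.sum_prod_type]
        refine Finset.sum_le_sum fun i _ => ?_
        rw [Fintype.sum_prod_type]
        rw [Finset.sum_comm]
        change (∑ _y : Fin S.d, ∑ x : Fin S.cap, if (x : ℤ) < cnt i then 1 else 0) ≤ _
        rw [Finset.sum_const, Finset.card_univ, Fintype.card_fin, smul_eq_mul, mul_comm,
          ← Finset.card_filter]
        gcongr
        rw [← Finset.card_range (cnt i).toNat]
        refine Finset.card_le_card_of_injOn (fun k : Fin S.cap => (k : ℕ)) (fun k hk => ?_)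
          fun a _ b _ hab => Fin.ext hab
        have hk' := (Finset.mem_filter.1 hk).2
        simp only [Finset.coe_range, Set.mem_Iio]
        omega
      refine h1.trans ?_
      rw [← Finset.sum_mul]
      gcongr
      have h2 : ((∑ i, (cnt i).toNat : ℕ) : ℤ) = ∑ i, cnt i := by
        rw [Nat.cast_sum]
        exact Finset.sum_congr rfl fun i _ => Int.toNat_of_nonneg (h.1 i)
      have h3 := h.2
      rw [← h2] at h3
      exact_mod_cast h3
    · trivial

theorem costLE_chainProg (cb cq : ℕ) (ω : S.Seed) (t : Fin S.T) (j : ℕ) :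
    (S.chainProg ω t j).CostLE cb cq (j *
      (S.K * cb + (S.s * (cq + (S.W + 1)) + S.cap * S.d * (cq + (2 * S.L + 1))))) := by
  induction j with
  | zero => trivial
  | succ j ih =>
    rw [Nat.succ_mul]
    refine ih.bind fun o => ?_
    cases o with
    | none => trivial
    | some M =>
      simp only
      split_ifs with hj
      · exact S.costLE_levelProg cb cq ω t _ M
      · trivial

theorem costLE_trialsProg (cb cq : ℕ) (ω : S.Seed) (t : ℕ) :
    (S.trialsProg ω t).CostLE cb cq (t * (S.lv *
      (S.K * cb + (S.s * (cq + (S.W + 1)) + S.cap * S.d * (cq + (2 * S.L + 1)))))) := by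
  induction t with
  | zero => trivial
  | succ t ih =>
    rw [Nat.succ_mul]
    refine ih.bind fun o => ?_
    cases o with
    | some M => trivial
    | none =>
      simp only
      split_ifs with ht
      · exact S.costLE_chainProg cb cq ω _ _
      · trivial

theorem costLE_iterProg (cb cq : ℕ) (P : S.Mat) (σ : ℤ) (f₀ : Fin S.s × Fin S.d → ℤ) (k : ℕ) :
    (S.iterProg P σ f₀ k).CostLE cb cq (k * (cb + S.s * S.d * (cq + (S.W + 1)))) := by
  induction k with
  | zero => trivial
  | succ k ih =>
    rw [Nat.succ_mul]
    refine ih.bind fun f => ?_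
    split_ifs with hk
    · refine ⟨_, Prog.CostLE.bind (N' := 0) (Prog.costLE_gather cb cq _ _ _ _ (S.W + 1)
        fun a _ => le_rfl) fun F => trivial, ?_⟩
      simp [allEntries]
    · trivial

theorem costLE_solveProg (cb cq : ℕ) (P : S.Mat) :
    (S.solveProg P).CostLE cb cq ((S.it + 1) * (cb + S.s * S.d * (cq + (S.W + 1)))) := by
  refine (Prog.CostLE.bind (N := S.s * S.d * (cq + (S.W + 1)))
    (N' := cb + S.it * (cb + S.s * S.d * (cq + (S.W + 1)))) ?_ fun F => ?_).mono ?_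
  · refine Prog.CostLE.mono (Prog.costLE_gather cb cq _ _ _ _ (S.W + 1) fun a _ => le_rfl) ?_
    simp [allEntries]
  · split_ifs
    · refine (Prog.costLE_bcastList cb cq _).mono ?_
      simp only [List.length_replicate]
      nlinarith [Nat.zero_le (S.it * (S.s * S.d * (cq + (S.W + 1))))]
    · exact ⟨_, Prog.CostLE.bind (N' := 0) (S.costLE_iterProg cb cq _ _ _ _) fun _ => trivial,
        le_rfl⟩
  · rw [Nat.succ_mul]; omega

theorem costLE_mainProg (cb cq : ℕ) (ω : S.Seed) :
    (S.mainProg ω).CostLE cb cq (S.T * (S.lv *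
      (S.K * cb + (S.s * (cq + (S.W + 1)) + S.cap * S.d * (cq + (2 * S.L + 1)))))
      + (S.it + 1) * (cb + S.s * S.d * (cq + (S.W + 1)))) :=
  (S.costLE_trialsProg cb cq ω S.T).bind fun _ => S.costLE_solveProg cb cq _

end Setup

/-! ### The sampling phase -/

theorem sum_fin_getElem {α M : Type*} [AddCommMonoid M] (l : List α) {cap : ℕ}
    (h : l.length ≤ cap) (f : α → M) (g : Fin cap → M)
    (hg : ∀ (k : Fin cap) (hk : (k : ℕ) < l.length), g k = f l[(k : ℕ)])
    (hg0 : ∀ k : Fin cap, ¬ (k : ℕ) < l.length → g k = 0) :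
    ∑ k, g k = (l.map f).sum := by
  induction l generalizing cap with
  | nil => simpa using Finset.sum_eq_zero fun k _ => hg0 k (by simp)
  | cons a l ih =>
    obtain ⟨cap, rfl⟩ : ∃ c, cap = c + 1 := ⟨cap - 1, by simp at h; omega⟩
    rw [Fin.sum_univ_succ, List.map_cons, List.sum_cons, hg 0 (by simp),
      ih (by simpa using h) (fun k => g k.succ)]
    · simp
    · intro k hk
      rw [hg k.succ (by simpa using hk)]
      simp
    · intro k hk
      exact hg0 k.succ (by simpa using hk)

theorem sum_map_filter_finRange {M : Type*} [AddCommMonoid M] {n : ℕ} (p : Fin n → Prop)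
    [DecidablePred p] (f : Fin n → M) :
    (((List.finRange n).filter fun r => decide (p r)).map f).sum = ∑ r, if p r then f r else 0 := by
  rw [← Finset.sum_filter, ← List.sum_toFinset]
  · congr 1
    ext r
    simp
  · exact (List.nodup_finRange n).filter _

theorem abs_floor_lt_of_abs_le {x : ℝ} {b k : ℕ} (h : |x| ≤ 2 ^ b) (hk : b < k) :
    |⌊x⌋| < 2 ^ k := by
  rw [abs_le] at h
  have h1 : (2 : ℝ) ^ b < 2 ^ k := pow_lt_pow_right₀ (by norm_num) hk
  rw [abs_lt]
  constructor
  · have h2 : (2 : ℤ) ^ b < 2 ^ k := pow_lt_pow_right₀ (by norm_num) hk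
    refine lt_of_lt_of_le (neg_lt_neg h2) (Int.le_floor.2 ?_)
    push_cast
    exact h.1
  · refine Int.floor_lt.2 ?_
    push_cast
    exact h.2.trans_lt h1

namespace Setup

variable (S : Setup)

/-- The rows of all machines. -/
noncomputable def rows (D : Fin S.s → LocalData S.d) : S.Idx → Fin S.d → ℝ :=
  fun p => extRow S.n (D p.1) p.2

theorem mu_pos : 0 < S.mu := by unfold mu; positivity

theorem lam_pos : 0 < S.lam := pow_pos S.mu_pos 2

theorem grd_pos : 0 < S.grd := by unfold grd; positivity

theorem decV_encV {z : Fin S.d → ℤ} (h : ∀ c, |z c| < 2 ^ S.W) : S.decV (S.encV z) = z :=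
  funext fun c => ofWord_toWord (h c)

variable {S}

/-- A sketch vector `v = C g` satisfies `vᵀ M v = gᵀ g = d`, and `M` dominates `lam`. So its entries
are at most `√d / mu`. -/
theorem abs_sketch_lt (hW : 3 * S.Lam + 2 * S.L + S.ell + 7 ≤ S.W) (hd : S.d ≤ 2 ^ S.Lam)
    {M : S.Mat} (hM : IsSPD M) (hlam : ∀ x, S.lam * (x ⬝ᵥ x) ≤ x ⬝ᵥ (M *ᵥ x))
    (g : Fin S.K → Fin S.d → Bool) (k : Fin S.K) (c : Fin S.d) :
    |sketch S.grd M g k c| < 2 ^ S.W := by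
  set v := whitening M *ᵥ fun i => sgn (g k i) with hv
  have h1 : v ⬝ᵥ (M *ᵥ v) = S.d := by
    rw [hv, mulVec_dotProduct_mulVec, Matrix.mulVec_mulVec, Matrix.mulVec_mulVec,
      hM.whitening_spec, Matrix.one_mulVec]
    have : ∀ b : Bool, sgn b * sgn b = 1 := by intro b; cases b <;> simp [sgn]
    simp [dotProduct, this]
  have h2 : (v c) ^ 2 ≤ v ⬝ᵥ v := by
    rw [pow_two]
    exact Finset.single_le_sum (f := fun i => v i * v i) (fun i _ => mul_self_nonneg _)
      (Finset.mem_univ c)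
  have h3 := hlam v
  rw [h1] at h3
  have h4 : (S.mu * |v c|) ^ 2 ≤ (2 ^ S.Lam) ^ 2 := by
    have hd' : (S.d : ℝ) ≤ 2 ^ S.Lam := by exact_mod_cast hd
    have h5 : (1 : ℝ) ≤ 2 ^ S.Lam := one_le_pow₀ (by norm_num)
    rw [mul_pow, sq_abs]
    calc S.mu ^ 2 * v c ^ 2 ≤ S.lam * (v ⬝ᵥ v) := by rw [lam]; gcongr
      _ ≤ S.d := h3
      _ ≤ (2 ^ S.Lam) ^ 2 := by nlinarith
  have h5 : S.mu * |v c| ≤ 2 ^ S.Lam := abs_le_of_sq_le_sq' h4 (by positivity) |>.2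
  have h6 : |v c / S.grd| ≤ 2 ^ (3 * S.Lam + 2 * S.L + S.ell + 6) := by
    rw [abs_div, abs_of_pos S.grd_pos, grd, div_inv_eq_mul]
    rw [mu, inv_mul_le_iff₀ (by positivity)] at h5
    calc |v c| * 2 ^ (2 * S.Lam + S.L + 2)
        ≤ 2 ^ (S.L + S.ell + 4) * 2 ^ S.Lam * 2 ^ (2 * S.Lam + S.L + 2) := by gcongr
      _ = _ := by rw [← pow_add, ← pow_add]; congr 1; ring
  exact abs_floor_lt_of_abs_le h6 (by omega)

variable (S) in
/-- The coordinator and the machines execute a program. -/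
noncomputable abbrev exec (D : Fin S.s → LocalData S.d) (ω : S.Seed) :
    Fin S.s → List S.Vec → (q : S.Query) → Fin (2 ^ S.rl q) :=
  fun i => S.answer ω i (D i)

theorem readSketch_append {y : Fin S.K → Fin S.d → ℤ} (hy : ∀ k c, |y k c| < 2 ^ S.W)
    (H : List S.Vec) : S.readSketch ((List.ofFn fun k => S.encV (y k)) ++ H) = y := by
  funext k
  rw [readSketch, List.getD_append _ _ _ _ (by simp)]
  rw [List.getD_eq_getElem _ _ (by simp), List.getElem_ofFn]
  exact S.decV_encV (hy k)

open Classical in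
theorem sum_length_sampledRows (D : Fin S.s → LocalData S.d)
    (ω : TrialSeed (Fin S.d) S.Idx S.K (S.s * S.n) S.lv) (j : Fin S.lv) (M : S.Mat) :
    ∑ i, (S.sampledRows ω j i (D i) (sketch S.grd M (ω.2 j).1)).length
      = (Finset.univ.filter (IsSampled S.grd S.R (S.rows D) ω j M)).card := by
  rw [Finset.card_filter, Fintype.sum_prod_type]
  refine Finset.sum_congr rfl fun i _ => ?_
  have h := sum_map_filter_finRange (fun r => atLevel ω.1 (j + 1) (i, r) = true ∧
    ((ω.2 j).2 (i, r) : ℕ) < threshold S.grd S.R (S.s * S.n) (sketch S.grd M (ω.2 j).1)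
      (extRow S.n (D i) r)) (fun _ => 1)
  rw [List.map_const', List.sum_replicate, smul_eq_mul, mul_one] at h
  rw [sampledRows, h]
  refine Finset.sum_congr rfl fun r _ => ?_
  congr

/-- No weights are transmitted: the threshold of a row is a function of the row and the sketch, both
of which the coordinator knows exactly. -/
theorem assemble_eq (D : Fin S.s → LocalData S.d)
    (ω : TrialSeed (Fin S.d) S.Idx S.K (S.s * S.n) S.lv) (j : Fin S.lv) (M : S.Mat)
    (cnt : Fin S.s → ℤ)
    (hcnt : ∀ i, cnt i = (S.sampledRows ω j i (D i) (sketch S.grd M (ω.2 j).1)).length)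
    (hcap : ∀ i, cnt i ≤ S.cap) (F : Fin S.s × Fin S.cap × Fin S.d → ℤ)
    (hF : ∀ i (k : Fin S.cap) (hk : (k : ℕ) <
      (S.sampledRows ω j i (D i) (sketch S.grd M (ω.2 j).1)).length) c,
      (F (i, k, c) : ℝ) / 2 ^ S.L = extRow S.n (D i)
        ((S.sampledRows ω j i (D i) (sketch S.grd M (ω.2 j).1))[(k : ℕ)]) c) :
    S.assemble (sketch S.grd M (ω.2 j).1) cnt F
      = sampleMatrix S.lam S.grd S.R (levelRows (S.rows D) ω.1 (j + 1)) M (ω.2 j) := by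
  classical
  set y := sketch S.grd M (ω.2 j).1 with hy
  rw [assemble, sampleMatrix, gram, Fintype.sum_prod_type, ← hy]
  congr 1
  refine Finset.sum_congr rfl fun i _ => ?_
  set f : Fin S.n → S.Mat := fun r => (((S.s * S.n : ℕ) : ℝ) /
      threshold S.grd S.R (S.s * S.n) y (extRow S.n (D i) r)) •
      Matrix.vecMulVec (extRow S.n (D i) r) (extRow S.n (D i) r) with hf
  rw [sum_fin_getElem (S.sampledRows ω j i (D i) y) (by have := hcap i; rw [hcnt i] at this; exact_mod_cast this)
    f, sampledRows, sum_map_filter_finRange]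
  · refine Finset.sum_congr rfl fun r _ => ?_
    by_cases h : atLevel ω.1 (j + 1) (i, r) = true
    · simp only [h, true_and, levelRows, if_true, rows, hf, ite_smul, zero_smul]
    · simp [h, levelRows]
  · intro k hk
    rw [if_pos (by rw [hcnt]; exact_mod_cast hk)]
    have h : (fun c => (F (i, k, c) : ℝ) / 2 ^ S.L)
      = extRow S.n (D i) (S.sampledRows ω j i (D i) y)[(k : ℕ)] := funext fun c => hF i k hk c
    rw [h]
  · intro k hk
    rw [if_neg (by rw [hcnt]; exact_mod_cast hk)]

theorem floor_fixedPoint {L : ℕ} {x : ℝ} (h : IsFixedPoint L x) :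
    ∃ z : ℤ, ⌊2 ^ L * x⌋ = z ∧ |z| < 2 ^ (2 * L) ∧ x = z / 2 ^ L := by
  obtain ⟨z, h1, h2⟩ := h
  refine ⟨z, ?_, h1, h2⟩
  rw [h2, mul_div_cancel₀ _ (by positivity), Int.floor_intCast]

open Classical in
theorem run_levelProg (hW : 3 * S.Lam + 2 * S.L + S.ell + 7 ≤ S.W) (hd : S.d ≤ 2 ^ S.Lam)
    (hn : S.n ≤ 2 ^ S.Lam) {D : Fin S.s → LocalData S.d}
    (hD : ∀ p c, IsFixedPoint S.L (S.rows D p c)) (ω : S.Seed) (t : Fin S.T) (j : Fin S.lv)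
    {M : S.Mat} (hM : IsSPD M) (hlam : ∀ x, S.lam * (x ⬝ᵥ x) ≤ x ⬝ᵥ (M *ᵥ x)) (H : List S.Vec) :
    ((S.levelProg ω t j M).run (S.exec D ω) H).1 =
      if (Finset.univ.filter (IsSampled S.grd S.R (S.rows D) (ω t) j M)).card ≤ S.cap then
        some (sampleMatrix S.lam S.grd S.R (levelRows (S.rows D) (ω t).1 (j + 1)) M ((ω t).2 j))
      else none := by
  set y := sketch S.grd M ((ω t).2 j).1 with hy
  have hyW : ∀ k c, |y k c| < 2 ^ S.W := fun k c => abs_sketch_lt hW hd hM hlam _ k c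
  set l : Fin S.s → List (Fin S.n) := fun i => S.sampledRows (ω t) j i (D i) y with hl
  have hlen : ∀ i, (l i).length ≤ S.n := fun i => by
    refine (List.length_filter_le _ _).trans ?_
    simp
  rw [levelProg, Prog.run_bind, Prog.run_bcastList]
  set H1 := (List.ofFn fun k => S.encV (y k)) ++ H with hH1
  have hread : S.readSketch H1 = y := readSketch_append hyW H
  rw [Prog.run_bind]
  obtain ⟨hg1, hg2⟩ := Prog.run_gather id (fun _ => (.inl (t, j) : S.Query)) S.decA (S.exec D ω)
    (List.finRange S.s) H1
  rw [hg1]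
  set cnt := ((Prog.gather id (fun _ => (.inl (t, j) : S.Query)) S.decA
    (List.finRange S.s)).run (S.exec D ω) H1).1 with hcntdef
  have hcnt : ∀ i, cnt i = (l i).length := fun i => by
    rw [hg2 i (List.mem_finRange i)]
    change ofWord S.W (toWord S.W
      (S.sampledRows (ω t) j i (D i) (S.readSketch H1)).length) = _
    rw [hread, ofWord_toWord]
    rw [abs_of_nonneg (by positivity)]
    calc (((S.sampledRows (ω t) j i (D i) y).length : ℕ) : ℤ) ≤ (2 : ℤ) ^ S.Lam := by
          exact_mod_cast (hlen i).trans hn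
      _ < 2 ^ S.W := pow_lt_pow_right₀ (by norm_num) (by omega)
  have hsum : ∑ i, cnt i = ((Finset.univ.filter
      (IsSampled S.grd S.R (S.rows D) (ω t) j M)).card : ℤ) := by
    rw [← sum_length_sampledRows, Nat.cast_sum]
    exact Finset.sum_congr rfl fun i _ => hcnt i
  have hpos : ∀ i, 0 ≤ cnt i := fun i => by rw [hcnt]; positivity
  simp only [hpos, implies_true, true_and, hsum, Nat.cast_le]
  split_ifs with hcap
  · rw [Prog.run_bind, Prog.run]
    refine congrArg some (assemble_eq D (ω t) j M cnt hcnt (fun i => ?_) _ fun i k hk c => ?_)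
    · refine (Finset.single_le_sum (fun i _ => hpos i) (Finset.mem_univ i)).trans ?_
      rw [hsum]
      exact_mod_cast hcap
    · rw [(Prog.run_gather _ _ _ _ _ _).2 (i, k, c) ?_]
      · change ((ofWord (2 * S.L) (toWord (2 * S.L) ⌊2 ^ S.L * ((S.sampledRows (ω t) j i (D i)
          (S.readSketch H1))[(k : ℕ)]?.elim 0 (extRow S.n (D i))) c⌋) : ℤ) : ℝ) / 2 ^ S.L = _
        rw [hread]
        have hk' : (k : ℕ) < (l i).length := hk
        change ((ofWord (2 * S.L) (toWord (2 * S.L) ⌊2 ^ S.L *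
          ((l i)[(k : ℕ)]?.elim 0 (extRow S.n (D i))) c⌋) : ℤ) : ℝ) / 2 ^ S.L
            = extRow S.n (D i) (l i)[(k : ℕ)] c
        rw [List.getElem?_eq_getElem hk', Option.elim_some]
        obtain ⟨z, h1, h2, h3⟩ := floor_fixedPoint (hD (i, (l i)[(k : ℕ)]) c)
        change ⌊2 ^ S.L * extRow S.n (D i) (l i)[(k : ℕ)] c⌋ = z at h1
        change extRow S.n (D i) (l i)[(k : ℕ)] c = _ at h3
        rw [h1, ofWord_toWord h2, ← h3]
      · rw [entryList, Finset.mem_toList, Finset.mem_filter]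
        refine ⟨Finset.mem_univ _, ?_⟩
        rw [hcnt]
        exact_mod_cast hk
  · rfl

theorem lam_le_gram {ι : Type*} [Fintype ι] {lam : ℝ} {m : Type*} [Fintype m] [DecidableEq m]
    (a : ι → m → ℝ) {c : ι → ℝ} (hc : ∀ r, 0 ≤ c r) (x : m → ℝ) :
    lam * (x ⬝ᵥ x) ≤ x ⬝ᵥ (gram lam a c *ᵥ x) := by
  rw [dotProduct_gram]
  have : 0 ≤ ∑ r, c r * (a r ⬝ᵥ x) ^ 2 :=
    Finset.sum_nonneg fun r _ => mul_nonneg (hc r) (sq_nonneg _)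
  linarith

theorem lam_le_chain {m ι : Type*} [Fintype m] [DecidableEq m] [Fintype ι] {K N lv : ℕ}
    (lam grd R : ℝ) (a : ι → m → ℝ) (ω : TrialSeed m ι K N lv) (j : ℕ) (x : m → ℝ) :
    lam * (x ⬝ᵥ x) ≤ x ⬝ᵥ (chain lam grd R a ω j *ᵥ x) := by
  induction j with
  | zero => simp [chain, Matrix.smul_mulVec]
  | succ j ih =>
    rw [chain]
    split_ifs with hj
    · exact lam_le_gram _ (fun r => by split_ifs <;> positivity) x
    · exact ih

open Classical in
theorem run_chainProg (hW : 3 * S.Lam + 2 * S.L + S.ell + 7 ≤ S.W) (hd : S.d ≤ 2 ^ S.Lam)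
    (hn : S.n ≤ 2 ^ S.Lam) {D : Fin S.s → LocalData S.d}
    (hD : ∀ p c, IsFixedPoint S.L (S.rows D p c)) (ω : S.Seed) (t : Fin S.T) (H : List S.Vec)
    (j : ℕ) :
    ((S.chainProg ω t j).run (S.exec D ω) H).1 =
      if ∃ l : Fin S.lv, (l : ℕ) < j ∧
        S.cap < sampleCount S.lam S.grd S.R (S.rows D) (ω t) l then none
      else some (chain S.lam S.grd S.R (S.rows D) (ω t) j) := by
  induction j with
  | zero => simp [chainProg, Prog.run, chain]
  | succ j ih =>
    rw [chainProg, Prog.run_bind, ih]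
    by_cases h : ∃ l : Fin S.lv, (l : ℕ) < j ∧
        S.cap < sampleCount S.lam S.grd S.R (S.rows D) (ω t) l
    · rw [if_pos h, if_pos]
      · rfl
      · obtain ⟨l, h1, h2⟩ := h
        exact ⟨l, by omega, h2⟩
    · rw [if_neg h]
      simp only
      by_cases hj : j < S.lv
      · rw [dif_pos hj, run_levelProg hW hd hn hD ω t ⟨j, hj⟩ (chain_isSPD S.lam_pos _ _)
          (lam_le_chain _ _ _ _ _ _), chain, dif_pos hj]
        have hiff : (∃ l : Fin S.lv, (l : ℕ) < j + 1 ∧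
            S.cap < sampleCount S.lam S.grd S.R (S.rows D) (ω t) l) ↔
            ¬ (Finset.univ.filter (IsSampled S.grd S.R (S.rows D) (ω t) ⟨j, hj⟩
              (chain S.lam S.grd S.R (S.rows D) (ω t) j))).card ≤ S.cap := by
          rw [not_le]
          constructor
          · rintro ⟨l, h1, h2⟩
            rcases Nat.lt_succ_iff_lt_or_eq.1 h1 with h3 | h3
            · exact absurd ⟨l, h3, h2⟩ h
            · have : l = ⟨j, hj⟩ := Fin.ext h3
              subst this
              exact h2
          · intro h2
            exact ⟨⟨j, hj⟩, Nat.lt_succ_self j, h2⟩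
        by_cases hc : (Finset.univ.filter (IsSampled S.grd S.R (S.rows D) (ω t) ⟨j, hj⟩
              (chain S.lam S.grd S.R (S.rows D) (ω t) j))).card ≤ S.cap
        · rw [if_pos hc, if_neg (fun h' => hiff.1 h' hc)]
        · rw [if_neg hc, if_pos (hiff.2 hc)]
      · rw [dif_neg hj, Prog.run, chain, dif_neg hj, if_neg]
        rintro ⟨l, h1, h2⟩
        exact h ⟨l, by omega, h2⟩

/-- It does not matter which trial `u` is returned, because the approximation will be known for all
of them. -/
theorem run_trialsProg (hW : 3 * S.Lam + 2 * S.L + S.ell + 7 ≤ S.W) (hd : S.d ≤ 2 ^ S.Lam)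
    (hn : S.n ≤ 2 ^ S.Lam) {D : Fin S.s → LocalData S.d}
    (hD : ∀ p c, IsFixedPoint S.L (S.rows D p c)) (ω : S.Seed) (H : List S.Vec) (t : ℕ) :
    (((S.trialsProg ω t).run (S.exec D ω) H).1 = none ∧ ∀ u : Fin S.T, (u : ℕ) < t →
      ∃ l, S.cap < sampleCount S.lam S.grd S.R (S.rows D) (ω u) l) ∨
    ∃ u : Fin S.T, ((S.trialsProg ω t).run (S.exec D ω) H).1
      = some (chain S.lam S.grd S.R (S.rows D) (ω u) S.lv) := by
  induction t with
  | zero => exact .inl ⟨rfl, fun u hu => absurd hu (Nat.not_lt_zero _)⟩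
  | succ t ih =>
    rw [trialsProg, Prog.run_bind]
    rcases ih with ⟨h1, h2⟩ | ⟨u, h1⟩
    · rw [h1]
      simp only
      by_cases ht : t < S.T
      · rw [dif_pos ht, run_chainProg hW hd hn hD]
        split_ifs with h3
        · refine .inl ⟨rfl, fun u hu => ?_⟩
          rcases Nat.lt_succ_iff_lt_or_eq.1 hu with h4 | h4
          · exact h2 u h4
          · have : u = ⟨t, ht⟩ := Fin.ext h4
            subst this
            obtain ⟨l, -, h5⟩ := h3
            exact ⟨l, h5⟩
        · exact .inr ⟨⟨t, ht⟩, rfl⟩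
      · rw [dif_neg ht]
        exact .inl ⟨rfl, fun u hu => h2 u (by omega)⟩
    · rw [h1]
      exact .inr ⟨u, rfl⟩

end Setup

/-! ### Least squares -/

section LeastSquares

variable {m n : Type*} [Fintype m] [Fintype n]

theorem Matrix.mul_eq_zero_of_transpose_mul_self_mul_eq_zero {l : Type*} (A : Matrix m n ℝ)
    (B : Matrix n l ℝ) (h : Aᵀ * A * B = 0) : A * B = 0 := by
  have := (Matrix.conjTranspose_mul_self_mul_eq_zero A B).1
  rw [Matrix.conjTranspose_eq_transpose_of_trivial] at this
  exact this h

/-- The least squares solution `(Aᵀ A)† Aᵀ b`. -/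
noncomputable def lsq (A : Matrix m n ℝ) (b : m → ℝ) : n → ℝ :=
  pinv (Aᵀ * A) *ᵥ (Aᵀ *ᵥ b)

/-- `1 - G B` annihilates `G = AᵀA` from the left. Transposing, cancelling `Aᵀ` and transposing
back, it annihilates `Aᵀ` as well. -/
theorem normal_equations (A : Matrix m n ℝ) (b : m → ℝ) :
    Aᵀ *ᵥ (A *ᵥ lsq A b) = Aᵀ *ᵥ b := by
  classical
  have hP := isMoorePenrose_pinv (Aᵀ * A)
  set G := Aᵀ * A with hG
  set B := pinv G with hB
  have hGT : Gᵀ = G := by rw [hG, Matrix.transpose_mul, Matrix.transpose_transpose]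
  have h1 : G * (1 - G * B)ᵀ = 0 := by
    have h2 : (1 - G * B) * G = 0 := by
      rw [Matrix.sub_mul, Matrix.one_mul, hP.mul_mul_self, sub_self]
    have h3 := congrArg Matrix.transpose h2
    rwa [Matrix.transpose_mul, hGT, Matrix.transpose_zero] at h3
  have h4 : A * (1 - G * B)ᵀ = 0 :=
    Matrix.mul_eq_zero_of_transpose_mul_self_mul_eq_zero A _ h1
  have h5 : (1 - G * B) * Aᵀ = 0 := by
    have := congrArg Matrix.transpose h4
    rwa [Matrix.transpose_mul, Matrix.transpose_transpose, Matrix.transpose_zero] at this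
  rw [Matrix.sub_mul, Matrix.one_mul, sub_eq_zero] at h5
  conv_rhs => rw [h5]
  rw [lsq, Matrix.mulVec_mulVec, Matrix.mulVec_mulVec, Matrix.mulVec_mulVec, ← hG, ← hB]

theorem lsq_minimizes (A : Matrix m n ℝ) (b : m → ℝ) (y : n → ℝ) :
    l2norm (A *ᵥ lsq A b - b) ≤ l2norm (A *ᵥ y - b) := by
  refine l2norm_le_of_sq_le (l2norm_nonneg _) ?_
  rw [l2norm_sq]
  set x := lsq A b with hx
  set u := A *ᵥ x - b with hu
  set v := A *ᵥ (y - x) with hv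
  have h1 : A *ᵥ y - b = u + v := by rw [hu, hv, Matrix.mulVec_sub]; abel
  have h2 : v ⬝ᵥ u = 0 := by
    rw [hv, mulVec_dotProduct_mulVec, hu, Matrix.mulVec_sub, hx, normal_equations, sub_self,
      dotProduct_zero]
  rw [h1, add_dotProduct, dotProduct_add, dotProduct_add, h2, dotProduct_comm u v, h2]
  have := dotProduct_self_nonneg' v
  linarith

/-- Triangle inequality through the least squares solution, whose residual is minimal and whose
image is the vector in the error term. -/
theorem isHighAccuracySolution_of_le {d : ℕ} {ε : ℝ} {A : Matrix m (Fin d) ℝ} {b : m → ℝ}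
    {x : Fin d → ℝ} (h : l2norm (A *ᵥ (x - lsq A b)) ≤ ε * l2norm (A *ᵥ lsq A b)) :
    IsHighAccuracySolution ε A b x := by
  rw [IsHighAccuracySolution]
  have h1 : (A * pinv (Aᵀ * A) * Aᵀ) *ᵥ b = A *ᵥ lsq A b := by
    rw [lsq, Matrix.mulVec_mulVec, Matrix.mulVec_mulVec, Matrix.mul_assoc]
  have h2 : l2norm (A *ᵥ lsq A b - b) ≤ ⨅ y : Fin d → ℝ, l2norm (A *ᵥ y - b) :=
    le_ciInf fun y => lsq_minimizes A b y
  have h3 : A *ᵥ x - b = A *ᵥ (x - lsq A b) + (A *ᵥ lsq A b - b) := by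
    rw [Matrix.mulVec_sub]; abel
  rw [h1, h3]
  refine (l2norm_add_le _ _).trans ?_
  linarith

theorem isHighAccuracySolution_zero {d : ℕ} {ε : ℝ} {A : Matrix m (Fin d) ℝ} {b : m → ℝ}
    (h : 1 ≤ ε ∨ A = 0) : IsHighAccuracySolution ε A b 0 := by
  refine isHighAccuracySolution_of_le ?_
  rcases h with h | h
  · rw [zero_sub, Matrix.mulVec_neg, l2norm_neg]
    have := l2norm_nonneg (A *ᵥ lsq A b)
    nlinarith
  · simp [h, l2norm]

theorem l2norm_lsq_le (A : Matrix m n ℝ) (b : m → ℝ) : l2norm (A *ᵥ lsq A b) ≤ l2norm b := by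
  have h1 : (A *ᵥ lsq A b) ⬝ᵥ (A *ᵥ lsq A b) = (A *ᵥ lsq A b) ⬝ᵥ b := by
    rw [mulVec_dotProduct_mulVec, normal_equations, ← mulVec_dotProduct_mulVec]
  refine l2norm_le_of_sq_le (l2norm_nonneg _) ?_
  rw [l2norm_sq]
  have h2 := dotProduct_self_nonneg' (A *ᵥ lsq A b - b)
  rw [sub_dotProduct, dotProduct_sub, dotProduct_sub, dotProduct_comm b, ← h1] at h2
  linarith

-- Take `z = A† A e`, so that `‖z‖ ≤ ‖A†‖ ‖A e‖`, and bound `‖A‖` from below by any nonzero entry.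
-- This is the only place where the condition number enters.
open scoped Matrix.Norms.L2Operator in
theorem exists_preimage_of_condNumber_le [DecidableEq m] [DecidableEq n] {A : Matrix m n ℝ}
    {κ δ : ℝ} (hA : condNumber A ≤ κ)
    (hentry : ∀ r c, A r c ≠ 0 → δ ≤ |A r c|) (e : n → ℝ) :
    ∃ z, A *ᵥ z = A *ᵥ e ∧ δ * l2norm z ≤ κ * l2norm (A *ᵥ z) := by
  by_cases h0 : A = 0
  · exact ⟨0, by simp [h0], by simp [l2norm]⟩
  obtain ⟨r, c, hrc⟩ : ∃ r c, A r c ≠ 0 := by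
    by_contra hne
    push Not at hne
    exact h0 (Matrix.ext hne)
  have hAn : δ ≤ ‖A‖ := by
    have h1 := Matrix.l2_opNorm_mulVec A (WithLp.toLp 2 (Pi.single c 1))
    change l2norm (A *ᵥ Pi.single c 1) ≤ ‖A‖ * l2norm (Pi.single c 1) at h1
    have h2 : l2norm (Pi.single c (1 : ℝ)) = 1 := by
      have h3 := l2norm_sq (Pi.single c (1 : ℝ))
      rw [dotProduct_single, Pi.single_eq_same, mul_one] at h3
      nlinarith [l2norm_nonneg (Pi.single c (1 : ℝ))]
    have h3 := abs_le_l2norm (A *ᵥ Pi.single c 1) r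
    rw [Matrix.mulVec_single_one, Matrix.col_apply] at h3
    rw [h2, mul_one, Matrix.mulVec_single_one] at h1
    exact (hentry r c hrc).trans (h3.trans h1)
  refine ⟨pinv A *ᵥ (A *ᵥ e), ?_, ?_⟩
  · rw [Matrix.mulVec_mulVec, Matrix.mulVec_mulVec, (isMoorePenrose_pinv A).mul_mul_self]
  · have h4 : A *ᵥ (pinv A *ᵥ (A *ᵥ e)) = A *ᵥ e := by
      rw [Matrix.mulVec_mulVec, Matrix.mulVec_mulVec, (isMoorePenrose_pinv A).mul_mul_self]
    rw [h4]
    have h5 := Matrix.l2_opNorm_mulVec (pinv A) (WithLp.toLp 2 (A *ᵥ e))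
    change l2norm (pinv A *ᵥ (A *ᵥ e)) ≤ ‖pinv A‖ * l2norm (A *ᵥ e) at h5
    have h6 := l2norm_nonneg (A *ᵥ e)
    have h7 := l2norm_nonneg (pinv A *ᵥ (A *ᵥ e))
    calc δ * l2norm (pinv A *ᵥ (A *ᵥ e)) ≤ ‖A‖ * (‖pinv A‖ * l2norm (A *ᵥ e)) := by gcongr
      _ = condNumber A * l2norm (A *ᵥ e) := by rw [condNumber]; ring
      _ ≤ κ * l2norm (A *ᵥ e) := by gcongr

/-- Scaling by `16/15` moves the interval `[15/16, 17/16]` to `[1, 17/15]`, so that the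
preconditioner dominates and a step cannot overshoot. -/
theorem preconditions_of_approx [DecidableEq n] {ι : Type*} [Fintype ι] {lam : ℝ}
    {A : Matrix m n ℝ} {M : Matrix n n ℝ} {a : ι → n → ℝ} (hM : IsSPD M)
    (h : Approx M (gram lam a fun _ => 1))
    (ha : ∀ x, ∑ r, (a r ⬝ᵥ x) ^ 2 = (A *ᵥ x) ⬝ᵥ (A *ᵥ x))
    (hrow : ∀ e, ∃ z, A *ᵥ z = A *ᵥ e ∧ 256 * (lam * (z ⬝ᵥ z)) ≤ (A *ᵥ z) ⬝ᵥ (A *ᵥ z)) :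
    Preconditions lam A ((16 / 15 : ℝ) • M) := by
  have hq : ∀ x, x ⬝ᵥ (((16 / 15 : ℝ) • M) *ᵥ x) = 16 / 15 * (x ⬝ᵥ (M *ᵥ x)) := fun x => by
    rw [Matrix.smul_mulVec, dotProduct_smul, smul_eq_mul]
  have hG : ∀ x, x ⬝ᵥ (gram lam a (fun _ => 1) *ᵥ x)
      = (A *ᵥ x) ⬝ᵥ (A *ᵥ x) + lam * (x ⬝ᵥ x) := fun x => by
    rw [dotProduct_gram, ← ha]
    simp only [one_mul]
    ring
  have hab := fun x => abs_le.1 (h x)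
  simp only [hG] at hab
  refine ⟨⟨?_, fun x hx => ?_⟩, fun x => ?_, fun x => ?_, hrow⟩
  · rw [Matrix.IsSymm, Matrix.transpose_smul, hM.symm.eq]
  · rw [hq]
    have := hM.pos x hx
    positivity
  · rw [hq]; have := (hab x).1; linarith
  · rw [hq]; have := (hab x).2; linarith

end LeastSquares

/-! ### Fixed-point entries and padded inputs. -/

theorem IsFixedPoint.abs_le {L : ℕ} {x : ℝ} (h : IsFixedPoint L x) : |x| ≤ 2 ^ L := by
  obtain ⟨z, h1, rfl⟩ := h
  rw [abs_div, abs_of_pos (by positivity : (0 : ℝ) < 2 ^ L), div_le_iff₀ (by positivity), ← pow_add,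
    ← two_mul]
  have h2 : |z| ≤ 2 ^ (2 * L) := h1.le
  exact_mod_cast h2

theorem IsFixedPoint.le_abs {L : ℕ} {x : ℝ} (h : IsFixedPoint L x) (hx : x ≠ 0) :
    (2 ^ L)⁻¹ ≤ |x| := by
  obtain ⟨z, h1, rfl⟩ := h
  rw [abs_div, abs_of_pos (by positivity : (0 : ℝ) < 2 ^ L), inv_eq_one_div]
  gcongr
  have hz : z ≠ 0 := by rintro rfl; simp at hx
  exact_mod_cast Int.one_le_abs hz

theorem isFixedPoint_zero (L : ℕ) : IsFixedPoint L 0 := ⟨0, by simp, by simp⟩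

theorem sum_ext_eq {s d n : ℕ} {M : Type*} [AddCommMonoid M] (D : Fin s → LocalData d)
    (i : Fin s) (hn : (D i).1 ≤ n) (f : (Fin d → ℝ) → ℝ → M) (hf : f 0 0 = 0) :
    ∑ r : Fin n, f (extRow n (D i) r) (extRhs n (D i) r)
      = ∑ r : Fin (D i).1, f (stackMatrix D ⟨i, r⟩) (stackVector D ⟨i, r⟩) := by
  obtain ⟨k, rfl⟩ := Nat.exists_eq_add_of_le hn
  rw [Fin.sum_univ_add]
  have h1 : ∀ r : Fin k, f (extRow ((D i).1 + k) (D i) (Fin.natAdd _ r))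
      (extRhs ((D i).1 + k) (D i) (Fin.natAdd _ r)) = 0 := fun r => by
    simp [extRow, extRhs, hf]
  have h2 : ∀ r : Fin (D i).1, f (extRow ((D i).1 + k) (D i) (Fin.castAdd _ r))
      (extRhs ((D i).1 + k) (D i) (Fin.castAdd _ r))
      = f (stackMatrix D ⟨i, r⟩) (stackVector D ⟨i, r⟩) := fun r => by
    simp only [extRow, extRhs, Fin.val_castAdd, Fin.is_lt, dite_true]
    rfl
  simp only [h1, h2, Finset.sum_const_zero, add_zero]

/-! ### The iterations -/

namespace Setup

variable {S : Setup}

/-- The input is as promised, and the parameters of the protocol are large enough for it. -/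
structure Fits (S : Setup) (D : Fin S.s → LocalData S.d) : Prop where
  card : ∑ i, (D i).1 = S.n
  fixA : ∀ r j, IsFixedPoint S.L (stackMatrix D r j)
  fixb : ∀ r, IsFixedPoint S.L (stackVector D r)
  cond : condNumber (stackMatrix D) ≤ 2 ^ S.ell
  s_le : S.s ≤ 2 ^ S.Lam
  n_le : S.n ≤ 2 ^ S.Lam
  d_le : S.d ≤ 2 ^ S.Lam
  W_ge : 3 * S.Lam + 4 * S.L + S.ell + 13 ≤ S.W

namespace Fits

variable {D : Fin S.s → LocalData S.d}

theorem le_n (h : S.Fits D) (i : Fin S.s) : (D i).1 ≤ S.n := by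
  rw [← h.card]
  exact Finset.single_le_sum (f := fun i => (D i).1) (fun _ _ => Nat.zero_le _) (Finset.mem_univ i)

theorem extRow_eq (i : Fin S.s) (r : Fin S.n) :
    extRow S.n (D i) r = 0 ∧ extRhs S.n (D i) r = 0 ∨
    ∃ q, extRow S.n (D i) r = stackMatrix D q ∧ extRhs S.n (D i) r = stackVector D q := by
  by_cases hr : (r : ℕ) < (D i).1
  · refine .inr ⟨⟨i, ⟨r, hr⟩⟩, ?_, ?_⟩
    · rw [extRow, dif_pos hr]; rfl
    · rw [extRhs, dif_pos hr]; rfl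
  · exact .inl ⟨by rw [extRow, dif_neg hr], by rw [extRhs, dif_neg hr]⟩

theorem fix_rows (h : S.Fits D) (p : S.Idx) (c : Fin S.d) : IsFixedPoint S.L (S.rows D p c) := by
  rcases extRow_eq (D := D) p.1 p.2 with ⟨h1, -⟩ | ⟨q, h1, -⟩
  · rw [rows, h1]; exact isFixedPoint_zero _
  · rw [rows, h1]; exact h.fixA q c

theorem fix_rhs (h : S.Fits D) (i : Fin S.s) (r : Fin S.n) :
    IsFixedPoint S.L (extRhs S.n (D i) r) := by
  rcases extRow_eq (D := D) i r with ⟨-, h1⟩ | ⟨q, -, h1⟩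
  · rw [h1]; exact isFixedPoint_zero _
  · rw [h1]; exact h.fixb q

theorem abs_extRow_dot_le (i : Fin S.s) (r : Fin S.n) (v : Fin S.d → ℝ) :
    |extRow S.n (D i) r ⬝ᵥ v| ≤ l2norm (stackMatrix D *ᵥ v) := by
  rcases extRow_eq (D := D) i r with ⟨h1, -⟩ | ⟨q, h1, -⟩
  · rw [h1, zero_dotProduct, abs_zero]; exact l2norm_nonneg _
  · rw [h1]; exact abs_le_l2norm (stackMatrix D *ᵥ v) q

theorem sum_rows_sq (h : S.Fits D) (x : Fin S.d → ℝ) :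
    ∑ p, (S.rows D p ⬝ᵥ x) ^ 2 = (stackMatrix D *ᵥ x) ⬝ᵥ (stackMatrix D *ᵥ x) := by
  rw [Fintype.sum_prod_type, dotProduct, Fintype.sum_sigma]
  refine Finset.sum_congr rfl fun i _ => ?_
  simp only [rows]
  rw [sum_ext_eq D i (h.le_n i) (fun a _ => (a ⬝ᵥ x) ^ 2) (by simp)]
  exact Finset.sum_congr rfl fun r _ => pow_two _

theorem sum_localGrad (h : S.Fits D) (x : Fin S.d → ℝ) (c : Fin S.d) :
    ∑ i, S.localGrad (D i) x c
      = ((stackMatrix D)ᵀ *ᵥ (stackVector D - stackMatrix D *ᵥ x)) c := by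
  rw [Matrix.mulVec, dotProduct, Fintype.sum_sigma]
  refine Finset.sum_congr rfl fun i _ => ?_
  rw [localGrad, sum_ext_eq D i (h.le_n i) (fun a b => a c * (b - a ⬝ᵥ x)) (by simp)]
  rfl

theorem sum_localGrad_eq (h : S.Fits D) (x : Fin S.d → ℝ) (c : Fin S.d) :
    ∑ i, S.localGrad (D i) x c = ((stackMatrix D)ᵀ *ᵥ (stackMatrix D *ᵥ
      (lsq (stackMatrix D) (stackVector D) - x))) c := by
  rw [h.sum_localGrad, Matrix.mulVec_sub, Matrix.mulVec_sub, Matrix.mulVec_sub, normal_equations]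

theorem rowSpace (h : S.Fits D) (e : Fin S.d → ℝ) :
    ∃ z, stackMatrix D *ᵥ z = stackMatrix D *ᵥ e ∧ 256 * (S.lam * (z ⬝ᵥ z))
      ≤ (stackMatrix D *ᵥ z) ⬝ᵥ (stackMatrix D *ᵥ z) := by
  obtain ⟨z, h1, h2⟩ := exists_preimage_of_condNumber_le h.cond (fun r c hrc => (h.fixA r c).le_abs hrc) e
  refine ⟨z, h1, ?_⟩
  rw [← l2norm_sq, ← l2norm_sq]
  have h3 : 16 * S.mu * l2norm z ≤ l2norm (stackMatrix D *ᵥ z) := by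
    have h4 : 16 * S.mu = (2 ^ S.L)⁻¹ * (2 ^ S.ell)⁻¹ := by
      rw [mu, pow_add, pow_add, mul_inv, mul_inv]
      norm_num
      ring
    rw [h4, mul_right_comm, ← div_eq_mul_inv, div_le_iff₀ (by positivity), mul_comm (l2norm _)]
    exact h2
  have h5 := pow_le_pow_left₀ (mul_nonneg (mul_nonneg (by norm_num) S.mu_pos.le)
    (l2norm_nonneg z)) h3 2
  refine le_trans (le_of_eq ?_) h5
  rw [lam]
  ring

theorem card_index (h : S.Fits D) : Fintype.card (Σ i : Fin S.s, Fin (D i).1) = S.n := by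
  simpa using h.card

theorem n_le_real (h : S.Fits D) : (S.n : ℝ) ≤ 2 ^ S.Lam := by exact_mod_cast h.n_le

theorem d_le_real (h : S.Fits D) : (S.d : ℝ) ≤ 2 ^ S.Lam := by exact_mod_cast h.d_le

theorem s_le_real (h : S.Fits D) : (S.s : ℝ) ≤ 2 ^ S.Lam := by exact_mod_cast h.s_le

theorem l2norm_le_of_abs_le (h : S.Fits D) {v : (Σ i : Fin S.s, Fin (D i).1) → ℝ} {c : ℝ}
    (hc : 0 ≤ c) (hv : ∀ r, |v r| ≤ c) : l2norm v ≤ 2 ^ S.Lam * c := by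
  refine l2norm_le_of_sq_le (by positivity) ((dotProduct_self_le_of_abs_le hv).trans ?_)
  rw [h.card_index, mul_pow]
  gcongr
  have h1 : (1 : ℝ) ≤ 2 ^ S.Lam := one_le_pow₀ (by norm_num)
  have := h.n_le_real
  nlinarith

theorem l2norm_mulVec_le (h : S.Fits D) {η : Fin S.d → ℝ} {g : ℝ} (hg : 0 ≤ g)
    (hη : ∀ c, |η c| ≤ g) : l2norm (stackMatrix D *ᵥ η) ≤ 2 ^ (2 * S.Lam + S.L) * g := by
  have h1 : ∀ r, |(stackMatrix D *ᵥ η) r| ≤ 2 ^ S.Lam * (2 ^ S.L * g) := by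
    intro r
    rw [Matrix.mulVec, dotProduct]
    refine (Finset.abs_sum_le_sum_abs _ _).trans ?_
    have h2 : ∀ c ∈ Finset.univ, |stackMatrix D r c * η c| ≤ 2 ^ S.L * g := fun c _ => by
      rw [abs_mul]
      exact mul_le_mul (h.fixA r c).abs_le (hη c) (abs_nonneg _) (by positivity)
    refine (Finset.sum_le_sum h2).trans ?_
    rw [Finset.sum_const, Finset.card_univ, Fintype.card_fin, nsmul_eq_mul]
    have := h.d_le_real
    gcongr
  refine (h.l2norm_le_of_abs_le (by positivity) h1).trans (le_of_eq ?_)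
  rw [pow_add, two_mul, pow_add]
  ring

end Fits

theorem xgrid_eq (σ : ℤ) (k : ℕ) :
    S.xgrid σ k = 2 ^ (σ - k) * (2 ^ (2 * S.Lam + S.L + 4))⁻¹ := by
  rw [xgrid, zpow_sub₀ (by norm_num : (2 : ℝ) ≠ 0) (σ - k), zpow_natCast, div_eq_mul_inv]

theorem qgrid_eq (σ : ℤ) (k : ℕ) :
    S.qgrid σ k = 2 ^ (σ - k) * (2 ^ (2 * S.Lam + S.L + S.ell + 8))⁻¹ := by
  rw [qgrid, zpow_sub₀ (by norm_num : (2 : ℝ) ≠ 0) (σ - k), zpow_natCast, div_eq_mul_inv]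

theorem xgrid_pos (σ : ℤ) (k : ℕ) : 0 < S.xgrid σ k := by unfold xgrid; positivity

theorem qgrid_pos (σ : ℤ) (k : ℕ) : 0 < S.qgrid σ k := by unfold qgrid; positivity

theorem zpow_succ_half (σ : ℤ) (k : ℕ) :
    (2 : ℝ) ^ (σ - ((k + 1 : ℕ) : ℤ)) = 2 ^ (σ - k) / 2 := by
  rw [Nat.cast_succ, ← sub_sub, zpow_sub₀ (by norm_num : (2 : ℝ) ≠ 0) _ 1, zpow_one]

theorem qgrid_succ (σ : ℤ) (k : ℕ) : S.qgrid σ k = 2 * S.qgrid σ (k + 1) := by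
  rw [qgrid_eq, qgrid_eq, zpow_succ_half]
  ring

namespace Fits

variable {D : Fin S.s → LocalData S.d}

theorem abs_localGrad_sub_le (h : S.Fits D) (i : Fin S.s) (x y : Fin S.d → ℝ) (c : Fin S.d) :
    |S.localGrad (D i) x c - S.localGrad (D i) y c|
      ≤ 2 ^ (S.Lam + S.L) * l2norm (stackMatrix D *ᵥ (x - y)) := by
  rw [localGrad, localGrad, ← Finset.sum_sub_distrib]
  refine (Finset.abs_sum_le_sum_abs _ _).trans ?_
  have h2 : ∀ r ∈ Finset.univ, |extRow S.n (D i) r c * (extRhs S.n (D i) r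
      - extRow S.n (D i) r ⬝ᵥ x) - extRow S.n (D i) r c * (extRhs S.n (D i) r
      - extRow S.n (D i) r ⬝ᵥ y)| ≤ 2 ^ S.L * l2norm (stackMatrix D *ᵥ (x - y)) := fun r _ => by
    rw [← mul_sub, abs_mul, sub_sub_sub_cancel_left, ← dotProduct_sub, ← neg_sub x y,
      dotProduct_neg, abs_neg]
    exact mul_le_mul (h.fix_rows (i, r) c).abs_le (abs_extRow_dot_le i r _) (abs_nonneg _)
      (by positivity)
  refine (Finset.sum_le_sum h2).trans ?_
  rw [Finset.sum_const, Finset.card_univ, Fintype.card_fin, nsmul_eq_mul, pow_add, mul_assoc]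
  have := h.n_le_real
  have := l2norm_nonneg (stackMatrix D *ᵥ (x - y))
  gcongr

/-- Between consecutive iterates the images under `A` differ by `O(2^(σ-k))`, hence so do the local
gradients, up to the factor `2^(Lam+L)`. The grid shrinks at the same rate, so the quotient is
bounded independently of `k`; the two floors add an error of at most 2. -/
theorem abs_answer_lt (h : S.Fits D) (i : Fin S.s) {x y : Fin S.d → ℝ} (c : Fin S.d) {σ : ℤ}
    {k : ℕ} (hxy : l2norm (stackMatrix D *ᵥ (y - x)) ≤ 2 * 2 ^ (σ - k)) :
    |⌊S.localGrad (D i) y c / S.qgrid σ (k + 1)⌋ - 2 * ⌊S.localGrad (D i) x c / S.qgrid σ k⌋|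
      < 2 ^ S.W := by
  set q := S.qgrid σ (k + 1) with hq
  have hq0 : 0 < q := qgrid_pos σ _
  set τ : ℝ := 2 ^ (σ - k) with hτ
  have hτ0 : 0 < τ := by positivity
  set B : ℝ := 2 ^ (3 * S.Lam + 2 * S.L + S.ell + 10) with hB
  have h1 : |S.localGrad (D i) y c - S.localGrad (D i) x c| ≤ B * q := by
    refine (h.abs_localGrad_sub_le i y x c).trans ?_
    have h2 : B * q = 2 ^ (S.Lam + S.L) * (2 * τ) := by
      rw [hq, qgrid_eq, zpow_succ_half, ← hτ, hB, mul_comm, ← div_eq_mul_inv, div_mul_eq_mul_div,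
        div_eq_iff (by positivity)]
      have h3 : 3 * S.Lam + 2 * S.L + S.ell + 10 = (S.Lam + S.L) + (2 * S.Lam + S.L + S.ell + 8) + 2 := by
        ring
      rw [h3, pow_add _ _ 2, pow_add _ (S.Lam + S.L)]
      ring
    rw [h2]
    gcongr
  set u := S.localGrad (D i) y c with hu
  set v := S.localGrad (D i) x c with hv
  have hqk : S.qgrid σ k = 2 * q := qgrid_succ σ k
  rw [hqk]
  have e1 := Int.floor_le (u / q)
  have e2 := Int.lt_floor_add_one (u / q)
  have e3 := Int.floor_le (v / (2 * q))
  have e4 := Int.lt_floor_add_one (v / (2 * q))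
  set a := ⌊u / q⌋
  set b := ⌊v / (2 * q)⌋
  rw [le_div_iff₀ (by positivity)] at e1 e3
  rw [div_lt_iff₀ (by positivity)] at e2 e4
  rw [abs_le] at h1
  have h4 : |((a - 2 * b : ℤ) : ℝ)| ≤ B + 2 := by
    push_cast
    rw [abs_le]
    constructor
    · refine le_of_mul_le_mul_right ?_ hq0; nlinarith
    · refine le_of_mul_le_mul_right ?_ hq0; nlinarith
  have h5 : B + 2 < 2 ^ S.W := by
    have h6 : (2 : ℝ) ≤ B := by
      rw [hB]
      exact le_self_pow₀ (by norm_num) (by omega)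
    have h7 : B * 4 ≤ 2 ^ S.W := by
      rw [hB, show (4 : ℝ) = 2 ^ 2 by norm_num, ← pow_add]
      have := h.W_ge
      exact pow_le_pow_right₀ (by norm_num) (by omega)
    linarith
  exact_mod_cast h4.trans_lt h5

theorem step (h : S.Fits D) {P : S.Mat} (hP : Preconditions S.lam (stackMatrix D) P) (σ : ℤ)
    (k : ℕ) {x : Fin S.d → ℝ} (hx : l2norm (stackMatrix D *ᵥ
      (x - lsq (stackMatrix D) (stackVector D))) ≤ 2 ^ (σ - k))
    {f : Fin S.s × Fin S.d → ℤ} (hf : ∀ p, f p = ⌊S.localGrad (D p.1) x p.2 / S.qgrid σ k⌋) :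
    (∀ c, |S.increment P σ k f c| < 2 ^ S.W) ∧
    l2norm (stackMatrix D *ᵥ (x + (fun c => S.xgrid σ k * S.increment P σ k f c)
      - lsq (stackMatrix D) (stackVector D))) ≤ 2 ^ (σ - (k + 1 : ℕ)) := by
  set τ : ℝ := 2 ^ (σ - k) with hτ
  have hτ0 : 0 < τ := by positivity
  set rt : Fin S.d → ℝ := fun c => ∑ i, S.qgrid σ k * f (i, c) with hrt
  have hq0 : 0 < S.qgrid σ k := qgrid_pos σ k
  have hg0 : 0 < S.xgrid σ k := xgrid_pos σ k
  have hst := hP.step S.lam_pos hτ0 hg0 (rt := rt) (zb := S.s * S.qgrid σ k) hx ?_ ?_ ?_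
  · obtain ⟨h1, h2⟩ := hst
    refine ⟨fun c => ?_, ?_⟩
    · have h3 : (S.mu * |(P⁻¹ *ᵥ rt) c|) ^ 2 ≤ (2 * τ) ^ 2 := by
        rw [mul_pow, sq_abs, mul_pow]
        have := h1 c
        rw [lam] at this
        linarith
      have h4 : S.mu * |(P⁻¹ *ᵥ rt) c| ≤ 2 * τ := abs_le_of_sq_le_sq' h3 (by positivity) |>.2
      rw [mu, inv_mul_le_iff₀ (by positivity)] at h4
      have h5 : |(P⁻¹ *ᵥ rt) c / S.xgrid σ k| ≤ 2 ^ (2 * S.Lam + 2 * S.L + S.ell + 9) := by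
        rw [abs_div, abs_of_pos hg0, div_le_iff₀ hg0, xgrid_eq, ← hτ]
        refine h4.trans (le_of_eq ?_)
        rw [← div_eq_mul_inv, mul_div_assoc', eq_div_iff (by positivity)]
        have h6 : (2 : ℝ) ^ (2 * S.Lam + 2 * S.L + S.ell + 9)
            = 2 ^ (S.L + S.ell + 4) * 2 ^ (2 * S.Lam + S.L + 4) * 2 := by
          rw [← pow_add, ← pow_succ]
          congr 1
          ring
        rw [h6]
        ring
      have := h.W_ge
      exact abs_floor_lt_of_abs_le h5 (by omega)
    · rw [zpow_succ_half, ← hτ]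
      exact h2
  · intro c
    rw [← h.sum_localGrad_eq, hrt, ← Finset.sum_sub_distrib]
    refine (Finset.abs_sum_le_sum_abs _ _).trans ?_
    have h3 : ∀ i ∈ Finset.univ, |S.qgrid σ k * (f (i, c) : ℝ) - S.localGrad (D i) x c|
        ≤ S.qgrid σ k := fun i _ => by
      rw [hf]
      have e1 := Int.floor_le (S.localGrad (D i) x c / S.qgrid σ k)
      have e2 := Int.lt_floor_add_one (S.localGrad (D i) x c / S.qgrid σ k)
      rw [le_div_iff₀ hq0] at e1
      rw [div_lt_iff₀ hq0] at e2
      rw [abs_le]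
      constructor <;> simp only <;> nlinarith
    refine (Finset.sum_le_sum h3).trans (le_of_eq ?_)
    simp
  · rw [Fintype.card_fin, qgrid_eq, ← hτ, lam, mu]
    have hd := h.d_le_real
    have hs := h.s_le_real
    set Y : ℝ := 2 ^ S.Lam with hY
    have hY1 : 1 ≤ Y := one_le_pow₀ (by norm_num)
    -- This is how the exponent in `qgrid` is made up: `Y²` absorbs `d s²` after squaring, 16 the
    -- factor 256, and the last power is `1 / mu`.
    have h3 : (2 : ℝ) ^ (2 * S.Lam + S.L + S.ell + 8) = Y ^ 2 * (16 * 2 ^ (S.L + S.ell + 4)) := by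
      rw [hY, ← pow_mul, show (16 : ℝ) = 2 ^ 4 by norm_num, ← pow_add, ← pow_add]
      congr 1
      ring
    rw [h3]
    set Z : ℝ := 2 ^ (S.L + S.ell + 4) with hZ
    have hZ0 : 0 < Z := by positivity
    have h4 : (S.d : ℝ) * S.s ^ 2 ≤ Y ^ 4 := by
      calc (S.d : ℝ) * S.s ^ 2 ≤ Y * Y ^ 2 := by gcongr
        _ ≤ Y * (Y * Y ^ 2) := by
          have : Y ^ 2 ≤ Y * Y ^ 2 := le_mul_of_one_le_left (by positivity) hY1
          gcongr
        _ = Y ^ 4 := by ring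
    have h5 : 256 * ((S.d : ℝ) * (S.s * (τ * (Y ^ 2 * (16 * Z))⁻¹)) ^ 2)
        = ((S.d : ℝ) * S.s ^ 2) / Y ^ 4 * ((Z⁻¹) ^ 2 * τ ^ 2) := by
      field_simp
      ring
    rw [h5]
    refine mul_le_of_le_one_left (by positivity) ?_
    rw [div_le_one (by positivity)]
    exact h4
  · intro η hη
    refine (h.l2norm_mulVec_le hg0.le hη).trans (le_of_eq ?_)
    rw [xgrid_eq, ← hτ, pow_add _ (2 * S.Lam + S.L) 4]
    field_simp
    norm_num

/-- The coordinator always holds the exact floors of the local gradients at the current iterate,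
since the answers are differences of integers that fit into words; rounding errors therefore never
pile up. All machines can rebuild the iterate from the history. -/
theorem run_iterProg (h : S.Fits D) {P : S.Mat} (hP : Preconditions S.lam (stackMatrix D) P)
    {σ : ℤ} (hσ : |σ| < 2 ^ S.W) (hstart : l2norm (stackMatrix D *ᵥ
      lsq (stackMatrix D) (stackVector D)) ≤ 2 ^ σ) (ω : S.Seed)
    {f₀ : Fin S.s × Fin S.d → ℤ} (hf₀ : ∀ p, f₀ p = ⌊S.localGrad (D p.1) 0 p.2 / S.qgrid σ 0⌋)
    (H₀ : List S.Vec) (k : ℕ) (hk : k ≤ S.it) :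
    ∃ zs : List (Fin S.d → ℤ), zs.length = k ∧ (∀ z ∈ zs, ∀ c, |z c| < 2 ^ S.W) ∧
      (∀ p, ((S.iterProg P σ f₀ k).run (S.exec D ω) (S.encV (fun _ => σ) :: H₀)).1 p
        = ⌊S.localGrad (D p.1) (S.iterate σ zs) p.2 / S.qgrid σ k⌋) ∧
      ((S.iterProg P σ f₀ k).run (S.exec D ω) (S.encV (fun _ => σ) :: H₀)).2
        = zs.map S.encV ++ S.encV (fun _ => σ) :: H₀ ∧
      l2norm (stackMatrix D *ᵥ (S.iterate σ zs - lsq (stackMatrix D) (stackVector D)))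
        ≤ 2 ^ (σ - k) := by
  induction k with
  | zero =>
    refine ⟨[], rfl, by simp, hf₀, rfl, ?_⟩
    rw [iterate, zero_sub, Matrix.mulVec_neg, l2norm_neg]
    simpa using hstart
  | succ k ih =>
    obtain ⟨zs, hlen, hzs, hf, hH, hx⟩ := ih (by omega)
    rw [iterProg, Prog.run_bind, hH, dif_pos (by omega : k < S.it)]
    set f := ((S.iterProg P σ f₀ k).run (S.exec D ω) (S.encV (fun _ => σ) :: H₀)).1 with hfdef
    obtain ⟨hz, hx'⟩ := h.step hP σ k hx hf
    set z := S.increment P σ k f with hzdef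
    have hit : S.iterate σ (z :: zs) = S.iterate σ zs + fun c => S.xgrid σ k * z c := by
      rw [iterate, hlen]
    rw [← hit] at hx'
    have hzs' : ∀ z' ∈ z :: zs, ∀ c, |z' c| < 2 ^ S.W := by
      intro z' hz'
      rcases List.mem_cons.1 hz' with rfl | h1
      · exact hz
      · exact hzs z' h1
    refine ⟨z :: zs, by simp [hlen], hzs', ?_, ?_, hx'⟩
    · intro p
      rw [Prog.run, Prog.run_bind, Prog.run]
      simp only
      rw [(Prog.run_gather _ _ _ _ _ _).2 p (by simp [allEntries])]
      set H : List S.Vec := S.encV z :: (zs.map S.encV ++ S.encV (fun _ => σ) :: H₀) with hHdef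
      have hHeq : H = (z :: zs).map S.encV ++ S.encV (fun _ => σ) :: H₀ := by simp [hHdef]
      have hget : S.decV (H.getD (k + 1) (S.encV 0)) p.2 = σ := by
        rw [hHeq, List.getD_append_right _ _ _ _ (by simp [hlen])]
        simp only [List.length_map, List.length_cons, hlen, Nat.sub_self, List.getD_cons_zero]
        rw [S.decV_encV fun _ => hσ]
      have htake : (H.take (k + 1)).map S.decV = z :: zs := by
        rw [hHeq, List.take_left' (by simp [hlen]), List.map_map]
        conv_rhs => rw [← List.map_id (z :: zs)]
        exact List.map_congr_left fun z' hz' => S.decV_encV (hzs' z' hz')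
      change 2 * f p + ofWord S.W (toWord S.W
        (⌊S.localGrad (D p.1) (S.iterate (S.decV (H.getD (k + 1) (S.encV 0)) p.2)
            ((H.take (k + 1)).map S.decV)) p.2
              / S.qgrid (S.decV (H.getD (k + 1) (S.encV 0)) p.2) (k + 1)⌋
        - 2 * ⌊S.localGrad (D p.1) (S.iterate (S.decV (H.getD (k + 1) (S.encV 0)) p.2)
            ((H.take (k + 1)).map S.decV).tail) p.2
              / S.qgrid (S.decV (H.getD (k + 1) (S.encV 0)) p.2) k⌋)) = _
      rw [hget, htake, List.tail_cons, ofWord_toWord, hf p]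
      · ring
      · refine h.abs_answer_lt p.1 p.2 ?_
        have e1 : S.iterate σ (z :: zs) - S.iterate σ zs
            = (S.iterate σ (z :: zs) - lsq (stackMatrix D) (stackVector D))
              + -(S.iterate σ zs - lsq (stackMatrix D) (stackVector D)) := by abel
        rw [e1, Matrix.mulVec_add, Matrix.mulVec_neg]
        refine (l2norm_add_le _ _).trans ?_
        rw [l2norm_neg]
        rw [zpow_succ_half] at hx'
        have : (0 : ℝ) < 2 ^ (σ - k) := by positivity
        linarith
    · rw [Prog.run, Prog.run_bind, Prog.run]
      exact (Prog.run_gather _ _ _ _ _ _).1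

end Fits

end Setup

/-! ### The scale of the solution and the correctness of the output. -/

namespace Setup

variable {S : Setup}

namespace Fits

variable {D : Fin S.s → LocalData S.d}

/-- At `x = 0` the local gradient is a sum of products of two fixed-point numbers, so it can be sent
exactly. The term `4 L` in the word length is needed here. -/
theorem exists_int_localGrad (h : S.Fits D) (i : Fin S.s) (c : Fin S.d) :
    ∃ z : ℤ, 4 ^ S.L * S.localGrad (D i) 0 c = z ∧ |z| < 2 ^ S.W := by
  have h1 : ∀ r, ∃ z : ℤ, 4 ^ S.L * (extRow S.n (D i) r c * extRhs S.n (D i) r) = z ∧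
      |z| ≤ 2 ^ (4 * S.L) := by
    intro r
    obtain ⟨z₁, h1, h2⟩ := h.fix_rows (i, r) c
    obtain ⟨z₂, h3, h4⟩ := h.fix_rhs i r
    refine ⟨z₁ * z₂, ?_, ?_⟩
    · change extRow S.n (D i) r c = _ at h2
      rw [h2, h4, show (4 : ℝ) = 2 * 2 by norm_num, mul_pow]
      push_cast
      field_simp
    · rw [abs_mul, show 4 * S.L = 2 * S.L + 2 * S.L by ring, pow_add]
      exact mul_le_mul h1.le h3.le (abs_nonneg _) (by positivity)
  choose z hz hz' using h1
  refine ⟨∑ r, z r, ?_, ?_⟩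
  · rw [localGrad, Finset.mul_sum, Int.cast_sum]
    refine Finset.sum_congr rfl fun r _ => ?_
    rw [dotProduct_zero, sub_zero, hz]
  · refine lt_of_le_of_lt ((Finset.abs_sum_le_sum_abs _ _).trans
      (Finset.sum_le_sum fun r _ => hz' r)) ?_
    rw [Finset.sum_const, Finset.card_univ, Fintype.card_fin, nsmul_eq_mul]
    calc (S.n : ℤ) * 2 ^ (4 * S.L) ≤ 2 ^ S.Lam * 2 ^ (4 * S.L) := by
          have : (S.n : ℤ) ≤ 2 ^ S.Lam := by exact_mod_cast h.n_le
          gcongr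
      _ = 2 ^ (S.Lam + 4 * S.L) := by rw [pow_add]
      _ < 2 ^ S.W := pow_lt_pow_right₀ (by norm_num) (by have := h.W_ge; omega)

/-- If `ρ` is the square root of the leverage and `Δ = ‖A x‖`, then `7/8 Δ² ≤ ρ² ≤ Δ²` by
`lev_normal`. The `+ 2` in `scale` gives `2ρ ≤ 2^σ ≤ 4ρ`, hence both bounds. -/
theorem scale_bounds {P : S.Mat} (hP : Preconditions S.lam (stackMatrix D) P) {x : Fin S.d → ℝ}
    (hx : (stackMatrix D)ᵀ *ᵥ (stackMatrix D *ᵥ x) ≠ 0) :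
    l2norm (stackMatrix D *ᵥ x) ≤ 2 ^ S.scale P ((stackMatrix D)ᵀ *ᵥ (stackMatrix D *ᵥ x)) ∧
    (2 : ℝ) ^ S.scale P ((stackMatrix D)ᵀ *ᵥ (stackMatrix D *ᵥ x))
      ≤ 4 * l2norm (stackMatrix D *ᵥ x) := by
  obtain ⟨h1, h2⟩ := hP.lev_normal S.lam_pos x
  set g := (stackMatrix D)ᵀ *ᵥ (stackMatrix D *ᵥ x) with hg
  rw [← l2norm_sq] at h1 h2
  set Δ := l2norm (stackMatrix D *ᵥ x) with hΔ
  have hΔ0 : 0 ≤ Δ := l2norm_nonneg _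
  have hpos : 0 < lev P g := by
    refine lt_of_le_of_ne (hP.spd.lev_nonneg g) fun h0 => hx ?_
    rw [← h0] at h2
    have h3 : Δ ^ 2 = 0 := le_antisymm (by linarith) (sq_nonneg _)
    rw [hΔ, l2norm_sq, dotProduct_self_eq_zero] at h3
    rw [hg, h3, Matrix.mulVec_zero]
  set ρ := Real.sqrt (lev P g) with hρ
  have hρ0 : 0 < ρ := Real.sqrt_pos.2 hpos
  have hρ2 : ρ ^ 2 = lev P g := Real.sq_sqrt hpos.le
  rw [← hρ2] at h1 h2
  have h3 : ((2 : ℕ) : ℝ) ^ Int.log 2 ρ ≤ ρ := Int.zpow_log_le_self (by norm_num) hρ0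
  have h4 : ρ < ((2 : ℕ) : ℝ) ^ (Int.log 2 ρ + 1) := Int.lt_zpow_succ_log_self (by norm_num) ρ
  have h5 : (2 : ℝ) ^ S.scale P g = 4 * 2 ^ Int.log 2 ρ := by
    rw [scale, zpow_add₀ (by norm_num : (2 : ℝ) ≠ 0), mul_comm]
    norm_num
    rfl
  rw [zpow_add₀ (by norm_num)] at h4
  push_cast at h3 h4
  rw [zpow_one] at h4
  rw [h5]
  have h6 : ρ ≤ Δ := abs_le_of_sq_le_sq' h1 hΔ0 |>.2
  constructor
  · refine (abs_le_of_sq_le_sq' (?_ : Δ ^ 2 ≤ (2 * ρ) ^ 2) (by positivity)).2.trans (by linarith)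
    nlinarith
  · linarith

/-- The exponent itself must fit into a word. `‖A x*‖ ≤ ‖b‖` bounds it from above. From below, a
nonzero entry of `Aᵀ b = AᵀA x*` is a multiple of `4^(-L)`, while it is at most `2^(Lam+L) ‖A x*‖`.
-/
theorem abs_scale_lt (h : S.Fits D) {σ : ℤ}
    (hr : (stackMatrix D)ᵀ *ᵥ stackVector D ≠ 0)
    (h1 : l2norm (stackMatrix D *ᵥ lsq (stackMatrix D) (stackVector D)) ≤ 2 ^ σ)
    (h2 : (2 : ℝ) ^ σ ≤ 4 * l2norm (stackMatrix D *ᵥ lsq (stackMatrix D) (stackVector D))) :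
    |σ| < 2 ^ S.W := by
  set A := stackMatrix D with hA
  set b := stackVector D with hb
  set Δ := l2norm (A *ᵥ lsq A b) with hΔ
  have hup : Δ ≤ 2 ^ S.Lam * 2 ^ S.L :=
    (l2norm_lsq_le A b).trans (h.l2norm_le_of_abs_le (by positivity) fun r => (h.fixb r).abs_le)
  have hlow : (1 : ℝ) ≤ 2 ^ (3 * S.L + S.Lam) * Δ := by
    obtain ⟨c, hc⟩ : ∃ c, (Aᵀ *ᵥ b) c ≠ 0 := by
      by_contra hne
      push Not at hne
      exact hr (funext hne)
    choose z hz hz' using fun i => h.exists_int_localGrad i c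
    have e1 : 4 ^ S.L * (Aᵀ *ᵥ b) c = ((∑ i, z i : ℤ) : ℝ) := by
      have := h.sum_localGrad 0 c
      rw [Matrix.mulVec_zero, sub_zero] at this
      rw [← this, Finset.mul_sum, Int.cast_sum]
      exact Finset.sum_congr rfl fun i _ => hz i
    have e2 : (1 : ℝ) ≤ |4 ^ S.L * (Aᵀ *ᵥ b) c| := by
      have e3 : (∑ i, z i : ℤ) ≠ 0 := by
        intro h0
        rw [h0, Int.cast_zero] at e1
        exact hc ((mul_eq_zero.1 e1).resolve_left (by positivity))
      rw [e1]
      exact_mod_cast Int.one_le_abs e3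
    have e4 : |(Aᵀ *ᵥ b) c| ≤ 2 ^ S.Lam * (2 ^ S.L * Δ) := by
      rw [← normal_equations, Matrix.mulVec, dotProduct]
      refine (Finset.abs_sum_le_sum_abs _ _).trans ?_
      have e5 : ∀ r ∈ Finset.univ, |Aᵀ c r * (A *ᵥ lsq A b) r| ≤ 2 ^ S.L * Δ := fun r _ => by
        rw [abs_mul]
        exact mul_le_mul (h.fixA r c).abs_le (abs_le_l2norm _ r) (abs_nonneg _) (by positivity)
      refine (Finset.sum_le_sum e5).trans ?_
      rw [Finset.sum_const, Finset.card_univ, h.card_index, nsmul_eq_mul]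
      have := h.n_le_real
      have : 0 ≤ Δ := l2norm_nonneg _
      gcongr
    rw [abs_mul, abs_of_pos (by positivity)] at e2
    refine e2.trans ((mul_le_mul_of_nonneg_left e4 (by positivity)).trans (le_of_eq ?_))
    rw [pow_add, show (4 : ℝ) ^ S.L = 2 ^ (2 * S.L) by rw [pow_mul]; norm_num,
      show 3 * S.L = 2 * S.L + S.L by ring, pow_add]
    ring
  have hσ1 : σ ≤ ((S.L + S.Lam + 2 : ℕ) : ℤ) := by
    rw [← zpow_le_zpow_iff_right₀ (by norm_num : (1 : ℝ) < 2), zpow_natCast]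
    calc (2 : ℝ) ^ σ ≤ 4 * (2 ^ S.Lam * 2 ^ S.L) := h2.trans (by gcongr)
      _ = _ := by rw [pow_add, pow_add]; ring
  have hσ2 : -((3 * S.L + S.Lam : ℕ) : ℤ) ≤ σ := by
    rw [← zpow_le_zpow_iff_right₀ (by norm_num : (1 : ℝ) < 2), zpow_neg, zpow_natCast,
      inv_le_iff_one_le_mul₀ (by positivity), mul_comm]
    refine hlow.trans ?_
    gcongr
  have hW : (S.W : ℤ) < 2 ^ S.W := by exact_mod_cast Nat.lt_two_pow_self
  have := h.W_ge
  push_cast at hσ1 hσ2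
  rw [abs_lt]
  constructor <;> omega

theorem iterate_replicate_zero (σ : ℤ) (k : ℕ) : S.iterate σ (List.replicate k 0) = 0 := by
  induction k with
  | zero => rfl
  | succ k ih =>
    rw [List.replicate_succ, iterate, ih]
    funext c
    simp

/-- After all iterations the error is at most `2^σ / 2^it`, and `2^σ ≤ 4 ‖A x*‖`; this explains the
constant 4 in the condition on `ε`. -/
theorem output_solveProg (h : S.Fits D) {P : S.Mat}
    (hP : Preconditions S.lam (stackMatrix D) P) (ω : S.Seed) (H₀ : List S.Vec) {ε : ℝ}
    (hε : 4 ≤ ε * 2 ^ S.it) :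
    IsHighAccuracySolution ε (stackMatrix D) (stackVector D)
      (S.output ((S.solveProg P).run (S.exec D ω) H₀).2) := by
  set A := stackMatrix D with hA
  set b := stackVector D with hb
  rw [solveProg, Prog.run_bind]
  obtain ⟨hg1, hg2⟩ := Prog.run_gather (fun p : Fin S.s × Fin S.d => p.1)
    (fun p => (.inr (.inr (.inl p.2)) : S.Query)) S.decA (S.exec D ω) S.allEntries H₀
  rw [hg1]
  set F := ((Prog.gather (fun p : Fin S.s × Fin S.d => p.1)
    (fun p => (.inr (.inr (.inl p.2)) : S.Query)) S.decA S.allEntries).run (S.exec D ω) H₀).1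
    with hFdef
  have hF : ∀ p, (F p : ℝ) / 4 ^ S.L = S.localGrad (D p.1) 0 p.2 := fun p => by
    rw [hg2 p (by simp [allEntries])]
    change ((ofWord S.W (toWord S.W ⌊4 ^ S.L * S.localGrad (D p.1) 0 p.2⌋) : ℤ) : ℝ) / 4 ^ S.L = _
    obtain ⟨z, h1, h2⟩ := h.exists_int_localGrad p.1 p.2
    rw [h1, Int.floor_intCast, ofWord_toWord h2, ← h1, mul_div_cancel_left₀ _ (by positivity)]
  have hrhs : S.rhsVec F = Aᵀ *ᵥ b := funext fun c => by
    rw [rhsVec, Finset.sum_congr rfl fun i _ => hF (i, c), h.sum_localGrad, Matrix.mulVec_zero,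
      sub_zero]
  simp only [hrhs, hF]
  have hpos0 : (0 : ℝ) < 2 ^ S.it := by positivity
  split_ifs with h0
  · have hout : S.output ((Prog.bcastList (List.replicate (S.it + 1) (S.encV 0)) :
        S.SProg Unit).run (S.exec D ω) H₀).2 = 0 := by
      rw [Prog.run_bcastList]
      funext c
      rw [output, List.take_append_of_le_length (by simp), List.take_replicate,
        List.map_replicate, min_eq_left (by omega), S.decV_encV (z := 0) (by simp),
        iterate_replicate_zero]
    rw [hout]
    refine isHighAccuracySolution_of_le ?_
    have h1 : lsq A b = 0 := by rw [lsq, h0, Matrix.mulVec_zero]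
    rw [h1]
    simp [l2norm]
  · have hr : Aᵀ *ᵥ (A *ᵥ lsq A b) ≠ 0 := by rwa [normal_equations]
    obtain ⟨hs1, hs2⟩ := scale_bounds hP hr
    rw [← hA, normal_equations] at hs1 hs2
    set σ := S.scale P (Aᵀ *ᵥ b) with hσ
    have hσW : |σ| < 2 ^ S.W := h.abs_scale_lt h0 hs1 hs2
    rw [Prog.run, Prog.run_bind, Prog.run]
    obtain ⟨zs, hlen, hzs, -, hH, hx⟩ := h.run_iterProg hP hσW hs1 ω
      (f₀ := fun p => ⌊S.localGrad (D p.1) 0 p.2 / S.qgrid σ 0⌋) (fun p => rfl) H₀ S.it le_rfl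
    simp only [hH]
    have hout : S.output (zs.map S.encV ++ S.encV (fun _ => σ) :: H₀) = S.iterate σ zs := by
      funext c
      have hget : S.decV ((zs.map S.encV ++ S.encV (fun _ => σ) :: H₀).getD S.it (S.encV 0)) c
          = σ := by
        rw [List.getD_append_right _ _ _ _ (by simp [hlen])]
        simp only [List.length_map, hlen, Nat.sub_self, List.getD_cons_zero]
        rw [S.decV_encV fun _ => hσW]
      have htake : ((zs.map S.encV ++ S.encV (fun _ => σ) :: H₀).take S.it).map S.decV = zs := by
        rw [List.take_left' (by simp [hlen]), List.map_map]
        conv_rhs => rw [← List.map_id zs]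
        exact List.map_congr_left fun z' hz' => S.decV_encV (hzs z' hz')
      rw [output, hget, htake]
    rw [hout]
    refine isHighAccuracySolution_of_le (hx.trans ?_)
    rw [zpow_sub₀ (by norm_num : (2 : ℝ) ≠ 0), zpow_natCast, div_le_iff₀ hpos0]
    have := l2norm_nonneg (A *ᵥ lsq A b)
    calc (2 : ℝ) ^ σ ≤ 4 * l2norm (A *ᵥ lsq A b) := hs2
      _ ≤ ε * 2 ^ S.it * l2norm (A *ᵥ lsq A b) := by gcongr
      _ = _ := by ring

theorem output_mainProg (h : S.Fits D) {ω : S.Seed} {ε : ℝ} (hε : 4 ≤ ε * 2 ^ S.it)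
    (hsucc : ∃ u, ∀ l, sampleCount S.lam S.grd S.R (S.rows D) (ω u) l ≤ S.cap)
    (happ : ∀ u, Approx (chain S.lam S.grd S.R (S.rows D) (ω u) S.lv)
      (levelGram S.lam (S.rows D) (ω u).1 S.lv)) :
    IsHighAccuracySolution ε (stackMatrix D) (stackVector D)
      (S.output ((S.mainProg ω).run (S.exec D ω) []).2) := by
  rw [mainProg, Prog.run_bind]
  have hW : 3 * S.Lam + 2 * S.L + S.ell + 7 ≤ S.W := by have := h.W_ge; omega
  rcases run_trialsProg hW h.d_le h.n_le h.fix_rows ω [] S.T with ⟨-, h2⟩ | ⟨u, hu⟩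
  · obtain ⟨u, h3⟩ := hsucc
    obtain ⟨l, h4⟩ := h2 u u.2
    exact absurd (h3 l) (not_le.2 h4)
  · rw [hu, Option.getD_some]
    refine h.output_solveProg (preconditions_of_approx (chain_isSPD S.lam_pos _ _)
      (a := S.rows D) ?_ h.sum_rows_sq h.rowSpace) ω _ hε
    have := happ u
    rwa [levelGram, levelRows_top] at this

end Fits

end Setup

/-! ### The probability of failure -/

namespace Setup

variable {S : Setup}

/-- The parameters that give a probability of failure below `2 ^ (-C * Lam)`. -/
structure Tuned (S : Setup) (C : ℕ) : Prop where
  s_pos : 0 < S.s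
  n_pos : 0 < S.n
  d_pos : 0 < S.d
  Lam_pos : 0 < S.Lam
  sn_le : S.s * S.n ≤ 2 ^ S.Lam
  T_eq : S.T = C * S.Lam + 2
  lv_eq : S.lv = 8 * ((C + 2) * S.Lam) + 2 * S.Lam
  K_eq : S.K = 7 * S.lv
  R_eq : S.R = 1024 * (8 * ((C + 2) * S.Lam) + S.Lam)
  cap_eq : S.cap = 148 * (S.lv * S.K * S.R * S.d)
  L_pos : 0 < S.L
  d_le : S.d ≤ 2 ^ S.Lam
  W_eq : S.W = 3 * S.Lam + 4 * S.L + S.ell + 13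

noncomputable instance (S : Setup) :
    Fintype (TrialSeed (Fin S.d) S.Idx S.K (S.s * S.n) S.lv) := inferInstance

namespace Tuned

variable {C : ℕ} {D : Fin S.s → LocalData S.d}

theorem grd_sum_le (h : S.Fits D) (p : S.Idx) :
    S.grd * ∑ c, |S.rows D p c| ≤ (2 ^ (S.Lam + 2))⁻¹ := by
  have h1 : ∑ c, |S.rows D p c| ≤ 2 ^ S.Lam * 2 ^ S.L := by
    refine (Finset.sum_le_sum fun c _ => (h.fix_rows p c).abs_le).trans ?_
    rw [Finset.sum_const, Finset.card_univ, Fintype.card_fin, nsmul_eq_mul]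
    have := h.d_le_real
    gcongr
  rw [grd, inv_mul_le_iff₀ (by positivity), ← div_eq_mul_inv, le_div_iff₀ (by positivity)]
  refine (mul_le_mul_of_nonneg_right h1 (by positivity)).trans (le_of_eq ?_)
  rw [← pow_add, ← pow_add]
  congr 1
  ring

theorem five_mul_sq_le (ht : S.Tuned C) :
    5 * ((2 ^ (S.Lam + 2))⁻¹ : ℝ) ^ 2 ≤ 1 / (S.s * S.n : ℕ) := by
  have h1 : ((S.s * S.n : ℕ) : ℝ) ≤ 2 ^ S.Lam := by exact_mod_cast ht.sn_le
  have h2 : (0 : ℝ) < (S.s * S.n : ℕ) := by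
    exact_mod_cast Nat.mul_pos ht.s_pos ht.n_pos
  have h3 : (1 : ℝ) ≤ 2 ^ S.Lam := one_le_pow₀ (by norm_num)
  rw [le_div_iff₀ h2, inv_pow, mul_right_comm, ← div_eq_mul_inv, div_le_one (by positivity),
    pow_add, mul_pow]
  nlinarith

theorem nonempty_trialSeed (ht : S.Tuned C) :
    Nonempty (TrialSeed (Fin S.d) S.Idx S.K (S.s * S.n) S.lv) :=
  have : Nonempty (Fin (S.s * S.n)) := ⟨⟨0, Nat.mul_pos ht.s_pos ht.n_pos⟩⟩
  inferInstance

/-- Each source of failure (a row surviving all halvings, an underestimated leverage, a deviating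
sample) is pushed below `2^(-8E)` with `E = (C + 2) Lam`, after a union bound over at most `2^Lam`
rows or coordinates. `K = 7 lv` suffices because `(9/10)^7 ≤ 1/2`. -/
theorem error_le (ht : S.Tuned C) (hd : S.d ≤ 2 ^ S.Lam) :
    (Fintype.card S.Idx : ℝ) * (1 / 2) ^ S.lv + S.lv * (Fintype.card S.Idx * (9 / 10) ^ S.K
      + 2 * (Fintype.card (Fin S.d) * Real.exp (-((8 * ((C + 2) * S.Lam) + S.Lam : ℕ) : ℝ))))
      ≤ (3 * S.lv + 1) * (1 / 2) ^ (8 * ((C + 2) * S.Lam)) := by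
  set b := 8 * ((C + 2) * S.Lam) with hb
  have hι : (Fintype.card S.Idx : ℝ) ≤ 2 ^ S.Lam := by
    rw [Fintype.card_prod, Fintype.card_fin, Fintype.card_fin]
    exact_mod_cast ht.sn_le
  have hd' : (Fintype.card (Fin S.d) : ℝ) ≤ 2 ^ S.Lam := by
    rw [Fintype.card_fin]
    exact_mod_cast hd
  have key : ∀ k, b + S.Lam ≤ k → (2 : ℝ) ^ S.Lam * (1 / 2) ^ k ≤ (1 / 2) ^ b := by
    intro k hk
    calc (2 : ℝ) ^ S.Lam * (1 / 2) ^ k ≤ 2 ^ S.Lam * (1 / 2) ^ (b + S.Lam) := by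
          gcongr ?_ * ?_
          exact pow_le_pow_of_le_one (by norm_num) (by norm_num) hk
      _ = (1 / 2) ^ b * (2 * (1 / 2)) ^ S.Lam := by rw [pow_add, mul_pow]; ring
      _ = (1 / 2) ^ b := by norm_num
  have h1 : (Fintype.card S.Idx : ℝ) * (1 / 2) ^ S.lv ≤ (1 / 2) ^ b :=
    (mul_le_mul_of_nonneg_right hι (by positivity)).trans (key _ (by rw [ht.lv_eq]; omega))
  have h2 : (Fintype.card S.Idx : ℝ) * (9 / 10) ^ S.K ≤ (1 / 2) ^ b := by
    have h3 : (9 / 10 : ℝ) ^ S.K ≤ (1 / 2) ^ S.lv := by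
      rw [ht.K_eq, pow_mul]
      exact pow_le_pow_left₀ (by norm_num) (by norm_num) _
    exact (mul_le_mul hι h3 (by positivity) (by positivity)).trans
      (key _ (by rw [ht.lv_eq]; omega))
  have h3 : (Fintype.card (Fin S.d) : ℝ) * Real.exp (-((b + S.Lam : ℕ) : ℝ)) ≤ (1 / 2) ^ b := by
    have h4 : Real.exp (-((b + S.Lam : ℕ) : ℝ)) ≤ (1 / 2) ^ (b + S.Lam) := by
      have h5 : Real.exp (-1) ≤ 1 / 2 := by
        have := Real.exp_one_gt_d9
        rw [Real.exp_neg, one_div]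
        exact inv_anti₀ (by norm_num) (by linarith)
      calc Real.exp (-((b + S.Lam : ℕ) : ℝ)) = Real.exp (-1) ^ (b + S.Lam) := by
            rw [← Real.exp_nat_mul]; ring_nf
        _ ≤ _ := pow_le_pow_left₀ (Real.exp_pos _).le h5 _
    exact (mul_le_mul hd' h4 (Real.exp_pos _).le (by positivity)).trans (key _ le_rfl)
  have h4 : (0 : ℝ) ≤ S.lv := Nat.cast_nonneg _
  nlinarith

theorem mul_error_le {E T lv : ℕ} (hE : 2 ≤ E) (hT : T ≤ E) (hlv : lv ≤ 9 * E) :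
    (T : ℝ) * ((3 * lv + 1) * (1 / 2) ^ (8 * E)) ≤ 1 / 2 * (1 / 2) ^ E := by
  have h1 : 2 * (T * (3 * lv + 1)) ≤ 2 ^ (7 * E) := by
    have h2 : E ≤ 2 ^ E := Nat.lt_two_pow_self.le
    have h3 : 2 ^ (3 * 2) ≤ 2 ^ (3 * E) := Nat.pow_le_pow_right (by norm_num) (by omega)
    calc 2 * (T * (3 * lv + 1)) ≤ 2 * (E * (28 * E)) := by gcongr; omega
      _ ≤ 64 * (E * E) := by nlinarith
      _ ≤ 2 ^ (3 * E) * (2 ^ E * 2 ^ E) := by gcongr; exact h3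
      _ = 2 ^ (5 * E) := by rw [← pow_add, ← pow_add]; congr 1; ring
      _ ≤ 2 ^ (7 * E) := Nat.pow_le_pow_right (by norm_num) (by omega)
  have h2 : 2 * ((T : ℝ) * (3 * lv + 1)) ≤ 2 ^ (7 * E) := by exact_mod_cast h1
  have h3 : (1 / 2 : ℝ) ^ (8 * E) * 2 ^ (7 * E) = (1 / 2) ^ E := by
    rw [show 8 * E = E + 7 * E by ring, pow_add, mul_assoc, ← mul_pow]
    norm_num
  have h4 : (0 : ℝ) < (1 / 2) ^ (8 * E) := by positivity
  nlinarith

/-- The event that sampling succeeds. -/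
def Good (S : Setup) (D : Fin S.s → LocalData S.d) (ω : S.Seed) : Prop :=
  (∃ u, ∀ l, sampleCount S.lam S.grd S.R (S.rows D) (ω u) l ≤ S.cap) ∧
    ∀ u, Approx (chain S.lam S.grd S.R (S.rows D) (ω u) S.lv)
      (levelGram S.lam (S.rows D) (ω u).1 S.lv)

/-- The expected count per level is at most `(11 * 3 + 4) K R d = 37 K R d`. The cap is `4 * 37 * lv
* K * R * d`, so Markov's inequality over `lv` levels gives `1/4`. -/
theorem prob_abort_le (ht : S.Tuned C) (h : S.Fits D) :
    prob (fun ω : TrialSeed (Fin S.d) S.Idx S.K (S.s * S.n) S.lv =>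
      ∃ j, S.cap < sampleCount S.lam S.grd S.R (S.rows D) ω j)
      ≤ (3 * S.lv + 1) * (1 / 2) ^ (8 * ((C + 2) * S.Lam)) + 1 / 4 := by
  have hL := ht.Lam_pos
  have hCL : 0 < (C + 2) * S.Lam := Nat.mul_pos (by omega) hL
  have hlv : 0 < S.lv := by rw [ht.lv_eq]; omega
  have hK : 0 < S.K := by rw [ht.K_eq]; omega
  have hR : 0 < S.R := by rw [ht.R_eq]; omega
  have hd := ht.d_pos
  have hcap : 0 < S.cap := by rw [ht.cap_eq]; positivity
  refine (prob_sampleCount_gt S.lam_pos S.grd_pos (by exact_mod_cast hR) hK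
    (Nat.mul_pos ht.s_pos ht.n_pos) (by simp) (grd_sum_le h) (by positivity) ht.five_mul_sq_le
    (t := ((8 * ((C + 2) * S.Lam) + S.Lam : ℕ) : ℝ)) ?_ hcap).trans
    (add_le_add (ht.error_le h.d_le) ?_)
  · rw [ht.R_eq, Nat.cast_mul, Nat.cast_ofNat, mul_div_cancel_left₀ _ (by norm_num)]
  · have hc : (0 : ℝ) < S.cap := by exact_mod_cast hcap
    rw [← mul_div_assoc, div_le_iff₀ hc, ht.cap_eq, Fintype.card_fin]
    push_cast
    have hd1 : (1 : ℝ) ≤ S.d := by exact_mod_cast hd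
    have h1 : (0 : ℝ) ≤ S.lv * S.K * S.R := by positivity
    nlinarith

/-- A trial aborts with probability at most `1/2`, so all `C * Lam + 2` of them do with probability
at most a quarter of the target. A bad approximation in any trial has at most half of the target. -/
theorem prob_not_good_le (ht : S.Tuned C) (h : S.Fits D) :
    prob (fun ω : S.Seed => ¬ Good S D ω) ≤ (1 / 2) ^ (C * S.Lam) := by
  have := ht.nonempty_trialSeed
  have hL := ht.Lam_pos
  have hE : 2 ≤ (C + 2) * S.Lam := by nlinarith
  have hCE : (C + 2) * S.Lam = C * S.Lam + 2 * S.Lam := by ring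
  have hlv : S.lv ≤ 9 * ((C + 2) * S.Lam) := by rw [ht.lv_eq]; omega
  have hTE : S.T ≤ (C + 2) * S.Lam := by rw [ht.T_eq]; omega
  have hR : 0 < S.R := by rw [ht.R_eq]; omega
  set E := (C + 2) * S.Lam with hEdef
  have hsplit : ∀ ω : S.Seed, ¬ Good S D ω →
      (∀ u, ∃ j, S.cap < sampleCount S.lam S.grd S.R (S.rows D) (ω u) j) ∨
      ∃ u ∈ Finset.univ, ∃ j ≤ S.lv, ¬ Approx (chain S.lam S.grd S.R (S.rows D) (ω u) j)
        (levelGram S.lam (S.rows D) (ω u).1 j) := by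
    intro ω hω
    rw [Good, not_and_or] at hω
    rcases hω with h1 | h1
    · left
      push Not at h1
      exact h1
    · right
      push Not at h1
      obtain ⟨u, hu⟩ := h1
      exact ⟨u, Finset.mem_univ _, S.lv, le_rfl, hu⟩
  refine (prob_mono hsplit).trans ((prob_or _ _).trans ?_)
  have h1 : prob (fun ω : S.Seed =>
      ∀ u, ∃ j, S.cap < sampleCount S.lam S.grd S.R (S.rows D) (ω u) j) ≤ (1 / 2) ^ S.T := by
    rw [prob_forall (ι := Fin S.T) fun ω : TrialSeed (Fin S.d) S.Idx S.K (S.s * S.n) S.lv =>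
      ∃ j, S.cap < sampleCount S.lam S.grd S.R (S.rows D) ω j, Fintype.card_fin]
    refine pow_le_pow_left₀ (prob_nonneg _) ((ht.prob_abort_le h).trans ?_) _
    have h2 := mul_error_le (T := 1) hE (by omega) hlv
    rw [Nat.cast_one, one_mul] at h2
    have h3 : (1 / 2 : ℝ) ^ E ≤ (1 / 2) ^ 1 :=
      pow_le_pow_of_le_one (by norm_num) (by norm_num) (by omega)
    linarith
  have h2 : prob (fun ω : S.Seed => ∃ u ∈ Finset.univ, ∃ j ≤ S.lv,
      ¬ Approx (chain S.lam S.grd S.R (S.rows D) (ω u) j)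
        (levelGram S.lam (S.rows D) (ω u).1 j))
      ≤ S.T * ((3 * S.lv + 1) * (1 / 2) ^ (8 * E)) := by
    refine (prob_exists _ _).trans ?_
    have h3 : ∀ u ∈ (Finset.univ : Finset (Fin S.T)), prob (fun ω : S.Seed => ∃ j ≤ S.lv,
        ¬ Approx (chain S.lam S.grd S.R (S.rows D) (ω u) j)
          (levelGram S.lam (S.rows D) (ω u).1 j)) ≤ (3 * S.lv + 1) * (1 / 2) ^ (8 * E) := by
      intro u _
      rw [prob_update u]
      simp only [Function.update_self]
      rw [avg_const]
      refine (prob_chain_bad S.lam_pos S.grd_pos (by exact_mod_cast hR)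
        (Nat.mul_pos ht.s_pos ht.n_pos) (grd_sum_le h) (by positivity) ht.five_mul_sq_le
        (t := ((8 * E + S.Lam : ℕ) : ℝ)) ?_).trans (ht.error_le h.d_le)
      rw [ht.R_eq, Nat.cast_mul, Nat.cast_ofNat, mul_div_cancel_left₀ _ (by norm_num)]
    refine (Finset.sum_le_sum h3).trans ?_
    rw [Finset.sum_const, Finset.card_univ, Fintype.card_fin, nsmul_eq_mul]
  have h3 := mul_error_le hE hTE hlv
  have h4 : (1 / 2 : ℝ) ^ E ≤ (1 / 2) ^ (C * S.Lam) :=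
    pow_le_pow_of_le_one (by norm_num) (by norm_num) (by omega)
  have h5 : (1 / 2 : ℝ) ^ S.T = 1 / 4 * (1 / 2) ^ (C * S.Lam) := by
    rw [ht.T_eq, pow_add]; ring
  have h6 : (0 : ℝ) < (1 / 2) ^ (C * S.Lam) := by positivity
  linarith

end Tuned

end Setup

/-! ### The protocol and its cost -/

theorem ofReal_prob_eq {Ω : Type} [Fintype Ω] [Nonempty Ω] (p : Ω → Prop) :
    ENNReal.ofReal (prob p) = (PMF.uniformOfFintype Ω).toOuterMeasure {ω | p ω} := by
  classical
  rw [PMF.toOuterMeasure_uniformOfFintype_apply, prob, avg, ENNReal.ofReal_div_of_pos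
    (by exact_mod_cast Fintype.card_pos), ENNReal.ofReal_natCast]
  congr 1
  rw [Finset.sum_boole, ENNReal.ofReal_natCast, Fintype.card_subtype]
  congr!

namespace Setup

variable (S : Setup)

/-- The length of the code of a question. -/
def queryBits (C : ℕ) : ℕ := 7 * ((C + 2) * S.Lam) + 36 + Nat.clog 2 S.it

/-- A bound for the cost of the program. -/
def cost (C : ℕ) : ℕ :=
  S.T * (S.lv * (S.K * (S.s * (1 + (S.W + 1) * S.d)) + (S.s * ((1 + S.queryBits C) + (S.W + 1))
    + S.cap * S.d * ((1 + S.queryBits C) + (2 * S.L + 1)))))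
  + (S.it + 1) * (S.s * (1 + (S.W + 1) * S.d) + S.s * S.d * ((1 + S.queryBits C) + (S.W + 1)))

namespace Tuned

variable {S} {C : ℕ}

theorem T_le (ht : S.Tuned C) : S.T ≤ (C + 2) * S.Lam := by
  rw [ht.T_eq]
  have := ht.Lam_pos
  nlinarith

theorem lv_le (ht : S.Tuned C) : S.lv ≤ 9 * ((C + 2) * S.Lam) := by
  rw [ht.lv_eq]
  have : (C + 2) * S.Lam = C * S.Lam + 2 * S.Lam := by ring
  omega

theorem K_le (ht : S.Tuned C) : S.K ≤ 63 * ((C + 2) * S.Lam) := by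
  rw [ht.K_eq]
  have := ht.lv_le
  omega

theorem R_le (ht : S.Tuned C) : S.R ≤ 9216 * ((C + 2) * S.Lam) := by
  rw [ht.R_eq]
  have : (C + 2) * S.Lam = C * S.Lam + 2 * S.Lam := by ring
  omega

theorem cap_le (ht : S.Tuned C) : S.cap ≤ 773369856 * ((C + 2) * S.Lam) ^ 3 * S.d := by
  rw [ht.cap_eq]
  calc 148 * (S.lv * S.K * S.R * S.d)
      ≤ 148 * (9 * ((C + 2) * S.Lam) * (63 * ((C + 2) * S.Lam)) * (9216 * ((C + 2) * S.Lam)) * S.d) := by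
        have := ht.lv_le
        have := ht.K_le
        have := ht.R_le
        gcongr
    _ = _ := by ring

/-- Every question is preceded by its code, so the code has to be of logarithmic length. The number
of the iteration contributes `log it`, the source of the factor `log log ε⁻¹`. -/
theorem card_query_le (ht : S.Tuned C) : Fintype.card S.Query ≤ 2 ^ S.queryBits C := by
  simp only [Fintype.card_sum, Fintype.card_prod, Fintype.card_fin]
  set u := (C + 2) * S.Lam with hu
  have hΛu : S.Lam ≤ u := by
    have : u = C * S.Lam + 2 * S.Lam := by rw [hu]; ring
    omega
  have h1 : u ≤ 2 ^ u := Nat.lt_two_pow_self.le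
  have hd : S.d ≤ 2 ^ u := ht.d_le.trans (Nat.pow_le_pow_right (by norm_num) hΛu)
  have hT : S.T ≤ 2 ^ u := ht.T_le.trans h1
  have hlv : S.lv ≤ 2 ^ (u + 4) := by
    calc S.lv ≤ 9 * u := ht.lv_le
      _ ≤ 2 ^ u * 2 ^ 4 := by omega
      _ = 2 ^ (u + 4) := by rw [pow_add]
  have hcap : S.cap ≤ 2 ^ (30 + 4 * u) := by
    calc S.cap ≤ 773369856 * u ^ 3 * S.d := ht.cap_le
      _ ≤ 2 ^ 30 * (2 ^ u) ^ 3 * 2 ^ u := by gcongr; norm_num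
      _ = 2 ^ (30 + 4 * u) := by rw [← pow_mul, ← pow_add, ← pow_add]; congr 1; ring
  have hit : S.it ≤ 2 ^ Nat.clog 2 S.it := Nat.le_pow_clog (by norm_num) _
  set I := Nat.clog 2 S.it with hI
  have hq : 2 ^ S.queryBits C = 4 * 2 ^ (7 * u + 34 + I) := by
    rw [queryBits, ← hu, ← hI, show (4 : ℕ) = 2 ^ 2 by norm_num, ← pow_add]
    congr 1
    ring
  have e1 : S.T * S.lv ≤ 2 ^ (7 * u + 34 + I) := by
    calc S.T * S.lv ≤ 2 ^ u * 2 ^ (u + 4) := Nat.mul_le_mul hT hlv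
      _ = 2 ^ (u + (u + 4)) := by rw [← pow_add]
      _ ≤ _ := Nat.pow_le_pow_right (by norm_num) (by omega)
  have e2 : S.T * (S.lv * (S.cap * S.d)) ≤ 2 ^ (7 * u + 34 + I) := by
    calc S.T * (S.lv * (S.cap * S.d)) ≤ 2 ^ u * (2 ^ (u + 4) * (2 ^ (30 + 4 * u) * 2 ^ u)) :=
          Nat.mul_le_mul hT (Nat.mul_le_mul hlv (Nat.mul_le_mul hcap hd))
      _ = 2 ^ (7 * u + 34) := by rw [← pow_add, ← pow_add, ← pow_add]; congr 1; ring
      _ ≤ _ := Nat.pow_le_pow_right (by norm_num) (by omega)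
  have e3 : S.d ≤ 2 ^ (7 * u + 34 + I) :=
    hd.trans (Nat.pow_le_pow_right (by norm_num) (by omega))
  have e4 : S.it * S.d ≤ 2 ^ (7 * u + 34 + I) := by
    calc S.it * S.d ≤ 2 ^ I * 2 ^ u := Nat.mul_le_mul hit hd
      _ = 2 ^ (I + u) := by rw [pow_add]
      _ ≤ _ := Nat.pow_le_pow_right (by norm_num) (by omega)
  rw [hq]
  omega

/-- Sketches and iterations contribute multiples of `Y = s d (L + ell)`, the sampled rows multiples
of `Z = d² L`. The rest is polynomial in `Lam` and the code length of questions. -/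
theorem cost_le (ht : S.Tuned C) :
    S.cost C ≤ 4500000000000 * ((C + 2) * S.Lam) ^ 6 * S.Lam * (Nat.clog 2 S.it + 1) *
      (S.s * S.d * (S.L + S.ell) * (S.it + 1) + S.d ^ 2 * S.L) := by
  have hΛ := ht.Lam_pos
  have hL := ht.L_pos
  have hdp := ht.d_pos
  set u := (C + 2) * S.Lam with hu
  set Λ := S.Lam with hΛdef
  set I := Nat.clog 2 S.it with hI
  set X := S.L + S.ell with hX
  have hX1 : 1 ≤ X := by omega
  have hu1 : 1 ≤ u := by rw [hu]; nlinarith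
  set q := u * (I + 1) with hq
  have hq1 : 1 ≤ q := Nat.mul_pos hu1 (Nat.succ_pos _)
  have hqb : 1 + S.queryBits C ≤ 45 * q := by
    rw [queryBits, ← hu, ← hI, hq]
    nlinarith
  have hΛX : 1 ≤ Λ * X := Nat.mul_pos hΛ hX1
  have hW : S.W + 1 ≤ 22 * (Λ * X) := by
    rw [ht.W_eq]
    have h1 : Λ ≤ Λ * X := Nat.le_mul_of_pos_right _ hX1
    have h2 : X ≤ Λ * X := Nat.le_mul_of_pos_left _ hΛ
    omega
  have hcb : S.s * (1 + (S.W + 1) * S.d) ≤ 23 * (S.s * S.d * (Λ * X)) := by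
    have h1 : 1 + (S.W + 1) * S.d ≤ 23 * (Λ * X) * S.d := by nlinarith
    calc S.s * (1 + (S.W + 1) * S.d) ≤ S.s * (23 * (Λ * X) * S.d) := by gcongr
      _ = _ := by ring
  have hqW : (1 + S.queryBits C) + (S.W + 1) ≤ 67 * (q * (Λ * X)) := by nlinarith
  have hqL : (1 + S.queryBits C) + (2 * S.L + 1) ≤ 48 * (q * S.L) := by nlinarith
  set Y := S.s * S.d * X with hY
  set Z := S.d ^ 2 * S.L with hZ
  have h1 : S.K * (S.s * (1 + (S.W + 1) * S.d)) ≤ 1449 * (u * q * Λ * Y) := by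
    calc S.K * (S.s * (1 + (S.W + 1) * S.d)) ≤ (63 * u) * (23 * (S.s * S.d * (Λ * X))) :=
          Nat.mul_le_mul ht.K_le hcb
      _ = 1449 * (u * 1 * Λ * Y) := by rw [hY]; ring
      _ ≤ 1449 * (u * q * Λ * Y) := by gcongr
  have h2 : S.s * ((1 + S.queryBits C) + (S.W + 1)) ≤ 67 * (u * q * Λ * Y) := by
    calc S.s * ((1 + S.queryBits C) + (S.W + 1)) ≤ S.s * (67 * (q * (Λ * X))) := by gcongr
      _ = 67 * (1 * q * Λ * (S.s * 1 * X)) := by ring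
      _ ≤ 67 * (u * q * Λ * Y) := by rw [hY]; gcongr; exact hdp
  have h3 : S.cap * S.d * ((1 + S.queryBits C) + (2 * S.L + 1))
      ≤ 37121753088 * (u ^ 3 * q * Λ * Z) := by
    calc S.cap * S.d * ((1 + S.queryBits C) + (2 * S.L + 1))
        ≤ (773369856 * u ^ 3 * S.d) * S.d * (48 * (q * S.L)) := by
          have := ht.cap_le
          gcongr
      _ = 37121753088 * (u ^ 3 * q * 1 * Z) := by rw [hZ]; ring
      _ ≤ _ := by gcongr; exact hΛ
  have h4 : S.s * (1 + (S.W + 1) * S.d) + S.s * S.d * ((1 + S.queryBits C) + (S.W + 1))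
      ≤ 90 * (q * Λ * Y) := by
    calc S.s * (1 + (S.W + 1) * S.d) + S.s * S.d * ((1 + S.queryBits C) + (S.W + 1))
        ≤ 23 * (S.s * S.d * (Λ * X)) + S.s * S.d * (67 * (q * (Λ * X))) := by gcongr
      _ = 23 * (1 * Λ * Y) + 67 * (q * Λ * Y) := by rw [hY]; ring
      _ ≤ 23 * (q * Λ * Y) + 67 * (q * Λ * Y) := by gcongr
      _ = _ := by ring
  have hu3 : u ≤ u ^ 3 := Nat.le_self_pow (by norm_num) u
  have hu5 : 1 ≤ u ^ 5 := Nat.one_le_pow _ _ hu1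
  rw [cost]
  calc S.T * (S.lv * (S.K * (S.s * (1 + (S.W + 1) * S.d)) + (S.s * ((1 + S.queryBits C) + (S.W + 1))
        + S.cap * S.d * ((1 + S.queryBits C) + (2 * S.L + 1)))))
      + (S.it + 1) * (S.s * (1 + (S.W + 1) * S.d)
        + S.s * S.d * ((1 + S.queryBits C) + (S.W + 1)))
      ≤ u * (9 * u * (1449 * (u * q * Λ * Y) + (67 * (u * q * Λ * Y)
        + 37121753088 * (u ^ 3 * q * Λ * Z)))) + (S.it + 1) * (90 * (q * Λ * Y)) := by
        have := ht.T_le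
        have := ht.lv_le
        gcongr
    _ ≤ u * (9 * u * (1449 * (u ^ 3 * q * Λ * Y) + (67 * (u ^ 3 * q * Λ * Y)
        + 37121753088 * (u ^ 3 * q * Λ * Z)))) + (S.it + 1) * (90 * (u ^ 5 * q * Λ * Y)) := by
        gcongr
        exact Nat.le_mul_of_pos_left _ hu5
    _ = u ^ 5 * q * Λ * (13644 * (Y * 1) + 334095777792 * Z + 90 * (Y * (S.it + 1))) := by ring
    _ ≤ u ^ 5 * q * Λ * (13644 * (Y * (S.it + 1)) + 334095777792 * Z + 90 * (Y * (S.it + 1))) := by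
        gcongr
        omega
    _ ≤ u ^ 5 * q * Λ * (4500000000000 * (Y * (S.it + 1) + Z)) := by
        gcongr
        omega
    _ = _ := by rw [hq]; ring

theorem exists_protocol (ht : S.Tuned C) {ε : ℝ} (hε : 4 ≤ ε * 2 ^ S.it) :
    ∃ P : CoordinatorProtocol S.s (LocalData S.d) (Fin S.d → ℝ), ∀ D, S.Fits D →
      (∀ ω : P.Seed, ∃ T, P.EndsWith ω D T ∧ bitCount T ≤ 2 * S.cost C) ∧
      ENNReal.ofReal (1 - (1 / 2) ^ (C * S.Lam)) ≤ P.law.toOuterMeasure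
        {ω | ∃ T, P.EndsWith ω D T ∧
          IsHighAccuracySolution ε (stackMatrix D) (stackVector D) (P.coordinatorOut ω T) ∧
          ∀ i, P.machineOut ω i (D i) (T i) = P.coordinatorOut ω T} := by
  have := ht.nonempty_trialSeed
  have hV : Fintype.card S.Vec ≤ 2 ^ ((S.W + 1) * S.d) := by
    simp [← pow_mul]
  refine ⟨Prog.toProtocol ((S.W + 1) * S.d) (S.queryBits C) (PMF.uniformOfFintype S.Seed)
    S.mainProg S.answer (fun _ => S.output), fun D hD => ⟨fun ω => ?_, ?_⟩⟩
  · obtain ⟨T, h1, h2, -⟩ := Prog.toProtocol_endsWith ((S.W + 1) * S.d) (S.queryBits C) hV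
      ht.card_query_le (PMF.uniformOfFintype S.Seed) S.mainProg S.answer (fun _ => S.output) ω D
    exact ⟨T, h1, h2 _ (S.costLE_mainProg _ _ ω)⟩
  · have hp : 1 - (1 / 2) ^ (C * S.Lam) ≤ prob (fun ω : S.Seed => Good S D ω) := by
      have h1 := ht.prob_not_good_le hD
      rw [prob_not] at h1
      linarith
    refine (ENNReal.ofReal_le_ofReal hp).trans ?_
    rw [ofReal_prob_eq]
    refine MeasureTheory.measure_mono fun ω hω => ?_
    obtain ⟨T, h1, -, h3, h4⟩ := Prog.toProtocol_endsWith ((S.W + 1) * S.d) (S.queryBits C) hV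
      ht.card_query_le (PMF.uniformOfFintype S.Seed) S.mainProg S.answer (fun _ => S.output) ω D
    refine ⟨T, h1, ?_, fun i => (h4 i).trans h3.symm⟩
    rw [h3]
    exact hD.output_mainProg hε hω.1 hω.2

end Tuned

end Setup

/-! ### The main result -/

theorem clog_ceil_le {y : ℝ} (hy : 1 ≤ y) : (Nat.clog 2 ⌈y⌉₊ : ℝ) ≤ 2 + 2 * Real.log y := by
  have hlog : 0 ≤ Real.log y := Real.log_nonneg hy
  rcases le_or_gt ⌈y⌉₊ 1 with h | h
  · rw [Nat.clog_of_right_le_one h]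
    push_cast
    linarith
  have h1 := Nat.pow_pred_clog_lt_self (b := 2) (by norm_num) h
  have h2 : (2 : ℝ) ^ (Nat.clog 2 ⌈y⌉₊ - 1) ≤ 2 * y := by
    have h3 : ((2 ^ (Nat.clog 2 ⌈y⌉₊ - 1) : ℕ) : ℝ) < ⌈y⌉₊ := by exact_mod_cast h1
    push_cast at h3
    have := Nat.ceil_lt_add_one (by linarith : 0 ≤ y)
    linarith
  have h3 := Real.log_le_log (by positivity) h2
  rw [Real.log_pow, Real.log_mul (by norm_num) (by linarith),
    Nat.cast_sub (Nat.clog_pos (by norm_num) h)] at h3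
  have h4 := Real.log_two_gt_d9
  push_cast at h3
  nlinarith

theorem clog_le_mul_log {N : ℕ} (hN : 3 ≤ N) : (Nat.clog 2 N : ℝ) ≤ 4 * Real.log N := by
  have h1 := clog_ceil_le (y := N) (by exact_mod_cast (by omega : 1 ≤ N))
  rw [Nat.ceil_natCast] at h1
  have h2 : 1 ≤ Real.log N := by
    rw [Real.le_log_iff_exp_le (by positivity)]
    have h3 : (3 : ℝ) ≤ N := by exact_mod_cast hN
    linarith [Real.exp_one_lt_d9]
  linarith

theorem exists_trivial_protocol (s d : ℕ) :
    ∃ P : CoordinatorProtocol s (LocalData d) (Fin d → ℝ), ∀ D,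
      (∀ ω : P.Seed, ∃ T, P.EndsWith ω D T ∧ bitCount T = 0 ∧ P.coordinatorOut ω T = 0 ∧
        ∀ i, P.machineOut ω i (D i) (T i) = 0) := by
  refine ⟨⟨Unit, PMF.pure (), fun _ _ _ => false, fun _ _ _ _ => false, fun _ _ => none,
    fun _ _ _ _ => 0, fun _ _ => 0⟩, fun D ω => ⟨fun _ => [], ⟨⟨0, rfl⟩, ?_⟩, ?_, rfl,
    fun _ => rfl⟩⟩
  · have h : (List.finRange s).find? (fun _ => false) = none := List.find?_eq_none.2 (by simp)
    simp only [CoordinatorProtocol.next, h]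
  · simp [bitCount]

theorem stackMatrix_eq_zero {s n d L : ℕ} {D : Fin s → LocalData d} (hn : ∑ i, (D i).1 = n)
    (hA : ∀ r j, IsFixedPoint L (stackMatrix D r j)) (h : s * n * d * L = 0) :
    stackMatrix D = 0 := by
  ext ⟨i, r⟩ j
  have h1 : (D i).1 ≤ ∑ i, (D i).1 :=
    Finset.single_le_sum (f := fun i => (D i).1) (fun _ _ => Nat.zero_le _) (Finset.mem_univ i)
  have hs := i.pos
  have hr := r.pos
  have hd := j.pos
  have hn' : 0 < n := by omega
  have hL : L = 0 := by
    rcases mul_eq_zero.1 h with h2 | h2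
    · exact absurd h2 (by positivity)
    · exact h2
  obtain ⟨z, h2, h3⟩ := hA ⟨i, r⟩ j
  rw [hL, mul_zero, pow_zero, Int.abs_lt_one_iff] at h2
  rw [h3, h2]
  simp

/-- The parameters of the protocol. -/
def Setup.standard (C s n d L ell Lam it : ℕ) : Setup where
  s := s
  n := n
  d := d
  L := L
  ell := ell
  Lam := Lam
  T := C * Lam + 2
  lv := 8 * ((C + 2) * Lam) + 2 * Lam
  K := 7 * (8 * ((C + 2) * Lam) + 2 * Lam)
  R := 1024 * (8 * ((C + 2) * Lam) + Lam)
  cap := 148 * ((8 * ((C + 2) * Lam) + 2 * Lam) * (7 * (8 * ((C + 2) * Lam) + 2 * Lam)) *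
    (1024 * (8 * ((C + 2) * Lam) + Lam)) * d)
  it := it
  W := 3 * Lam + 4 * L + ell + 13

theorem cost_bound {C s d L ell Lam it I : ℕ} {c m κl el ll : ℝ}
    (hc : (c : ℝ) = 2 * 4500000000000 * (C + 2) ^ 6 * 4 ^ 7 * 9 * 21)
    (hΛ : (Lam : ℝ) ≤ 4 * m) (hell : (ell : ℝ) ≤ 2 + 2 * κl) (hit : (it : ℝ) + 1 ≤ 7 * el)
    (hI : (I : ℝ) + 1 ≤ 9 * ll) (hL : 1 ≤ L) (hκl : 0 ≤ κl) (hm : 0 ≤ m) (hll : 1 ≤ ll)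
    {cost : ℕ} (hcost : cost ≤ 4500000000000 * ((C + 2) * Lam) ^ 6 * Lam * (I + 1) *
      (s * d * (L + ell) * (it + 1) + d ^ 2 * L)) :
    ((2 * cost : ℕ) : ℝ) ≤ c * (s * d * (L + κl) * el + d ^ 2 * L) * (m * ll) ^ 7 := by
  have hL' : (1 : ℝ) ≤ L := by exact_mod_cast hL
  have hel : 0 ≤ el := by
    have : (0 : ℝ) ≤ it := Nat.cast_nonneg _
    linarith
  have h1 : (cost : ℝ) ≤ 4500000000000 * ((C + 2) * Lam) ^ 6 * Lam * (I + 1) *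
      (s * d * (L + ell) * (it + 1) + d ^ 2 * L) := by exact_mod_cast hcost
  have h2 : (s : ℝ) * d * (L + ell) * (it + 1) + d ^ 2 * L
      ≤ 21 * (s * d * (L + κl) * el + d ^ 2 * L) := by
    have h3 : (L : ℝ) + ell ≤ 3 * (L + κl) := by linarith
    have h4 : (s : ℝ) * d * (L + ell) * (it + 1) ≤ s * d * (3 * (L + κl)) * (7 * el) := by gcongr
    have h5 : (0 : ℝ) ≤ d ^ 2 * L := by positivity
    linarith
  have h3 : (Lam : ℝ) ^ 7 * (I + 1) ≤ 4 ^ 7 * 9 * (m * ll) ^ 7 := by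
    calc (Lam : ℝ) ^ 7 * (I + 1) ≤ (4 * m) ^ 7 * (9 * ll) := by gcongr
      _ ≤ (4 * m) ^ 7 * (9 * ll ^ 7) := by
          gcongr
          exact le_self_pow₀ hll (by norm_num)
      _ = _ := by ring
  have h6 : 0 ≤ (s : ℝ) * d * (L + κl) * el + d ^ 2 * L := by positivity
  push_cast
  calc 2 * (cost : ℝ) ≤ 2 * (4500000000000 * ((C + 2) * Lam) ^ 6 * Lam * (I + 1) *
      (s * d * (L + ell) * (it + 1) + d ^ 2 * L)) := by gcongr
    _ = 2 * 4500000000000 * (C + 2) ^ 6 * ((Lam : ℝ) ^ 7 * (I + 1)) *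
        (s * d * (L + ell) * (it + 1) + d ^ 2 * L) := by ring
    _ ≤ 2 * 4500000000000 * (C + 2) ^ 6 * (4 ^ 7 * 9 * (m * ll) ^ 7) *
        (21 * (s * d * (L + κl) * el + d ^ 2 * L)) := by gcongr
    _ = _ := by rw [hc]; ring

theorem mainTheorem4 (C : ℕ) :
    ∃ (K : ℝ) (p : ℕ), ∀ (s n d L : ℕ) (κ ε : ℝ), 1 ≤ κ → 0 < ε →
      ∃ P : CoordinatorProtocol s (LocalData d) (Fin d → ℝ),
        ∀ D : Fin s → LocalData d,
          ∑ i, (D i).1 = n →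
          (∀ r j, IsFixedPoint L (stackMatrix D r j)) →
          (∀ r, IsFixedPoint L (stackVector D r)) →
          condNumber (stackMatrix D) ≤ κ →
          (∀ ω : P.Seed, ∃ T, P.EndsWith ω D T ∧
            (bitCount T : ℝ) ≤
              K * (s * d * (L + Real.log κ) * max 1 (Real.log ε⁻¹) + d ^ 2 * L)
                * (Real.log (3 + s * n * d * L)
                    * Real.log (3 + Real.log (κ * max 1 ε⁻¹))) ^ p) ∧
          ENNReal.ofReal (1 - 1 / (n : ℝ) ^ C) ≤
            P.law.toOuterMeasure
              {ω | ∃ T, P.EndsWith ω D T ∧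
                IsHighAccuracySolution ε (stackMatrix D) (stackVector D) (P.coordinatorOut ω T) ∧
                ∀ i, P.machineOut ω i (D i) (T i) = P.coordinatorOut ω T} := by
  refine ⟨2 * 4500000000000 * (C + 2) ^ 6 * 4 ^ 7 * 9 * 21, 7, fun s n d L κ ε hκ hε => ?_⟩
  have hκl : 0 ≤ Real.log κ := Real.log_nonneg hκ
  have hmax : 1 ≤ κ * max 1 ε⁻¹ := one_le_mul_of_one_le_of_one_le hκ (le_max_left _ _)
  have hlogmax : 0 ≤ Real.log (κ * max 1 ε⁻¹) := Real.log_nonneg hmax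
  have hll : 1 ≤ Real.log (3 + Real.log (κ * max 1 ε⁻¹)) := by
    rw [Real.le_log_iff_exp_le (by linarith)]
    linarith [Real.exp_one_lt_d9]
  have hm : 0 ≤ Real.log (3 + s * n * d * L) := by
    have : (0 : ℝ) ≤ s * n * d * L := by positivity
    exact Real.log_nonneg (by linarith)
  -- In these cases 0 is a valid output without communication: either `A = 0` (for `L = 0` all
  -- entries vanish), or the error term alone covers `‖A x*‖`.
  by_cases htriv : s * n * d * L = 0 ∨ 1 ≤ ε
  · obtain ⟨P, hP⟩ := exists_trivial_protocol s d
    refine ⟨P, fun D hn hA _ _ => ⟨fun ω => ?_, ?_⟩⟩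
    · obtain ⟨T, h1, h2, -⟩ := hP D ω
      refine ⟨T, h1, ?_⟩
      rw [h2, Nat.cast_zero]
      positivity
    · have hall : {ω | ∃ T, P.EndsWith ω D T ∧
          IsHighAccuracySolution ε (stackMatrix D) (stackVector D) (P.coordinatorOut ω T) ∧
          ∀ i, P.machineOut ω i (D i) (T i) = P.coordinatorOut ω T} = Set.univ := by
        refine Set.eq_univ_of_forall fun ω => ?_
        obtain ⟨T, h1, -, h3, h4⟩ := hP D ω
        refine ⟨T, h1, ?_, fun i => (h4 i).trans h3.symm⟩
        rw [h3]
        exact isHighAccuracySolution_zero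
          (htriv.symm.imp id fun h => stackMatrix_eq_zero hn hA h)
      rw [hall, (P.law.toOuterMeasure_apply_eq_one_iff _).2 (Set.subset_univ _)]
      refine ENNReal.ofReal_le_one.2 ?_
      have : (0 : ℝ) ≤ 1 / (n : ℝ) ^ C := by positivity
      linarith
  push Not at htriv
  obtain ⟨hpos, hε1⟩ := htriv
  have hs : 0 < s := Nat.pos_of_ne_zero (by rintro rfl; simp at hpos)
  have hn : 0 < n := Nat.pos_of_ne_zero (by rintro rfl; simp at hpos)
  have hd : 0 < d := Nat.pos_of_ne_zero (by rintro rfl; simp at hpos)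
  have hL : 0 < L := Nat.pos_of_ne_zero (by rintro rfl; simp at hpos)
  have hε' : 1 ≤ ε⁻¹ := (one_le_inv₀ hε).2 hε1.le
  have hεl : 0 ≤ Real.log ε⁻¹ := Real.log_nonneg hε'
  set Lam := Nat.clog 2 (3 + s * n * d * L) with hLam
  set ell := Nat.clog 2 ⌈κ⌉₊ with hell
  -- The two extra iterations pay for the factor 4 lost in the scale.
  set it := Nat.clog 2 ⌈ε⁻¹⌉₊ + 2 with hit
  have hle : 3 + s * n * d * L ≤ 2 ^ Lam := Nat.le_pow_clog (by norm_num) _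
  have hle' : ∀ k, k ∣ s * n * d * L → k ≤ 2 ^ Lam := fun k hk =>
    (Nat.le_of_dvd (Nat.pos_of_ne_zero hpos) hk).trans (by omega)
  have hsn : s * n ≤ 2 ^ Lam := hle' _ ⟨d * L, by ring⟩
  have hdΛ : d ≤ 2 ^ Lam := hle' _ ⟨s * n * L, by ring⟩
  have hsΛ : s ≤ 2 ^ Lam := hle' _ ⟨n * d * L, by ring⟩
  have hnΛ : n ≤ 2 ^ Lam := hle' _ ⟨s * d * L, by ring⟩
  set S := Setup.standard C s n d L ell Lam it with hS
  have ht : S.Tuned C := ⟨hs, hn, hd, Nat.clog_pos (by norm_num) (by omega), hsn, rfl, rfl, rfl, rfl,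
    rfl, hL, hdΛ, rfl⟩
  have hεit : 4 ≤ ε * 2 ^ S.it := by
    change 4 ≤ ε * 2 ^ (Nat.clog 2 ⌈ε⁻¹⌉₊ + 2)
    have h1 : ((⌈ε⁻¹⌉₊ : ℕ) : ℝ) ≤ 2 ^ Nat.clog 2 ⌈ε⁻¹⌉₊ := by
      exact_mod_cast Nat.le_pow_clog (by norm_num) _
    have h2 : ε⁻¹ ≤ 2 ^ Nat.clog 2 ⌈ε⁻¹⌉₊ := (Nat.le_ceil _).trans h1
    have h3 : 1 ≤ ε * 2 ^ Nat.clog 2 ⌈ε⁻¹⌉₊ := by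
      calc (1 : ℝ) = ε * ε⁻¹ := (mul_inv_cancel₀ hε.ne').symm
        _ ≤ _ := by gcongr
    rw [pow_add]
    linarith
  obtain ⟨P, hP⟩ := ht.exists_protocol hεit
  refine ⟨P, fun D hDn hA hb hcond => ?_⟩
  have hfits : S.Fits D := by
    refine ⟨hDn, hA, hb, hcond.trans ?_, hsΛ, hnΛ, hdΛ, le_rfl⟩
    refine (Nat.le_ceil κ).trans ?_
    exact_mod_cast Nat.le_pow_clog (by norm_num) _
  obtain ⟨h1, h2⟩ := hP D hfits
  refine ⟨fun ω => ?_, le_trans (ENNReal.ofReal_le_ofReal ?_) h2⟩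
  · obtain ⟨T, h3, h4⟩ := h1 ω
    refine ⟨T, h3, le_trans (Nat.cast_le.2 h4) ?_⟩
    have hitR : (it : ℝ) ≤ 4 + 2 * Real.log ε⁻¹ := by
      have := clog_ceil_le hε'
      rw [hit]
      push_cast
      linarith
    refine cost_bound rfl ?_ (clog_ceil_le hκ) (it := it) ?_ ?_ hL hκl hm hll ht.cost_le
    · have := clog_le_mul_log (N := 3 + s * n * d * L) (by omega)
      push_cast at this
      exact this
    · have h5 := le_max_left 1 (Real.log ε⁻¹)
      have h6 := le_max_right 1 (Real.log ε⁻¹)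
      linarith
    · have h5 : (1 : ℝ) ≤ it := by
        rw [hit]; push_cast; linarith [Nat.cast_nonneg (α := ℝ) (Nat.clog 2 ⌈ε⁻¹⌉₊)]
      have h6 := clog_ceil_le h5
      rw [Nat.ceil_natCast] at h6
      have h7 : Real.log ε⁻¹ ≤ Real.log (κ * max 1 ε⁻¹) := by
        refine Real.log_le_log (by linarith) ?_
        rw [max_eq_right hε']
        exact le_mul_of_one_le_left (by linarith) hκ
      -- Because `it ≤ 4 + 2 x ≤ (3 + x)²` for `x = log ε⁻¹`.
      have h8 : Real.log it ≤ 2 * Real.log (3 + Real.log (κ * max 1 ε⁻¹)) := by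
        rw [← Real.log_rpow (by linarith)]
        refine Real.log_le_log (by linarith) ?_
        norm_num
        nlinarith
      change (Nat.clog 2 it : ℝ) + 1 ≤ _
      linarith
  · have h5 : (n : ℝ) ≤ 2 ^ Lam := by
      exact_mod_cast hnΛ
    have h6 : ((1 : ℝ) / 2) ^ (C * S.Lam) ≤ 1 / (n : ℝ) ^ C := by
      rw [one_div_pow, mul_comm, pow_mul]
      have hn' : (0 : ℝ) < n := by exact_mod_cast hn
      gcongr
      exact h5
    linarith
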